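/- Let $(M,\omega)$ be a symplectic manifold of dimension $4$, let $H_1,H_2\in C^\infty(M,\mathbb R)$ be Poisson commuting functions, and let $o=(a_o,b_o)\in\mathbb R^2$. Put $F=(H_1,H_2):M\to\mathbb R^2$ and $\Lambda_o=F^{-1}(o)$, and let $\mathcal X_1$ be the Hamiltonian vector field of $H_1$. Assume that - $F$ is proper and $\Lambda_o$ is connected; - $dH_1\neq 0$ at every point of $\Lambda_o$; - the critical points of $F$ on $\Lambda_o$ are transversally non-degenerate of saddle type: for any Poincaré section $\Sigma$ of $\mathcal X_1$ (a smooth embedded surface contained in a level set of $H_1$ and transversal to $\mathcal X_1$), every critical point of $H_2|_\Sigma$ lying on $\Lambda_o$ is non-degenerate with indefinite Hessian. Let $\gamma_i$ be a critical circle, that is, a connected component of the set of critical points of $F$ on $\Lambda_o$. Then around any point $m\in\gamma_i$ there exists a canonical chart $(x,y,\xi,\eta)$ centred at $m$ (that is, a smooth chart in which $\omega=d\xi\wedge dx+d\eta\wedge dy$ and $m$ has coordinates $0$) in which \[ H_1-a_o=\xi,\qquad H_2=\Phi(\xi,y\eta), \] for some smooth function $\Phi$ defined on a neighbourhood of the origin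 of $\mathbb R^2$ with $\partial_2\Phi(0,0)>0$. -/

import Mathlib

open Set Topology
open scoped Manifold ContDiff

noncomputable section

namespace SaddleSystem

/-- The model space `ℝ⁴`. The coordinates of a canonical chart are ordered as
`(x, y, ξ, η) = (q 0, q 1, q 2, q 3)`. -/
abbrev R4 : Type := EuclideanSpace ℝ (Fin 4)

section Defs

variable {M : Type*} [TopologicalSpace M] [ChartedSpace R4 M]

/-- A field of alternating 2-forms on the tangent spaces of a 4-manifold
(no regularity is imposed here). -/
abbrev TwoForm (M : Type*) [TopologicalSpace M] [ChartedSpace R4 M] : Type _ :=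
  ∀ p : M, TangentSpace (𝓡 4) p [⋀^Fin 2]→L[ℝ] ℝ

/-- The expression of a 2-form in a chart `e`: the pullback of the form by `e⁻¹`. It is meaningful
at the points of `e.target`. -/
def inChart (Ω : TwoForm M) (e : OpenPartialHomeomorph M R4) (q : R4) :
    R4 [⋀^Fin 2]→L[ℝ] ℝ :=
  (Ω (e.symm q)).compContinuousLinearMap (mfderiv (𝓡 4) (𝓡 4) e.symm q)

variable (M) in
/-- A symplectic form on a 4-manifold: a smooth, closed, non-degenerate 2-form. -/
structure SymplecticForm where
  /-- the underlying 2-form -/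
  form : TwoForm M
  smooth : ∀ e ∈ atlas R4 M, ContDiffOn ℝ ∞ (inChart form e) e.target
  closed : ∀ e ∈ atlas R4 M, ∀ q ∈ e.target, extDeriv (inChart form e) q = 0
  nondegenerate : ∀ (p : M) (v : TangentSpace (𝓡 4) p),
    (∀ w : TangentSpace (𝓡 4) p, form p ![v, w] = 0) → v = 0

/-- The map `v ↦ Ω(v, ·)` from a tangent space to its dual. -/
def SymplecticForm.flat (Ω : SymplecticForm M) (p : M) :
    TangentSpace (𝓡 4) p →ₗ[ℝ] Module.Dual ℝ (TangentSpace (𝓡 4) p) :=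
  LinearMap.mk₂ ℝ (fun v w => Ω.form p ![v, w])
    (fun v v' w => (Ω.form p).toAlternatingMap.map_vecCons_add ![w] v v')
    (fun c v w => (Ω.form p).toAlternatingMap.map_vecCons_smul ![w] c v)
    (fun v w w' => by
      have h := (Ω.form p).map_update_add ![v, w] 1 w w'
      have e : ∀ z, Function.update ![v, w] 1 z = ![v, z] := by
        intro z; ext i; fin_cases i <;> simp
      simpa only [e] using h)
    (fun c v w => by
      have h := (Ω.form p).map_update_smul ![v, w] 1 c w
      have e : ∀ z, Function.update ![v, w] 1 z = ![v, z] := by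
        intro z; ext i; fin_cases i <;> simp
      simpa only [e] using h)

theorem SymplecticForm.flat_apply (Ω : SymplecticForm M) (p : M) (v w : TangentSpace (𝓡 4) p) :
    Ω.flat p v w = Ω.form p ![v, w] := rfl

instance (p : M) : FiniteDimensional ℝ (TangentSpace (𝓡 4) p) :=
  inferInstanceAs (FiniteDimensional ℝ R4)

/-- The isomorphism `v ↦ Ω(v, ·)` from a tangent space to its dual. -/
def SymplecticForm.flatEquiv (Ω : SymplecticForm M) (p : M) :
    TangentSpace (𝓡 4) p ≃ₗ[ℝ] Module.Dual ℝ (TangentSpace (𝓡 4) p) :=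
  LinearEquiv.ofInjectiveOfFinrankEq (Ω.flat p)
    ((injective_iff_map_eq_zero _).2 fun v hv =>
      Ω.nondegenerate p v fun w => by rw [← Ω.flat_apply, hv]; rfl)
    (Subspace.dual_finrank_eq).symm

/-- The differential of a function at a point, as a linear form on the tangent space. -/
def differential (H : M → ℝ) (p : M) : Module.Dual ℝ (TangentSpace (𝓡 4) p) :=
  (mfderiv (𝓡 4) 𝓘(ℝ, ℝ) H p).toLinearMap

/-- The Hamiltonian vector field `X_H` of `H`: the vector field with `Ω(X_H, ·) = - dH`
(so that `X_ξ = ∂/∂x` for `Ω = dξ ∧ dx + dη ∧ dy`). -/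
def SymplecticForm.hamiltonianField (Ω : SymplecticForm M) (H : M → ℝ) (p : M) :
    TangentSpace (𝓡 4) p :=
  (Ω.flatEquiv p).symm (-differential H p)

theorem SymplecticForm.form_hamiltonianField (Ω : SymplecticForm M) (H : M → ℝ) (p : M)
    (w : TangentSpace (𝓡 4) p) :
    Ω.form p ![Ω.hamiltonianField H p, w] = -differential H p w := by
  have h : Ω.flatEquiv p (Ω.hamiltonianField H p) = -differential H p :=
    (Ω.flatEquiv p).apply_symm_apply _
  exact DFunLike.congr_fun h w

/-- The Poisson bracket `{f, g} = Ω(X_f, X_g)`. -/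
def SymplecticForm.poissonBracket (Ω : SymplecticForm M) (f g : M → ℝ) (p : M) : ℝ :=
  Ω.form p ![Ω.hamiltonianField f p, Ω.hamiltonianField g p]

/-- `σ`, restricted to the open set `V ⊆ ℝ²`, parametrises a Poincaré section of the Hamiltonian
vector field `X_H`: it is a smooth embedding of `V` as a surface that lies in one level set of
`H` and is transversal to `X_H`. -/
structure SymplecticForm.IsPoincareSection (Ω : SymplecticForm M) (H : M → ℝ)
    (V : Set (ℝ × ℝ)) (σ : ℝ × ℝ → M) : Prop where
  isOpen : IsOpen V
  smooth : ContMDiffOn 𝓘(ℝ, ℝ × ℝ) (𝓡 4) ∞ σ V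
  embedding : IsEmbedding (V.domRestrict σ)
  immersive : ∀ u ∈ V, Function.Injective (mfderiv 𝓘(ℝ, ℝ × ℝ) (𝓡 4) σ u)
  level : ∃ a : ℝ, ∀ u ∈ V, H (σ u) = a
  transversal : ∀ u ∈ V,
    Ω.hamiltonianField H (σ u) ∉ range (mfderiv 𝓘(ℝ, ℝ × ℝ) (𝓡 4) σ u)

/-- The Hessian of a function on `ℝ²`. -/
def hessian (f : ℝ × ℝ → ℝ) (u v w : ℝ × ℝ) : ℝ :=
  fderiv ℝ (fderiv ℝ f) u v w

/-- The momentum map `F = (H₁, H₂)`. -/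
def momentumMap (H₁ H₂ : M → ℝ) (p : M) : ℝ × ℝ := (H₁ p, H₂ p)

/-- The level set `Λ_o = F⁻¹(o)`. -/
def fibre (H₁ H₂ : M → ℝ) (o : ℝ × ℝ) : Set M := momentumMap H₁ H₂ ⁻¹' {o}

/-- The set `γ` of critical points of `F` on `Λ_o`. -/
def criticalSet (H₁ H₂ : M → ℝ) (o : ℝ × ℝ) : Set M :=
  {p ∈ fibre H₁ H₂ o |
    ¬ Function.Surjective (mfderiv (𝓡 4) 𝓘(ℝ, ℝ × ℝ) (momentumMap H₁ H₂) p)}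

/-- The critical circles `γ_i`: the connected components of `γ`. -/
def IsCriticalCircle (H₁ H₂ : M → ℝ) (o : ℝ × ℝ) (C : Set M) : Prop :=
  ∃ p ∈ criticalSet H₁ H₂ o, C = connectedComponentIn (criticalSet H₁ H₂ o) p

/-- The standing assumptions: `H₁, H₂` are smooth Poisson commuting functions, `F = (H₁, H₂)` is
proper, `Λ_o` is connected, `H₁` is non-singular on `Λ_o`, and the critical points of `F` on `Λ_o`
are transversally non-degenerate, of saddle type: every critical point, lying on `Λ_o`, of the
restriction of `H₂` to a Poincaré section of `X_{H₁}` is non-degenerate, and it is neither a local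
minimum nor a local maximum (its Hessian is indefinite). -/
structure IsSaddleSystem (Ω : SymplecticForm M) (H₁ H₂ : M → ℝ) (o : ℝ × ℝ) : Prop where
  smooth₁ : ContMDiff (𝓡 4) 𝓘(ℝ, ℝ) ∞ H₁
  smooth₂ : ContMDiff (𝓡 4) 𝓘(ℝ, ℝ) ∞ H₂
  commute : ∀ p, Ω.poissonBracket H₁ H₂ p = 0
  proper : IsProperMap (momentumMap H₁ H₂)
  connected : IsConnected (fibre H₁ H₂ o)
  nonsingular : ∀ p ∈ fibre H₁ H₂ o, differential H₁ p ≠ 0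
  morse : ∀ (V : Set (ℝ × ℝ)) (σ : ℝ × ℝ → M), Ω.IsPoincareSection H₁ V σ →
    ∀ u ∈ V, σ u ∈ fibre H₁ H₂ o → fderiv ℝ (H₂ ∘ σ) u = 0 →
      ∀ v, (∀ w, hessian (H₂ ∘ σ) u v w = 0) → v = 0
  saddle : ∀ (V : Set (ℝ × ℝ)) (σ : ℝ × ℝ → M), Ω.IsPoincareSection H₁ V σ →
    ∀ u ∈ V, σ u ∈ fibre H₁ H₂ o → fderiv ℝ (H₂ ∘ σ) u = 0 →
      (∃ v, 0 < hessian (H₂ ∘ σ) u v v) ∧ ∃ w, hessian (H₂ ∘ σ) u w w < 0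

/-- A canonical (symplectic) chart `(x, y, ξ, η)` centred at `m`: a chart of the smooth structure
in which `Ω = dξ ∧ dx + dη ∧ dy`. -/
structure SymplecticForm.IsCanonicalChartAt [IsManifold (𝓡 4) ∞ M] (Ω : SymplecticForm M)
    (χ : OpenPartialHomeomorph M R4) (m : M) : Prop where
  mem_maximalAtlas : χ ∈ IsManifold.maximalAtlas (𝓡 4) ∞ M
  mem_source : m ∈ χ.source
  centred : χ m = 0
  canonical : ∀ q ∈ χ.target, ∀ v w : R4,
    inChart Ω.form χ q ![v, w] =
      (v 2 * w 0 - v 0 * w 2) + (v 3 * w 1 - v 1 * w 3)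

end Defs

end SaddleSystem

end

/-! The statement is local at `m`. Since `dH₁ ≠ 0` there, a three-dimensional slice transversal to
the Hamiltonian field of `H₁` carries coordinates `(s, u, v)` with `s = H₁ - a_o`. At a critical
point of `F` the form `dH₂` vanishes on `ker dH₁`, so `H₂` is critical on the surface `s = 0` of the
slice, which is a Poincaré section. Its Hessian there is indefinite, and the Morse lemma with
parameter `s` (`exists_morse_saddle`) gives `H₂ = h₀(s) + uv` on the slice. The flow of the field
(`exists_flow_box`) adds a time `t`. Both functions are independent of `t`, and so is `ω`, because
its contraction with `∂_t` is the closed form `-ds`.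

Hence `ω = ds ∧ dt + ds ∧ (c₁ du + c₂ dv) + g du ∧ dv` with coefficients depending on `(s, u, v)`
only. Nondegeneracy forces `g ≠ 0`, and exchanging `u` and `v` makes `g < 0`. The main point
(`exists_isochore`) is to find functions `Y`, `N` of `(s, u, v)` with `dN ∧ dY = g du ∧ dv` modulo
`ds` and `uv = b(s, YN)`. Then `ω - ds ∧ dt - dN ∧ dY = ds ∧ β`, and closedness makes `β` closed on
the surfaces `s = const`, so `β = dS` modulo `ds` (`exists_potential`). The coordinates `(t + S, Y,
s, N)` are canonical (`exists_darboux_saddle`), with `Φ(s, c) = h₀(s) + b(s, c)`.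

The analytic core is the cohomological equation `g = A(s, uv) + (u ∂_u - v ∂_v) f`
(`exists_hyp_cohomological`). It is solved power by power in `v`, the resonant terms `(uv)ʲ` going
into `A`. Borel's lemma sums the formal solution and leaves a remainder that is flat on `v = 0`.
That remainder is integrated along the hyperbolic flow for `t → +∞` (`exists_hyp_eq_of_flat`): the
flow contracts `v`, and flatness beats the exponential growth of the derivatives.

Smooth dependence of integrals and flows on parameters comes from the smoothness of superposition
operators on spaces of continuous curves. Germs are represented throughout by globally smooth
functions, and identities are asserted near the point only. -/

noncomputable section

namespace SaddleSystem

universe u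

set_option linter.unusedSectionVars false

/-! ### Smoothness of superposition operators on spaces of continuous functions -/

section Nemytskii

variable {K : Type} [TopologicalSpace K] [CompactSpace K]
variable {E F : Type u} [NormedAddCommGroup E] [NormedSpace ℝ E] [NormedAddCommGroup F]
  [NormedSpace ℝ F]

/-- Pointwise application of a continuous family of operators to a continuous family of vectors. -/
def pointwiseApply (K : Type) [TopologicalSpace K] [CompactSpace K] (E F : Type u)
    [NormedAddCommGroup E] [NormedSpace ℝ E] [NormedAddCommGroup F] [NormedSpace ℝ F] :
    C(K, E →L[ℝ] F) →L[ℝ] C(K, E) →L[ℝ] C(K, F) :=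
  LinearMap.mkContinuous₂
    (LinearMap.mk₂ ℝ (fun (A : C(K, E →L[ℝ] F)) (h : C(K, E)) => (⟨fun k => A k (h k), by fun_prop⟩ : C(K, F)))
      (fun _ _ _ => by ext; simp) (fun _ _ _ => by ext; simp)
      (fun _ _ _ => by ext; simp) (fun _ _ _ => by ext; simp)) 1
    (fun A h => by
      rw [one_mul]
      refine (ContinuousMap.norm_le _ (mul_nonneg (norm_nonneg A) (norm_nonneg h))).2 fun k => ?_
      exact (A k).le_of_opNorm_le_of_le (A.norm_coe_le_norm k) (h.norm_coe_le_norm k))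

/-- Composition with a continuous function `f`, as a map between spaces of continuous functions. -/
def superposition (K : Type) [TopologicalSpace K] {E F : Type u} [TopologicalSpace E]
    [TopologicalSpace F] (f : E → F) (hf : Continuous f) (γ : C(K, E)) : C(K, F) :=
  (⟨f, hf⟩ : C(E, F)).comp γ

@[simp] theorem superposition_apply (f : E → F) (hf : Continuous f) (γ : C(K, E)) (k : K) :
    superposition K f hf γ k = f (γ k) := rfl

theorem continuous_superposition (f : E → F) (hf : Continuous f) :
    Continuous (superposition K f hf) :=
  ContinuousMap.continuous_postcomp _

/-- Superposition by `fderiv ℝ f` is continuous in the sup norm, so the mean value inequality on the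
segments `[γ k, γ k + h k]` has an error bound `ε ‖h‖` uniform in `k`. -/
theorem hasFDerivAt_superposition {f : E → F} (hf : ContDiff ℝ 1 f) (γ : C(K, E)) :
    HasFDerivAt (superposition K f hf.continuous)
      (pointwiseApply K E F (superposition K (fderiv ℝ f) (hf.continuous_fderiv one_ne_zero) γ))
      γ := by
  rw [hasFDerivAt_iff_isLittleO_nhds_zero, Asymptotics.isLittleO_iff]
  intro ε hε
  have hc := (continuous_superposition (K := K) (fderiv ℝ f)
    (hf.continuous_fderiv one_ne_zero)).continuousAt (x := γ)
  obtain ⟨δ, hδ, hδ'⟩ := Metric.continuousAt_iff.1 hc ε hε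
  filter_upwards [Metric.ball_mem_nhds (0 : C(K, E)) hδ] with h hh
  rw [mem_ball_zero_iff] at hh
  refine (ContinuousMap.norm_le _ (by positivity)).2 fun k => ?_
  have key : ∀ y ∈ segment ℝ (γ k) (γ k + h k),
      ‖fderiv ℝ f y - fderiv ℝ f (γ k)‖ ≤ ε := by
    intro y hy
    rw [segment_eq_image'] at hy
    obtain ⟨τ, hτ, rfl⟩ := hy
    have h1 : dist (γ + τ • h) γ < δ := by
      rw [dist_eq_norm, add_sub_cancel_left, norm_smul, Real.norm_of_nonneg hτ.1]
      exact lt_of_le_of_lt (mul_le_of_le_one_left (norm_nonneg _) hτ.2) hh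
    have h2 := hδ' h1
    rw [dist_eq_norm] at h2
    have h3 := ((superposition K (fderiv ℝ f) (hf.continuous_fderiv one_ne_zero) (γ + τ • h)
      - superposition K (fderiv ℝ f) (hf.continuous_fderiv one_ne_zero) γ).norm_coe_le_norm k)
    simpa using h3.trans h2.le
  have := (convex_segment (γ k) (γ k + h k)).norm_image_sub_le_of_norm_hasFDerivWithin_le'
    (f := f) (φ := fderiv ℝ f (γ k))
    (fun y _ => ((hf.differentiable one_ne_zero y).hasFDerivAt).hasFDerivWithinAt) key
    (left_mem_segment ℝ _ _) (right_mem_segment ℝ _ _)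
  rw [add_sub_cancel_left] at this
  exact this.trans (mul_le_mul_of_nonneg_left (h.norm_coe_le_norm k) hε.le)

/-- The derivative is again a superposition operator, for `fderiv ℝ f`, followed by a continuous
linear map. The induction lets the target vary because `fderiv ℝ f` takes values in `E →L[ℝ] F`; a
common universe for `E` and `F` keeps that space in range. -/
theorem contDiff_superposition_nat (n : ℕ) : ∀ {F : Type u} [NormedAddCommGroup F]
    [NormedSpace ℝ F] {f : E → F} (hf : ContDiff ℝ n f),
    ContDiff ℝ n (superposition K f hf.continuous) := by
  induction n with
  | zero =>
    intro F _ _ f hf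
    exact contDiff_zero.2 (continuous_superposition f hf.continuous)
  | succ n ih =>
    intro F _ _ f hf
    have h1 : ContDiff ℝ 1 f := hf.of_le (by exact_mod_cast Nat.le_add_left 1 n)
    have h2 : ContDiff ℝ n (fderiv ℝ f) := hf.fderiv_right (by norm_cast)
    have := (contDiff_succ_iff_hasFDerivAt (n := n) (f := superposition K f hf.continuous)).2
      ⟨fun γ => pointwiseApply K E F (superposition K (fderiv ℝ f) h2.continuous γ),
        by exact (pointwiseApply K E F).contDiff.comp (ih h2), fun γ => hasFDerivAt_superposition h1 γ⟩
    exact_mod_cast this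

theorem contDiff_superposition {f : E → F} (hf : ContDiff ℝ ∞ f) :
    ContDiff ℝ ∞ (superposition K f hf.continuous) :=
  contDiff_infty.2 fun n => contDiff_superposition_nat n (hf.of_le (by exact_mod_cast le_top))

end Nemytskii

/-! ### Primitives and integrals depending on a parameter -/

section Primitive

variable {E : Type u} [NormedAddCommGroup E] [NormedSpace ℝ E]

theorem continuous_primitive_IccExtend (γ : C(Icc (-1 : ℝ) 1, E)) :
    Continuous fun σ : Icc (-1 : ℝ) 1 => ∫ τ in (0 : ℝ)..σ, IccExtend (by norm_num) γ τ := by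
  have h : Continuous (IccExtend (by norm_num : (-1 : ℝ) ≤ 1) γ) := γ.continuous.Icc_extend'
  exact (intervalIntegral.continuous_primitive (fun a b => h.intervalIntegrable a b) 0).comp
    continuous_subtype_val

/-- The operator `γ ↦ (σ ↦ ∫₀^σ γ)` on continuous functions on `[-1, 1]`. -/
def primitive (E : Type u) [NormedAddCommGroup E] [NormedSpace ℝ E] :
    C(Icc (-1 : ℝ) 1, E) →L[ℝ] C(Icc (-1 : ℝ) 1, E) :=
  LinearMap.mkContinuous
    { toFun := fun γ => ⟨_, continuous_primitive_IccExtend γ⟩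
      map_add' := fun γ δ => by
        ext σ
        have h (γ : C(Icc (-1 : ℝ) 1, E)) :
          Continuous (IccExtend (by norm_num : (-1 : ℝ) ≤ 1) γ) := γ.continuous.Icc_extend'
        simp only [ContinuousMap.coe_mk, ContinuousMap.add_apply]
        rw [← intervalIntegral.integral_add ((h γ).intervalIntegrable _ _)
          ((h δ).intervalIntegrable _ _)]
        rfl
      map_smul' := fun c γ => by
        ext σ
        simp only [ContinuousMap.coe_mk, ContinuousMap.smul_apply, RingHom.id_apply]
        rw [← intervalIntegral.integral_smul]
        rfl } 1
    (fun γ => by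
      rw [one_mul]
      refine (ContinuousMap.norm_le _ (by positivity)).2 fun σ => ?_
      have := intervalIntegral.norm_integral_le_of_norm_le_const (a := 0) (b := (σ : ℝ))
        (f := IccExtend (by norm_num : (-1 : ℝ) ≤ 1) γ) (C := ‖γ‖)
        (fun x _ => γ.norm_coe_le_norm _)
      refine this.trans ?_
      rw [sub_zero]
      exact mul_le_of_le_one_right (norm_nonneg _) (abs_le.2 ⟨by linarith [σ.2.1], σ.2.2⟩))

theorem primitive_apply (γ : C(Icc (-1 : ℝ) 1, E)) (σ : Icc (-1 : ℝ) 1) :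
    primitive E γ σ = ∫ τ in (0 : ℝ)..σ, IccExtend (by norm_num) γ τ := rfl

/-- The integral is a composition of smooth maps: the affine map from `x` to the curve `τ ↦ (x, τ)`,
superposition by `f`, the primitive, and evaluation at `1`. -/
theorem contDiff_parametric_integral {G : Type u} [NormedAddCommGroup G] [NormedSpace ℝ G]
    {f : E × ℝ → G} (hf : ContDiff ℝ ∞ f) :
    ContDiff ℝ ∞ fun x => ∫ τ in (0 : ℝ)..1, f (x, τ) := by
  let i : C(Icc (-1 : ℝ) 1, E × ℝ) := ⟨fun τ => (0, τ), by fun_prop⟩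
  let c : E →L[ℝ] C(Icc (-1 : ℝ) 1, E × ℝ) :=
    LinearMap.mkContinuous
      { toFun := fun x => ContinuousMap.const _ (x, (0 : ℝ))
        map_add' := fun x y => by ext <;> simp
        map_smul' := fun x y => by ext <;> simp } 1
      (fun x => by
        rw [one_mul]
        refine (ContinuousMap.norm_le _ (by positivity)).2 fun σ => ?_
        simp [Prod.norm_def])
  have h1 : ContDiff ℝ ∞ fun x => primitive G (superposition _ f hf.continuous (i + c x)) :=
    (primitive G).contDiff.comp ((contDiff_superposition hf).comp
      (contDiff_const.add c.contDiff))
  have h2 := (ContinuousMap.evalCLM ℝ (⟨1, by norm_num⟩ : Icc (-1 : ℝ) 1) (M := G)).contDiff.comp h1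
  convert! h2 using 1
  funext x
  symm
  simp only [Function.comp_apply, ContinuousMap.evalCLM_apply, primitive_apply]
  refine intervalIntegral.integral_congr fun τ hτ => ?_
  rw [uIcc_of_le zero_le_one] at hτ
  rw [IccExtend_of_mem _ _ ⟨by linarith [hτ.1], hτ.2⟩]
  simp [i, c]

end Primitive

/-! ### Inverse function theorem and cutoffs for germs -/

section LocalTools

variable {E F : Type*} [NormedAddCommGroup E] [NormedSpace ℝ E] [NormedAddCommGroup F]
  [NormedSpace ℝ F]

/-- Invertibility of the derivative is an open condition. Shrinking the source to it makes the
inverse smooth on the whole target, not only near `f x`. -/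
theorem exists_openPartialHomeomorph_of_contDiff [CompleteSpace E] [CompleteSpace F] {f : E → F}
    (hf : ContDiff ℝ ∞ f) (x : E) (f' : E ≃L[ℝ] F) (hf' : HasFDerivAt f (f' : E →L[ℝ] F) x) :
    ∃ κ : OpenPartialHomeomorph E F, x ∈ κ.source ∧ (∀ y, κ y = f y) ∧
      ContDiffOn ℝ ∞ κ.symm κ.target ∧
      ∀ y ∈ κ.source, ∃ A : E ≃L[ℝ] F, HasFDerivAt f (A : E →L[ℝ] F) y := by
  have hne : (∞ : WithTop ℕ∞) ≠ 0 := by simp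
  let S : Set E := fderiv ℝ f ⁻¹' range ((↑) : (E ≃L[ℝ] F) → E →L[ℝ] F)
  have hS : IsOpen S := ContinuousLinearEquiv.isOpen.preimage (hf.continuous_fderiv hne)
  let κ := (hf.contDiffAt.toOpenPartialHomeomorph f hf' hne).restrOpen S hS
  have hder : ∀ y ∈ κ.source, ∃ A : E ≃L[ℝ] F, HasFDerivAt f (A : E →L[ℝ] F) y := by
    rintro y ⟨-, A, hA⟩
    exact ⟨A, hA ▸ (hf.differentiable hne y).hasFDerivAt⟩
  refine ⟨κ, ⟨hf.contDiffAt.mem_toOpenPartialHomeomorph_source hf' hne, ⟨f', hf'.fderiv.symm⟩⟩,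
    fun y => rfl, fun z hz => ?_, hder⟩
  obtain ⟨A, hA⟩ := hder (κ.symm z) (κ.map_target hz)
  exact (κ.contDiffAt_symm hz hA hf.contDiffAt).contDiffWithinAt

variable [FiniteDimensional ℝ E]

theorem exists_contDiff_cutoff {x : E} {U : Set E} (hU : U ∈ 𝓝 x) :
    ∃ ψ : E → ℝ, ContDiff ℝ ∞ ψ ∧ HasCompactSupport ψ ∧ tsupport ψ ⊆ U ∧ ∀ᶠ y in 𝓝 x, ψ y = 1 := by
  obtain ⟨ε, hε, hεU⟩ := Metric.nhds_basis_closedBall.mem_iff.1 hU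
  let b : ContDiffBump x := ⟨ε / 2, ε, by positivity, by linarith⟩
  exact ⟨b, b.contDiff, b.hasCompactSupport, by rw [b.tsupport_eq]; exact hεU,
    b.eventuallyEq_one⟩

theorem contDiff_smul_of_tsupport_subset {ψ : E → ℝ} {f : E → F} {U : Set E} (hU : IsOpen U)
    (hψ : ContDiff ℝ ∞ ψ) (hs : tsupport ψ ⊆ U) (hf : ContDiffOn ℝ ∞ f U) :
    ContDiff ℝ ∞ fun y => ψ y • f y := by
  rw [contDiff_iff_contDiffAt]
  intro y
  by_cases hy : y ∈ tsupport ψ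
  · exact hψ.contDiffAt.smul (hf.contDiffAt (hU.mem_nhds (hs hy)))
  · have : (fun y => ψ y • f y) =ᶠ[𝓝 y] fun _ => 0 := by
      filter_upwards [(isClosed_tsupport ψ).isOpen_compl.mem_nhds hy] with z hz
      rw [image_eq_zero_of_notMem_tsupport hz, zero_smul]
    exact contDiffAt_const.congr_of_eventuallyEq this

/-- A cutoff turns a germ into a globally smooth function. This is what removes domains from the
later statements. -/
theorem exists_contDiff_eventuallyEq {x : E} {f : E → F} {U : Set E} (hU : U ∈ 𝓝 x)
    (hf : ContDiffOn ℝ ∞ f U) : ∃ g : E → F, ContDiff ℝ ∞ g ∧ ∀ᶠ y in 𝓝 x, g y = f y := by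
  obtain ⟨ψ, h1, -, h3, h4⟩ := exists_contDiff_cutoff (interior_mem_nhds.2 hU)
  refine ⟨_, contDiff_smul_of_tsupport_subset isOpen_interior h1 h3 (hf.mono interior_subset), ?_⟩
  filter_upwards [h4] with y hy
  rw [hy, one_smul]

theorem exists_contDiff_local_inverse [FiniteDimensional ℝ F] {f : E → F} (hf : ContDiff ℝ ∞ f)
    (x : E) (hinj : Function.Injective (fderiv ℝ f x))
    (hdim : Module.finrank ℝ E = Module.finrank ℝ F) :
    ∃ g : F → E, ContDiff ℝ ∞ g ∧ (∀ᶠ y in 𝓝 x, g (f y) = y) ∧ ∀ᶠ z in 𝓝 (f x), f (g z) = z := by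
  have := FiniteDimensional.complete ℝ E
  have := FiniteDimensional.complete ℝ F
  let A : E ≃L[ℝ] F :=
    (LinearEquiv.ofInjectiveOfFinrankEq (fderiv ℝ f x).toLinearMap hinj hdim).toContinuousLinearEquiv
  have hA : HasFDerivAt f (A : E →L[ℝ] F) x := by
    convert! (hf.differentiable (by simp) x).hasFDerivAt using 1
  obtain ⟨κ, h1, h2, h3, -⟩ := exists_openPartialHomeomorph_of_contDiff hf x A hA
  have h1' : f x ∈ κ.target := h2 x ▸ κ.map_source h1
  obtain ⟨g, hg, hgk⟩ := exists_contDiff_eventuallyEq (κ.open_target.mem_nhds h1') h3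
  refine ⟨g, hg, ?_, ?_⟩
  · filter_upwards [hf.continuous.continuousAt.eventually hgk, κ.open_source.mem_nhds h1]
      with y hy hy'
    rw [hy, ← h2, κ.left_inv hy']
  · filter_upwards [hgk, κ.open_target.mem_nhds h1'] with z hz hz'
    rw [hz, ← h2, κ.right_inv hz']

end LocalTools

/-! ### Integration and Hadamard's lemma along a direction -/

section DirectionalPrimitive

variable {E : Type*} [NormedAddCommGroup E] [NormedSpace ℝ E] {G : Type*} [NormedAddCommGroup G]
  [NormedSpace ℝ G]

theorem eq_of_fderiv_apply_eq_zero {f : E → G} (hf : Differentiable ℝ f) (e z : E) (a : ℝ)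
    (h : ∀ s ∈ Icc (0 : ℝ) 1, fderiv ℝ f (z - (s * a) • e) e = 0) : f (z - a • e) = f z := by
  have hd : ∀ s ∈ Icc (0 : ℝ) 1, HasDerivAt (fun s : ℝ => f (z - (s * a) • e)) 0 s := by
    intro s hs
    have h1 : HasDerivAt (fun s : ℝ => z - (s * a) • e) (-(a • e)) s := by
      simpa using (((hasDerivAt_id s).mul_const a).smul_const e).const_sub z
    have h2 := (hf (z - (s * a) • e)).hasFDerivAt.comp_hasDerivAt s h1
    rw [map_neg, map_smul, h s hs, smul_zero, neg_zero] at h2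
    exact h2
  have := constant_of_has_deriv_right_zero
    (fun s hs => (hd s hs).continuousAt.continuousWithinAt)
    (fun s hs => (hd s (Ico_subset_Icc_self hs)).hasDerivWithinAt) 1 (right_mem_Icc.2 zero_le_one)
  simpa using this

/-- A function whose derivative in the direction `e` vanishes near `x` is constant along `e`. -/
theorem eventually_eq_of_fderiv_apply_eq_zero {f : E → G} (hf : Differentiable ℝ f)
    (ℓ : E →L[ℝ] ℝ) (e x : E) (hx : ℓ x = 0) (h : ∀ᶠ z in 𝓝 x, fderiv ℝ f z e = 0) :
    ∀ᶠ z in 𝓝 x, f (z - ℓ z • e) = f z := by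
  obtain ⟨ε, hε, hb⟩ := Metric.eventually_nhds_iff_ball.1 h
  have h1 : ∀ᶠ z in 𝓝 x, z - ℓ z • e ∈ Metric.ball x ε := by
    have : ContinuousAt (fun z => z - ℓ z • e) x := by fun_prop
    refine this.eventually (Metric.isOpen_ball.mem_nhds ?_)
    simpa [hx] using hε
  filter_upwards [h1, Metric.ball_mem_nhds x hε] with z hz1 hz2
  refine eq_of_fderiv_apply_eq_zero hf e z _ fun s hs => hb _ ?_
  have := (convex_ball x ε) hz2 hz1 (sub_nonneg.2 hs.2) hs.1 (by ring)
  convert! this using 1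
  module

/-- The product `ℓ z * r z` is the integral of `β` along `e` from the hyperplane `ℓ = 0` to `z`.
Rescaling the segment to `[0, 1]` extracts the factor `ℓ z` and leaves a parametric integral. -/
theorem exists_primitive_along {E : Type} [NormedAddCommGroup E] [NormedSpace ℝ E]
    (ℓ : E →L[ℝ] ℝ) (e : E) (he : ℓ e = 1) {β : E → ℝ}
    (hβ : ContDiff ℝ ∞ β) :
    ∃ r : E → ℝ, ContDiff ℝ ∞ r ∧ ∀ z, fderiv ℝ (fun z => ℓ z * r z) z e = β z := by
  let f : E × ℝ → ℝ := fun p => β (p.1 + ((p.2 - 1) * ℓ p.1) • e)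
  have hf : ContDiff ℝ ∞ f := by fun_prop
  have hr := contDiff_parametric_integral hf
  refine ⟨_, hr, fun z => ?_⟩
  have hd : Differentiable ℝ fun z => ℓ z * ∫ τ in (0 : ℝ)..1, f (z, τ) :=
    ℓ.differentiable.mul (hr.differentiable (by simp))
  have h1 : HasDerivAt (fun s : ℝ => z + s • e) e 0 := by
    simpa using ((hasDerivAt_id (0 : ℝ)).smul_const e).const_add z
  have h2 := HasFDerivAt.comp_hasDerivAt (0 : ℝ) (f := fun s : ℝ => z + s • e)
    (hd (z + (0 : ℝ) • e)).hasFDerivAt h1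
  -- Along the line `z + s e` the base point `z - ℓ(z) e` does not move; only the upper limit of the
  -- integral depends on `s`.
  have h3 : HasDerivAt (fun s : ℝ => ∫ σ in (0 : ℝ)..ℓ z + s, β (z - ℓ z • e + σ • e)) (β z) 0 := by
    have hc : Continuous fun σ : ℝ => β (z - ℓ z • e + σ • e) := by fun_prop
    have h4 := intervalIntegral.integral_hasDerivAt_right (hc.intervalIntegrable 0 (ℓ z + 0))
      (hc.stronglyMeasurableAtFilter _ _) hc.continuousAt
    have h5 := h4.comp_const_add (ℓ z) 0
    simpa using h5
  have h6 : (fun s : ℝ => ∫ σ in (0 : ℝ)..ℓ z + s, β (z - ℓ z • e + σ • e)) =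
      (fun z => ℓ z * ∫ τ in (0 : ℝ)..1, f (z, τ)) ∘ fun s : ℝ => z + s • e := by
    funext s
    have := intervalIntegral.mul_integral_comp_mul_left (a := 0) (b := 1)
      (f := fun σ => β (z - ℓ z • e + σ • e)) (ℓ z + s)
    simp only [mul_zero, mul_one] at this
    rw [← this]
    simp only [Function.comp_apply, map_add, map_smul, he, smul_eq_mul, mul_one, f]
    congr 1
    refine intervalIntegral.integral_congr fun τ _ => ?_
    refine congrArg β ?_
    module
  rw [← h6] at h2
  simpa using h2.unique h3

theorem exists_hadamard_along {E : Type} [NormedAddCommGroup E] [NormedSpace ℝ E]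
    (ℓ : E →L[ℝ] ℝ) (e : E) (he : ℓ e = 1) {c : E → ℝ}
    (hc : ContDiff ℝ ∞ c) :
    ∃ r : E → ℝ, ContDiff ℝ ∞ r ∧ (∀ z, c z = c (z - ℓ z • e) + ℓ z * r z) ∧
      ∀ z, fderiv ℝ c z e = r z + ℓ z * fderiv ℝ r z e := by
  have hβ : ContDiff ℝ ∞ fun z => fderiv ℝ c z e :=
    (hc.fderiv_right (m := ∞) (by simp)).clm_apply contDiff_const
  obtain ⟨r, hr, h⟩ := exists_primitive_along ℓ e he hβ
  have hp : ContDiff ℝ ∞ fun z => ℓ z * r z := ℓ.contDiff.mul hr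
  have hd : ContDiff ℝ ∞ fun z => c z - ℓ z * r z := hc.sub hp
  refine ⟨r, hr, fun z => ?_, fun z => ?_⟩
  rotate_left
  · rw [← h, fderiv_fun_mul ℓ.differentiableAt (hr.differentiable (by simp) z)]
    simp [he]
    ring
  have := eq_of_fderiv_apply_eq_zero (hd.differentiable (by simp)) e z (ℓ z) fun s _ => by
    rw [fderiv_fun_sub (hc.differentiable (by simp) _) (hp.differentiable (by simp) _)]
    simp [h]
  simp only [map_sub, map_smul, he, smul_eq_mul, mul_one, sub_self, zero_mul, sub_zero] at this
  linarith

end DirectionalPrimitive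

/-! ### Smooth local flows of vector fields -/

section Flow

variable {E : Type} [NormedAddCommGroup E] [NormedSpace ℝ E]

/-- Multiplication by `σ ∈ [-1, 1]` on the interval `[-1, 1]`. -/
def scaleInterval (σ : Icc (-1 : ℝ) 1) : C(Icc (-1 : ℝ) 1, Icc (-1 : ℝ) 1) :=
  ⟨fun ρ => ⟨σ * ρ, by
    have h : |(σ : ℝ) * ρ| ≤ 1 := by
      rw [abs_mul]
      exact mul_le_one₀ (abs_le.2 σ.2) (abs_nonneg _) (abs_le.2 ρ.2)
    exact abs_le.1 h⟩, by fun_prop⟩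

/-- This change of variables turns a solution of the Picard equation for time `t` into one for time
`σ t`. -/
theorem primitive_scaleInterval (γ : C(Icc (-1 : ℝ) 1, E)) (σ r : Icc (-1 : ℝ) 1) :
    (σ : ℝ) • primitive E (γ.comp (scaleInterval σ)) r = primitive E γ (scaleInterval σ r) := by
  rw [primitive_apply, primitive_apply]
  have h := intervalIntegral.smul_integral_comp_mul_left (a := 0) (b := r)
    (f := IccExtend (by norm_num : (-1 : ℝ) ≤ 1) γ) (σ : ℝ)
  rw [mul_zero] at h
  refine Eq.trans ?_ h
  congr 1
  refine intervalIntegral.integral_congr fun ρ hρ => ?_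
  have hρ' : ρ ∈ Icc (-1 : ℝ) 1 := by
    refine (uIcc_subset_Icc ?_ r.2) hρ
    norm_num
  have := (scaleInterval σ ⟨ρ, hρ'⟩).2
  rw [IccExtend_of_mem _ _ hρ']
  exact (IccExtend_of_mem (by norm_num : (-1 : ℝ) ≤ 1) γ this).symm

/-- The inclusion of a normed space in the continuous curves, as constant curves. -/
def constCurve (E : Type) [NormedAddCommGroup E] [NormedSpace ℝ E] :
    E →L[ℝ] C(Icc (-1 : ℝ) 1, E) :=
  LinearMap.mkContinuous
    { toFun := fun x => ContinuousMap.const _ x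
      map_add' := fun x y => by ext; simp
      map_smul' := fun x y => by ext; simp } 1
    (fun x => by
      rw [one_mul]
      exact (ContinuousMap.norm_le _ (norm_nonneg _)).2 fun σ => le_rfl)

@[simp] theorem constCurve_apply (x : E) (σ : Icc (-1 : ℝ) 1) : constCurve E x σ = x := rfl

/-- The zeros of this map are the solutions `γ` on `[-1, 1]` of `γ' = t X(γ)`, `γ 0 = x`. -/
def picardDefect (X : E → E) (hX : Continuous X) (p : (ℝ × E) × C(Icc (-1 : ℝ) 1, E)) :
    (ℝ × E) × C(Icc (-1 : ℝ) 1, E) :=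
  (p.1, p.2 - constCurve E p.1.2 - p.1.1 • primitive E (superposition _ X hX p.2))

theorem contDiff_picardDefect {X : E → E} (hX : ContDiff ℝ ∞ X) :
    ContDiff ℝ ∞ (picardDefect X hX.continuous) := by
  have h1 : ContDiff ℝ ∞ fun p : (ℝ × E) × C(Icc (-1 : ℝ) 1, E) =>
      primitive E (superposition _ X hX.continuous p.2) :=
    (primitive E).contDiff.comp ((contDiff_superposition hX).comp contDiff_snd)
  have h2 : ContDiff ℝ ∞ fun p : (ℝ × E) × C(Icc (-1 : ℝ) 1, E) => constCurve E p.1.2 :=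
    (constCurve E).contDiff.comp (contDiff_snd.comp contDiff_fst)
  exact contDiff_fst.prodMk ((contDiff_snd.sub h2).sub
    ((contDiff_fst.comp contDiff_fst).smul h1))

/-- At `t = 0` the integral term contributes only `k dt`, so the derivative is block triangular with
identities on the diagonal. No smallness condition on `X` is needed. -/
theorem exists_hasFDerivAt_picardDefect {X : E → E} (hX : ContDiff ℝ ∞ X) (x₀ : E) :
    ∃ A : ((ℝ × E) × C(Icc (-1 : ℝ) 1, E)) ≃L[ℝ] ((ℝ × E) × C(Icc (-1 : ℝ) 1, E)),
      HasFDerivAt (picardDefect X hX.continuous)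
        (A : ((ℝ × E) × C(Icc (-1 : ℝ) 1, E)) →L[ℝ] ((ℝ × E) × C(Icc (-1 : ℝ) 1, E)))
        ((0, x₀), constCurve E x₀) := by
  set k := primitive E (superposition _ X hX.continuous (constCurve E x₀)) with hk
  let B : (ℝ × E) →L[ℝ] C(Icc (-1 : ℝ) 1, E) :=
    (constCurve E).comp (ContinuousLinearMap.snd ℝ ℝ E) +
      (ContinuousLinearMap.fst ℝ ℝ E).smulRight k
  let A : ((ℝ × E) × C(Icc (-1 : ℝ) 1, E)) ≃L[ℝ] ((ℝ × E) × C(Icc (-1 : ℝ) 1, E)) :=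
    ContinuousLinearEquiv.equivOfInverse
      ((ContinuousLinearMap.fst ℝ _ _).prod
        (ContinuousLinearMap.snd ℝ _ _ - B.comp (ContinuousLinearMap.fst ℝ _ _)))
      ((ContinuousLinearMap.fst ℝ _ _).prod
        (ContinuousLinearMap.snd ℝ _ _ + B.comp (ContinuousLinearMap.fst ℝ _ _)))
      (fun p => by ext <;> simp) (fun p => by ext <;> simp)
  refine ⟨A, ?_⟩
  have h1 : DifferentiableAt ℝ (fun p : (ℝ × E) × C(Icc (-1 : ℝ) 1, E) =>
      primitive E (superposition _ X hX.continuous p.2)) ((0, x₀), constCurve E x₀) :=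
    (((primitive E).contDiff.comp ((contDiff_superposition hX).comp contDiff_snd)).differentiable
      (n := ∞) (by simp)) _
  have h2 := (hasFDerivAt_fst (𝕜 := ℝ) (p := ((0, x₀), constCurve E x₀))).prodMk
    (((hasFDerivAt_snd (𝕜 := ℝ) (p := (((0 : ℝ), x₀), constCurve E x₀))).sub
      (((constCurve E).comp ((ContinuousLinearMap.snd ℝ ℝ E).comp
        (ContinuousLinearMap.fst ℝ (ℝ × E) C(Icc (-1 : ℝ) 1, E)))).hasFDerivAt)).sub
      ((((ContinuousLinearMap.fst ℝ ℝ E).comp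
        (ContinuousLinearMap.fst ℝ (ℝ × E) C(Icc (-1 : ℝ) 1, E))).hasFDerivAt).smul
          h1.hasFDerivAt))
  refine HasFDerivAt.congr_fderiv (f := picardDefect X hX.continuous) h2 ?_
  ext p <;> simp [A, B, hk]

/-- The inverse function theorem for `picardDefect` gives solution curves `Γ (t, x)` that depend
smoothly on `(t, x)`, and the flow is their value at parameter `1`. Local uniqueness gives `Γ (σ t,
x) = Γ (t, x) ∘ (σ ·)`, so the flow for nearby times is read off one curve, which is an integral and
hence differentiable. -/
theorem exists_local_flow [FiniteDimensional ℝ E] {X : E → E} (hX : ContDiff ℝ ∞ X) (x₀ : E) :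
    ∃ φ : ℝ × E → E, ContDiff ℝ ∞ φ ∧ (∀ᶠ x in 𝓝 x₀, φ (0, x) = x) ∧
      ∀ᶠ p in 𝓝 ((0 : ℝ), x₀), HasDerivAt (fun t => φ (t, p.2)) (X (φ p)) p.1 := by
  have := FiniteDimensional.complete ℝ E
  obtain ⟨A, hA⟩ := exists_hasFDerivAt_picardDefect hX x₀
  obtain ⟨κ, hκ1, hκ2, hκ3, -⟩ :=
    exists_openPartialHomeomorph_of_contDiff (contDiff_picardDefect hX) _ A hA
  have h0 : κ ((0, x₀), constCurve E x₀) = ((0, x₀), 0) := by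
    rw [hκ2]; simp [picardDefect]
  have h0t : (((0 : ℝ), x₀), (0 : C(Icc (-1 : ℝ) 1, E))) ∈ κ.target := h0 ▸ κ.map_source hκ1
  let Γ : ℝ × E → C(Icc (-1 : ℝ) 1, E) := fun q => (κ.symm (q, 0)).2
  let U : Set (ℝ × E) := (fun q => (q, (0 : C(Icc (-1 : ℝ) 1, E)))) ⁻¹' κ.target
  have hU : IsOpen U := κ.open_target.preimage (by fun_prop)
  have h0U : ((0 : ℝ), x₀) ∈ U := h0t
  have hΓ : ContDiffOn ℝ ∞ Γ U :=
    contDiff_snd.comp_contDiffOn (hκ3.comp (by fun_prop) fun q hq => hq)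
  have hΓ0 : Γ (0, x₀) = constCurve E x₀ := by
    simp only [Γ]; rw [← h0, κ.left_inv hκ1]
  have hfst : ∀ q ∈ U, (κ.symm (q, 0)).1 = q := fun q hq => by
    have := κ.right_inv hq
    rw [hκ2] at this
    exact congrArg Prod.fst this
  have heq : ∀ q ∈ U, Γ q = constCurve E q.2 +
      q.1 • primitive E (superposition _ X hX.continuous (Γ q)) := by
    intro q hq
    have h1 := κ.right_inv hq
    rw [hκ2] at h1
    have h2 := congrArg Prod.snd h1
    simp only [picardDefect, hfst q hq] at h2
    rw [sub_sub, sub_eq_zero] at h2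
    exact h2
  have huniq : ∀ (q : ℝ × E) (γ : C(Icc (-1 : ℝ) 1, E)), (q, γ) ∈ κ.source →
      γ = constCurve E q.2 + q.1 • primitive E (superposition _ X hX.continuous γ) → Γ q = γ := by
    intro q γ hs hγ
    have h1 : κ (q, γ) = (q, 0) := by
      rw [hκ2, picardDefect, sub_sub]
      exact Prod.ext rfl (sub_eq_zero.2 hγ)
    simp only [Γ]
    rw [← h1, κ.left_inv hs]
  obtain ⟨ε, hε, hεs⟩ := Metric.isOpen_iff.1 κ.open_source _ hκ1
  have hev : ∀ᶠ q in 𝓝 ((0 : ℝ), x₀), q ∈ U ∧ ‖Γ q - constCurve E x₀‖ < ε ∧ dist q (0, x₀) < ε := by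
    refine (show ∀ᶠ q in 𝓝 ((0 : ℝ), x₀), q ∈ U from hU.mem_nhds h0U).and
      (Filter.Eventually.and ?_ (Metric.ball_mem_nhds _ hε))
    have hc : ContinuousAt Γ (0, x₀) := hΓ.continuousOn.continuousAt (hU.mem_nhds h0U)
    filter_upwards [hc.eventually (Metric.ball_mem_nhds _ hε)] with q hq
    rwa [hΓ0, dist_eq_norm] at hq
  obtain ⟨δ, hδ, hb⟩ := Metric.eventually_nhds_iff_ball.1 hev
  have hscale : ∀ (t : ℝ) (x : E), (t, x) ∈ Metric.ball ((0 : ℝ), x₀) δ → ∀ σ : Icc (-1 : ℝ) 1,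
      Γ (σ * t, x) = (Γ (t, x)).comp (scaleInterval σ) := by
    intro t x htx σ
    obtain ⟨h1, h2, h3⟩ := hb _ htx
    refine huniq _ _ (hεs ?_) ?_
    · rw [Metric.mem_ball, Prod.dist_eq, max_lt_iff, Prod.dist_eq, max_lt_iff] at *
      simp only [dist_zero_right, Real.norm_eq_abs] at h3
      refine ⟨⟨?_, h3.2⟩, ?_⟩
      · simp only [dist_zero_right, Real.norm_eq_abs, abs_mul]
        exact lt_of_le_of_lt (mul_le_of_le_one_left (abs_nonneg _) (abs_le.2 σ.2)) h3.1
      · rw [dist_eq_norm]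
        refine lt_of_le_of_lt ((ContinuousMap.norm_le _ (norm_nonneg _)).2 fun r => ?_) h2
        exact (Γ (t, x) - constCurve E x₀).norm_coe_le_norm (scaleInterval σ r)
    · ext r
      have h4 := DFunLike.congr_fun (heq _ h1) (scaleInterval σ r)
      have h5 := primitive_scaleInterval (superposition _ X hX.continuous (Γ (t, x))) σ r
      simp only [ContinuousMap.comp_apply, ContinuousMap.add_apply, ContinuousMap.smul_apply,
        constCurve_apply] at h4 ⊢
      rw [h4, ← h5, smul_smul, mul_comm t]
      rfl
  let one : Icc (-1 : ℝ) 1 := ⟨1, by norm_num⟩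
  have hφ : ContDiffOn ℝ ∞ (fun q => Γ q one) U :=
    ContDiff.comp_contDiffOn (ContinuousMap.evalCLM ℝ (M := E) one).contDiff hΓ
  obtain ⟨φ, hφ1, hφ2⟩ := exists_contDiff_eventuallyEq (hU.mem_nhds h0U) hφ
  have hΓφ : ∀ (t : ℝ) (x : E), (t, x) ∈ Metric.ball ((0 : ℝ), x₀) δ → ∀ σ : Icc (-1 : ℝ) 1,
      Γ (σ * t, x) one = Γ (t, x) σ := by
    intro t x htx σ
    rw [hscale t x htx σ, ContinuousMap.comp_apply]
    congr 1
    exact Subtype.ext (mul_one _)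
  refine ⟨φ, hφ1, ?_, ?_⟩
  · have hc : ContinuousAt (fun x : E => ((0 : ℝ), x)) x₀ := by fun_prop
    filter_upwards [hc.eventually hφ2, hc.eventually hev] with x hx hx'
    rw [hx, heq _ hx'.1]
    simp
  · filter_upwards [eventually_eventually_nhds.2 hφ2, Metric.ball_mem_nhds _ hδ] with p hp hpδ
    obtain ⟨t₀, x⟩ := p
    rw [Metric.mem_ball, Prod.dist_eq, max_lt_iff] at hpδ
    simp only [dist_zero_right, Real.norm_eq_abs] at hpδ
    -- A time `T` slightly larger than `|t₀|` makes `t₀ / T` an interior point of `[-1, 1]`, so the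
    -- single curve `Γ (T, x)` covers all times near `t₀`.
    obtain ⟨T, hT1, hT2⟩ := exists_between hpδ.1
    have hT0 : 0 < T := lt_of_le_of_lt (abs_nonneg _) hT1
    have hTb : (T, x) ∈ Metric.ball ((0 : ℝ), x₀) δ := by
      rw [Metric.mem_ball, Prod.dist_eq, max_lt_iff]
      simpa [abs_of_pos hT0] using ⟨hT2, hpδ.2⟩
    let c : ℝ → E := IccExtend (by norm_num : (-1 : ℝ) ≤ 1)
      (superposition _ X hX.continuous (Γ (T, x)))
    have hcc : Continuous c := ContinuousMap.continuous _ |>.Icc_extend'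
    have hmem : ∀ t : ℝ, |t| < T → t / T ∈ Icc (-1 : ℝ) 1 := fun t ht => by
      rw [mem_Icc, ← abs_le, abs_div, abs_of_pos hT0, div_le_one hT0]
      exact ht.le
    have hval : ∀ t : ℝ, ∀ ht : |t| < T, Γ (t, x) one = Γ (T, x) ⟨t / T, hmem t ht⟩ := by
      intro t ht
      rw [← hΓφ T x hTb]
      simp only
      rw [div_mul_cancel₀ _ hT0.ne']
    have hint : ∀ t : ℝ, |t| < T → Γ (t, x) one = x + T • ∫ τ in (0 : ℝ)..t / T, c τ := by
      intro t ht
      rw [hval t ht, heq _ (hb _ hTb).1]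
      rfl
    have hd : HasDerivAt (fun t : ℝ => x + T • ∫ τ in (0 : ℝ)..t / T, c τ) (c (t₀ / T)) t₀ := by
      have h1 : HasDerivAt (fun t : ℝ => t / T) (1 / T) t₀ := (hasDerivAt_id t₀).div_const T
      have h2 := intervalIntegral.integral_hasDerivAt_right (hcc.intervalIntegrable 0 (t₀ / T))
        (hcc.stronglyMeasurableAtFilter _ _) hcc.continuousAt
      have h3 := ((h2.scomp t₀ h1).const_smul T).const_add x
      convert! h3 using 1
      rw [smul_smul, mul_one_div_cancel hT0.ne', one_smul]
    have hnear : ∀ᶠ t in 𝓝 t₀, |t| < T := continuous_abs.continuousAt.eventually (Iio_mem_nhds hT1)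
    have hc2 : ContinuousAt (fun t : ℝ => (t, x)) t₀ := by fun_prop
    have hX' : X (φ (t₀, x)) = c (t₀ / T) := by
      rw [hp.self_of_nhds, hval t₀ hT1]
      simp only [c]
      rw [IccExtend_of_mem _ _ (hmem t₀ hT1)]
      rfl
    simp only [hX']
    refine hd.congr_of_eventuallyEq ?_
    filter_upwards [hnear, hc2.eventually hp] with t ht ht'
    rw [ht', hint t ht]

end Flow

/-! ### Borel's lemma with parameters -/

section Borel

theorem exists_bound_iteratedFDeriv {E F : Type*} [NormedAddCommGroup E] [NormedSpace ℝ E]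
    [NormedAddCommGroup F] [NormedSpace ℝ F] {f : E → F} (hf : ContDiff ℝ ∞ f)
    (hc : HasCompactSupport f) (k : ℕ) : ∃ C, ∀ x, ‖iteratedFDeriv ℝ k f x‖ ≤ C :=
  (hc.iteratedFDeriv k).exists_bound_of_continuous
    (hf.continuous_iteratedFDeriv (by exact_mod_cast le_top))

theorem contDiff_div_pow {φ : ℝ → ℝ} (hφ : ContDiff ℝ ∞ φ) (h0 : ∀ᶠ v in 𝓝 0, φ v = 0) (N : ℕ) :
    ContDiff ℝ ∞ (fun v => φ v / v ^ N) ∧ ∀ v, v ^ N * (φ v / v ^ N) = φ v := by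
  constructor
  · rw [contDiff_iff_contDiffAt]
    intro v
    rcases eq_or_ne v 0 with rfl | hv
    · refine (contDiffAt_const (c := (0 : ℝ))).congr_of_eventuallyEq ?_
      filter_upwards [h0] with v hv
      rw [hv, zero_div]
    · exact hφ.contDiffAt.div (contDiffAt_id.pow N) (pow_ne_zero _ hv)
  · intro v
    rcases eq_or_ne v 0 with rfl | hv
    · simp [h0.self_of_nhds]
    · field_simp

variable {Z : Type} [NormedAddCommGroup Z] [NormedSpace ℝ Z] [FiniteDimensional ℝ Z]

/-- Each derivative costs at most a factor `ε⁻¹`, so the prefactor `ε ^ m` with `m > k` leaves at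
least one power of `ε`. Small scales then make Borel's series converge with its derivatives. -/
theorem norm_iteratedFDeriv_rescale_le {G : Z × ℝ → ℝ} (hG : ContDiff ℝ ∞ G) {k : ℕ} {C ε : ℝ}
    (hC : ∀ x, ‖iteratedFDeriv ℝ k G x‖ ≤ C) (h0 : 0 < ε) (h1 : ε ≤ 1) (m : ℕ) (hm : k < m)
    (x : Z × ℝ) :
    ‖iteratedFDeriv ℝ k (fun x : Z × ℝ => ε ^ m * G (x.1, ε⁻¹ * x.2)) x‖ ≤ ε * C := by
  let L : Z × ℝ →L[ℝ] Z × ℝ :=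
    (ContinuousLinearMap.fst ℝ Z ℝ).prod (ε⁻¹ • ContinuousLinearMap.snd ℝ Z ℝ)
  have hC0 : 0 ≤ C := (norm_nonneg _).trans (hC 0)
  have hi : 1 ≤ ε⁻¹ := (one_le_inv₀ h0).2 h1
  have hL : ‖L‖ ≤ ε⁻¹ := by
    refine L.opNorm_le_bound (by positivity) fun y => ?_
    simp only [L, ContinuousLinearMap.prod_apply, ContinuousLinearMap.coe_fst',
      smul_apply, ContinuousLinearMap.coe_snd', Prod.norm_def, norm_smul]
    rw [Real.norm_of_nonneg (by positivity : 0 ≤ ε⁻¹)]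
    refine max_le ?_ ?_
    · exact (le_max_left _ _).trans (le_mul_of_one_le_left (le_max_of_le_left (norm_nonneg _)) hi)
    · gcongr
      exact le_max_right _ _
  have h2 : ‖iteratedFDeriv ℝ k (G ∘ L) x‖ ≤ C * (ε⁻¹) ^ k := by
    rw [ContinuousLinearMap.iteratedFDeriv_comp_right L hG x (i := k) (by exact_mod_cast le_top)]
    refine (ContinuousMultilinearMap.norm_compContinuousLinearMap_le _ _).trans ?_
    rw [Finset.prod_const, Finset.card_univ, Fintype.card_fin]
    have := hC (L x)
    gcongr
  have h3 : (fun x : Z × ℝ => ε ^ m * G (x.1, ε⁻¹ * x.2)) = ε ^ m • (G ∘ L) := rfl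
  have h4 : ContDiffAt ℝ k (G ∘ L) x :=
    ((hG.comp L.contDiff).of_le (by exact_mod_cast le_top)).contDiffAt
  rw [h3, iteratedFDeriv_const_smul_apply h4, norm_smul, Real.norm_of_nonneg (by positivity)]
  calc ε ^ m * ‖iteratedFDeriv ℝ k (G ∘ L) x‖ ≤ ε ^ m * (C * (ε⁻¹) ^ k) := by gcongr
    _ = ε ^ (m - k) * C := by
      rw [← Nat.sub_add_cancel hm.le, pow_add, Nat.add_sub_cancel, inv_pow]
      field_simp
    _ ≤ ε * C := by
      gcongr
      exact pow_le_of_le_one h0.le h1 (by omega)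

/-- Borel's lemma with parameters, with the remainders in factored form. -/
theorem exists_contDiff_taylor (b : ℕ → Z → ℝ) (hb : ∀ j, ContDiff ℝ ∞ (b j)) (z₀ : Z) :
    ∃ B : Z × ℝ → ℝ, ContDiff ℝ ∞ B ∧ ∃ U ∈ 𝓝 z₀, ∀ N : ℕ, ∃ R : Z × ℝ → ℝ, ContDiff ℝ ∞ R ∧
      ∀ z ∈ U, ∀ v, B (z, v) = ∑ j ∈ Finset.range N, b j z * v ^ j + v ^ N * R (z, v) := by
  obtain ⟨ψ, hψ, hψc, -, hψ1⟩ := exists_contDiff_cutoff (x := z₀) Filter.univ_mem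
  obtain ⟨χ, hχ, hχc, -, hχ1⟩ := exists_contDiff_cutoff (x := (0 : ℝ)) Filter.univ_mem
  -- The index `N` records division by `v ^ N`: the tail of the series must still converge in every
  -- `C^k` after that division, so the bounds are collected for all `N` at once.
  let G : ℕ → ℕ → Z × ℝ → ℝ := fun j N x => ψ x.1 * b j x.1 * x.2 ^ (j - N) * χ x.2
  have hG : ∀ j N, ContDiff ℝ ∞ (G j N) := fun j N =>
    (((hψ.comp contDiff_fst).mul ((hb j).comp contDiff_fst)).mul (contDiff_snd.pow _)).mul
      (hχ.comp contDiff_snd)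
  have hGc : ∀ j N, HasCompactSupport (G j N) := fun j N => by
    refine HasCompactSupport.intro (hψc.isCompact.prod hχc.isCompact) fun x hx => ?_
    rw [mem_prod, not_and_or] at hx
    rcases hx with hx | hx <;> simp [G, image_eq_zero_of_notMem_tsupport hx]
  choose C hC using fun j N k => exists_bound_iteratedFDeriv (hG j N) (hGc j N) k
  have hC0 : ∀ j N k, 0 ≤ C j N k := fun j N k => (norm_nonneg _).trans (hC j N k 0)
  -- `D j` dominates the finitely many bounds with `k + N < j`, so that the scale `2⁻ʲ / D j` makes
  -- the corresponding derivatives at most `2⁻ʲ`.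
  let D : ℕ → ℝ := fun j => 1 + ∑ N ∈ Finset.range (j + 1), ∑ k ∈ Finset.range (j + 1), C j N k
  have hD : ∀ j, 1 ≤ D j := fun j =>
    le_add_of_nonneg_right (Finset.sum_nonneg fun _ _ => Finset.sum_nonneg fun _ _ => hC0 _ _ _)
  have hCD : ∀ j N k, k + N < j → C j N k ≤ D j := fun j N k h => by
    refine le_add_of_nonneg_of_le zero_le_one ?_
    refine le_trans ?_ (Finset.single_le_sum (f := fun N => ∑ k ∈ Finset.range (j + 1), C j N k)
      (fun _ _ => Finset.sum_nonneg fun _ _ => hC0 _ _ _)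
      (Finset.mem_range.2 (by omega : N < j + 1)))
    exact Finset.single_le_sum (f := fun k => C j N k) (fun _ _ => hC0 _ _ _)
      (Finset.mem_range.2 (by omega : k < j + 1))
  let ε : ℕ → ℝ := fun j => (1 / 2) ^ j / D j
  have hD0 : ∀ j, 0 < D j := fun j => one_pos.trans_le (hD j)
  have hε0 : ∀ j, 0 < ε j := fun j => div_pos (by positivity) (hD0 j)
  have hε1 : ∀ j, ε j ≤ 1 := fun j =>
    div_le_one_of_le₀ ((pow_le_one₀ (by norm_num) (by norm_num)).trans (hD j)) (hD0 j).le
  let T : ℕ → ℕ → Z × ℝ → ℝ := fun j N x => ε j ^ (j - N) * G j N (x.1, (ε j)⁻¹ * x.2)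
  have hT : ∀ j N, ContDiff ℝ ∞ (T j N) := fun j N =>
    contDiff_const.mul ((hG j N).comp (contDiff_fst.prodMk (contDiff_const.mul contDiff_snd)))
  have hTv : ∀ j N x, T j N x = ψ x.1 * b j x.1 * x.2 ^ (j - N) * χ ((ε j)⁻¹ * x.2) := by
    intro j N x
    have := (hε0 j).ne'
    simp only [T, G, mul_pow, inv_pow]
    field_simp
  have hbound : ∀ j N k, k + N < j → ∀ x, ‖iteratedFDeriv ℝ k (T j N) x‖ ≤ (1 / 2) ^ j := by
    intro j N k h x
    refine (norm_iteratedFDeriv_rescale_le (hG j N) (hC j N k) (hε0 j) (hε1 j) (j - N)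
      (by omega) x).trans ?_
    calc ε j * C j N k ≤ ε j * D j := by
          have := hCD j N k h
          have := (hε0 j).le
          gcongr
      _ = (1 / 2) ^ j := div_mul_cancel₀ _ (hD0 j).ne'
  have hsum : Summable fun j : ℕ => ((1 : ℝ) / 2) ^ j := summable_geometric_two
  have htail : ∀ N, ContDiff ℝ ∞ fun x => ∑' i, T (i + N) N x := fun N => by
    refine contDiff_tsum_of_eventually (v := fun _ i => (1 / 2) ^ (i + N)) (fun i => hT _ _)
      (fun k _ => (summable_nat_add_iff N).2 hsum) fun k _ => ?_
    rw [Nat.cofinite_eq_atTop]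
    filter_upwards [Filter.eventually_gt_atTop k] with i hi x
    exact hbound _ _ _ (by omega) x
  have hTsum : ∀ x, Summable fun j => T j 0 x := fun x => by
    refine Summable.of_norm_bounded_eventually_nat hsum ?_
    filter_upwards [Filter.eventually_gt_atTop 0] with j hj
    simpa using hbound j 0 0 (by omega) x
  -- The neighbourhood is the set `ψ = 1`. It is the same for all `N`, as flatness will require.
  refine ⟨_, htail 0, _, hψ1, fun N => ?_⟩
  -- The terms of index below `N` differ from their monomials by functions of `v` that vanish near
  -- `0`, hence are divisible by `v ^ N`.
  have hχε : ∀ j, ContDiff ℝ ∞ (fun v => v ^ j * (χ ((ε j)⁻¹ * v) - 1)) ∧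
      ∀ᶠ v in 𝓝 0, v ^ j * (χ ((ε j)⁻¹ * v) - 1) = 0 := fun j => by
    refine ⟨(contDiff_id.pow j).mul ((hχ.comp (contDiff_const.mul contDiff_id)).sub
      contDiff_const), ?_⟩
    have hc : Filter.Tendsto (fun v : ℝ => (ε j)⁻¹ * v) (𝓝 0) (𝓝 0) := by
      simpa using (continuous_const_mul ((ε j)⁻¹)).tendsto (0 : ℝ)
    filter_upwards [hc.eventually hχ1] with v hv
    rw [hv, sub_self, mul_zero]
  let q : ℕ → ℝ → ℝ := fun j v => v ^ j * (χ ((ε j)⁻¹ * v) - 1) / v ^ N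
  have hq : ∀ j, ContDiff ℝ ∞ (q j) ∧ ∀ v, v ^ N * q j v = v ^ j * (χ ((ε j)⁻¹ * v) - 1) :=
    fun j => contDiff_div_pow (hχε j).1 (hχε j).2 N
  refine ⟨fun x => ∑ j ∈ Finset.range N, b j x.1 * q j x.2 + ∑' i, T (i + N) N x,
    (ContDiff.sum fun j _ => ((hb j).comp contDiff_fst).mul ((hq j).1.comp contDiff_snd)).add
      (htail N), fun z hz v => ?_⟩
  have hz : ψ z = 1 := hz
  simp only [add_zero]
  rw [← (hTsum (z, v)).sum_add_tsum_nat_add N, mul_add, ← add_assoc, ← tsum_mul_left]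
  congr 1
  · rw [Finset.mul_sum, ← Finset.sum_add_distrib]
    refine Finset.sum_congr rfl fun j _ => ?_
    rw [hTv, mul_left_comm, (hq j).2]
    simp only [hz, Nat.sub_zero]
    ring
  · congr 1
    funext i
    rw [hTv, hTv, Nat.add_sub_cancel, Nat.sub_zero, pow_add]
    ring

end Borel

/-! ### The hyperbolic flow and flat right-hand sides -/

section Hyperbolic

/-- The linear hyperbolic flow `(s, u, v) ↦ (s, eᵗ u, e⁻ᵗ v)`. -/
def squeeze (t : ℝ) : ℝ × ℝ × ℝ →L[ℝ] ℝ × ℝ × ℝ :=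
  (ContinuousLinearMap.fst ℝ ℝ (ℝ × ℝ)).prod
    ((Real.exp t • ContinuousLinearMap.fst ℝ ℝ ℝ ∘L ContinuousLinearMap.snd ℝ ℝ (ℝ × ℝ)).prod
      (Real.exp (-t) • ContinuousLinearMap.snd ℝ ℝ ℝ ∘L ContinuousLinearMap.snd ℝ ℝ (ℝ × ℝ)))

theorem squeeze_apply (t : ℝ) (z : ℝ × ℝ × ℝ) :
    squeeze t z = (z.1, Real.exp t * z.2.1, Real.exp (-t) * z.2.2) := rfl

theorem squeeze_add (t t' : ℝ) (z : ℝ × ℝ × ℝ) : squeeze (t + t') z = squeeze t (squeeze t' z) := by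
  simp only [squeeze_apply, neg_add, Real.exp_add, mul_assoc]

@[simp] theorem squeeze_zero (z : ℝ × ℝ × ℝ) : squeeze 0 z = z := by
  simp [squeeze_apply]

theorem norm_squeeze_le (t : ℝ) : ‖squeeze t‖ ≤ Real.exp |t| := by
  refine (squeeze t).opNorm_le_bound (by positivity) fun z => ?_
  have h1 : 1 ≤ Real.exp |t| := Real.one_le_exp (abs_nonneg t)
  have hz1 : ‖z.1‖ ≤ ‖z‖ := norm_fst_le z
  have hz2 : ‖z.2.1‖ ≤ ‖z‖ := (norm_fst_le z.2).trans (norm_snd_le z)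
  have hz3 : ‖z.2.2‖ ≤ ‖z‖ := (norm_snd_le z.2).trans (norm_snd_le z)
  simp only [squeeze_apply]
  refine (norm_prod_le_iff).2 ⟨?_, (norm_prod_le_iff).2 ⟨?_, ?_⟩⟩
  · exact hz1.trans (le_mul_of_one_le_left (norm_nonneg _) h1)
  · simp only [norm_mul, Real.norm_eq_abs, Real.abs_exp] at *
    gcongr
    exact le_abs_self t
  · simp only [norm_mul, Real.norm_eq_abs, Real.abs_exp] at *
    gcongr
    exact neg_le_abs t

theorem contDiff_squeeze_uncurry :
    ContDiff ℝ ∞ fun p : (ℝ × ℝ × ℝ) × ℝ => squeeze p.2 p.1 := by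
  simp only [squeeze_apply]
  fun_prop

theorem hasDerivAt_squeeze (z : ℝ × ℝ × ℝ) :
    HasDerivAt (fun t => squeeze t z) (0, z.2.1, -z.2.2) 0 := by
  simp only [squeeze_apply]
  have h1 : HasDerivAt (fun t : ℝ => Real.exp t * z.2.1) z.2.1 0 := by
    simpa using (Real.hasDerivAt_exp 0).mul_const z.2.1
  have h2 : HasDerivAt (fun t : ℝ => Real.exp (-t) * z.2.2) (-z.2.2) 0 := by
    simpa using ((hasDerivAt_neg (0 : ℝ)).exp).mul_const z.2.2
  exact (hasDerivAt_const _ _).prodMk (h1.prodMk h2)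

/-- The derivative of `f` along the hyperbolic vector field `u ∂_u - v ∂_v`. -/
def hyp (f : ℝ × ℝ × ℝ → ℝ) (z : ℝ × ℝ × ℝ) : ℝ := fderiv ℝ f z (0, z.2.1, -z.2.2)

theorem contDiff_hyp {f : ℝ × ℝ × ℝ → ℝ} (hf : ContDiff ℝ ∞ f) : ContDiff ℝ ∞ (hyp f) :=
  (hf.fderiv_right (m := ∞) (by simp)).clm_apply (by fun_prop)

theorem hyp_congr {f g : ℝ × ℝ × ℝ → ℝ} {z : ℝ × ℝ × ℝ} (h : f =ᶠ[𝓝 z] g) :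
    hyp f z = hyp g z := by
  rw [hyp, hyp, h.fderiv_eq]

theorem hyp_mul {f g : ℝ × ℝ × ℝ → ℝ} {z : ℝ × ℝ × ℝ} (hf : DifferentiableAt ℝ f z)
    (hg : DifferentiableAt ℝ g z) :
    hyp (fun z => f z * g z) z = f z * hyp g z + g z * hyp f z := by
  simp [hyp, fderiv_fun_mul hf hg]

/-- Since `v` has weight `-1`, the field acts on `v ^ j φ(s, u)` through the Euler operator `u ∂_u -
j`. -/
theorem hyp_pow_mul (j : ℕ) {f : ℝ × ℝ × ℝ → ℝ} {z : ℝ × ℝ × ℝ} (hf : DifferentiableAt ℝ f z) :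
    hyp (fun z => z.2.2 ^ j * f z) z = z.2.2 ^ j * (hyp f z - j * f z) := by
  have hd : HasFDerivAt (fun z : ℝ × ℝ × ℝ => z.2.2) (ContinuousLinearMap.snd ℝ ℝ ℝ ∘L
      ContinuousLinearMap.snd ℝ ℝ (ℝ × ℝ)) z := hasFDerivAt_snd.comp z hasFDerivAt_snd
  have h1 : hyp (fun z : ℝ × ℝ × ℝ => z.2.2 ^ j) z = - (j * z.2.2 ^ j) := by
    rw [hyp, (hd.pow j).fderiv]
    rcases j with _ | j
    · simp
    · simp; ring
  rw [hyp_mul (hd.pow j).differentiableAt hf, h1]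
  ring

/-- Moving `z` along the flow by `τ` turns the integral into one over `[n + τ, n + 1 + τ]`, whose
derivative is a difference of endpoint values. These differences telescope in `n`. -/
theorem hyp_integral_squeeze {ρ : ℝ × ℝ × ℝ → ℝ} (hρ : ContDiff ℝ ∞ ρ) (n : ℕ) (z : ℝ × ℝ × ℝ) :
    hyp (fun z => ∫ t in (0 : ℝ)..1, ρ (squeeze t (squeeze n z))) z =
      ρ (squeeze (n + 1 : ℕ) z) - ρ (squeeze n z) := by
  have hf : ContDiff ℝ ∞ fun p : (ℝ × ℝ × ℝ) × ℝ => ρ (squeeze p.2 (squeeze n p.1)) :=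
    hρ.comp (contDiff_squeeze_uncurry.comp
      (((squeeze n).contDiff.comp contDiff_fst).prodMk contDiff_snd))
  set I : ℝ × ℝ × ℝ → ℝ := fun z => ∫ t in (0 : ℝ)..1, ρ (squeeze t (squeeze n z)) with hIdef
  have hI : ContDiff ℝ ∞ I := contDiff_parametric_integral hf
  have h1 : HasDerivAt (I ∘ fun t => squeeze t z) (hyp I z) 0 := by
    have hd := (hI.differentiable (by simp) (squeeze 0 z)).hasFDerivAt
    have := hd.comp_hasDerivAt (0 : ℝ) (hasDerivAt_squeeze z)
    rwa [squeeze_zero] at this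
  have hc : Continuous fun t => ρ (squeeze t z) :=
    hρ.continuous.comp (contDiff_squeeze_uncurry.continuous.comp
      (continuous_const.prodMk continuous_id))
  have h2 : ∀ a : ℝ, HasDerivAt (fun τ => ∫ t in (0 : ℝ)..a + τ, ρ (squeeze t z))
      (ρ (squeeze a z)) 0 := fun a => by
    have h4 := intervalIntegral.integral_hasDerivAt_right (hc.intervalIntegrable 0 (a + 0))
      (hc.stronglyMeasurableAtFilter _ _) hc.continuousAt
    simpa using h4.comp_const_add a 0
  have h3 : (fun τ : ℝ => (∫ t in (0 : ℝ)..((n + 1 : ℕ) : ℝ) + τ, ρ (squeeze t z)) -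
      ∫ t in (0 : ℝ)..(n : ℝ) + τ, ρ (squeeze t z)) =
      I ∘ fun t => squeeze t z := by
    funext τ
    rw [intervalIntegral.integral_interval_sub_left (hc.intervalIntegrable _ _)
      (hc.intervalIntegrable _ _)]
    simp only [hIdef, Function.comp_apply, ← squeeze_add]
    have := intervalIntegral.integral_comp_add_right (a := 0) (b := 1)
      (fun t => ρ (squeeze t z)) (n + τ)
    simp only [zero_add] at this
    simp only [add_assoc, this]
    congr 1
    push_cast
    ring
  rw [← h3] at h1
  exact h1.unique ((h2 _).sub (h2 _))

theorem norm_iteratedFDeriv_comp_squeeze_le {h : ℝ × ℝ × ℝ → ℝ} (hh : ContDiff ℝ ∞ h) {k : ℕ}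
    {C : ℝ} (hC : ∀ x, ‖iteratedFDeriv ℝ k h x‖ ≤ C) (n : ℕ) (z : ℝ × ℝ × ℝ) :
    ‖iteratedFDeriv ℝ k (fun z => h (squeeze n z)) z‖ ≤ C * Real.exp n ^ k := by
  have hC0 : 0 ≤ C := (norm_nonneg _).trans (hC 0)
  have h1 : ‖squeeze n‖ ≤ Real.exp n := by simpa using norm_squeeze_le n
  have h2 := ContinuousLinearMap.iteratedFDeriv_comp_right (squeeze n) hh z (i := k)
    (by exact_mod_cast le_top)
  have h3 : (fun z => h (squeeze n z)) = h ∘ squeeze n := rfl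
  rw [h3, h2]
  refine (ContinuousMultilinearMap.norm_compContinuousLinearMap_le _ _).trans ?_
  rw [Finset.prod_const, Finset.card_univ, Fintype.card_fin]
  have := hC (squeeze n z)
  gcongr

/-- In Leibniz' formula only the factor composed with the flow grows, by at most `e ^ n` per
derivative. -/
theorem exists_bound_iteratedFDeriv_mul_comp_squeeze {P h : ℝ × ℝ × ℝ → ℝ} (hP : ContDiff ℝ ∞ P)
    (hPc : HasCompactSupport P) (hh : ContDiff ℝ ∞ h) (hhc : HasCompactSupport h) (k : ℕ) :
    ∃ C, ∀ (n : ℕ) z, ‖iteratedFDeriv ℝ k (fun z => P z * h (squeeze n z)) z‖ ≤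
      C * Real.exp n ^ k := by
  choose C hC using fun k => exists_bound_iteratedFDeriv hP hPc k
  choose D hD using fun k => exists_bound_iteratedFDeriv hh hhc k
  have hC0 : ∀ k, 0 ≤ C k := fun k => (norm_nonneg _).trans (hC k 0)
  have hD0 : ∀ k, 0 ≤ D k := fun k => (norm_nonneg _).trans (hD k 0)
  refine ⟨∑ i ∈ Finset.range (k + 1), (k.choose i : ℝ) * C i * D (k - i), fun n z => ?_⟩
  refine (norm_iteratedFDeriv_mul_le (N := ∞) hP (hh.comp (squeeze n).contDiff) z
    (by exact_mod_cast le_top)).trans ?_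
  rw [Finset.sum_mul]
  refine Finset.sum_le_sum fun i hi => ?_
  have h1 := norm_iteratedFDeriv_comp_squeeze_le hh (hD (k - i)) n z
  have h2 : Real.exp n ^ (k - i) ≤ Real.exp n ^ k :=
    pow_le_pow_right₀ (Real.one_le_exp (Nat.cast_nonneg n)) (Nat.sub_le _ _)
  have h3 : D (k - i) * Real.exp n ^ (k - i) ≤ D (k - i) * Real.exp n ^ k := by
    have := hD0 (k - i)
    gcongr
  have := hC i z
  have := hC0 i
  calc (k.choose i : ℝ) * ‖iteratedFDeriv ℝ i P z‖ *
        ‖iteratedFDeriv ℝ (k - i) (fun z => h (squeeze n z)) z‖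
      ≤ k.choose i * C i * (D (k - i) * Real.exp n ^ k) := by
        have := h1.trans h3
        gcongr
    _ = _ := by ring

/-- The hyperbolic cohomological equation for a right-hand side that is flat on `v = 0`. -/
theorem exists_hyp_eq_of_flat {ρ : ℝ × ℝ × ℝ → ℝ}
    (hflat : ∀ N : ℕ, ∃ R : ℝ × ℝ × ℝ → ℝ, ContDiff ℝ ∞ R ∧ HasCompactSupport R ∧
      ∀ z, ρ z = z.2.2 ^ N * R z) :
    ∃ f : ℝ × ℝ × ℝ → ℝ, ContDiff ℝ ∞ f ∧ ∀ᶠ z in 𝓝 0, hyp f z = ρ z := by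
  choose R hR hRc hRρ using hflat
  have hρ : ContDiff ℝ ∞ ρ := by
    convert! hR 0 using 1
    funext z
    simp [hRρ 0]
  -- The solution is `-∫₀^∞ ρ (squeeze t z) dt`, cut into unit times: `-∑ h (squeeze n z)`. The
  -- functions `k N` below show that `h` is flat on `v = 0` as well.
  let h : ℝ × ℝ × ℝ → ℝ := fun z => ∫ t in (0 : ℝ)..1, ρ (squeeze t z)
  let k : ℕ → ℝ × ℝ × ℝ → ℝ := fun N z =>
    ∫ t in (0 : ℝ)..1, Real.exp (-t) ^ N * R N (squeeze t z)
  have hk : ∀ N, ContDiff ℝ ∞ (k N) := fun N => by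
    refine contDiff_parametric_integral (f := fun p : (ℝ × ℝ × ℝ) × ℝ =>
      Real.exp (-p.2) ^ N * R N (squeeze p.2 p.1)) ?_
    exact ((Real.contDiff_exp.comp contDiff_snd.neg).pow N).mul
      ((hR N).comp contDiff_squeeze_uncurry)
  have hhk : ∀ N z, h z = z.2.2 ^ N * k N z := fun N z => by
    simp only [h, k, ← intervalIntegral.integral_const_mul]
    refine intervalIntegral.integral_congr fun t _ => ?_
    have := hRρ N (squeeze t z)
    simp only [this]
    rw [squeeze_apply, mul_pow]
    ring
  have hkc : ∀ N, HasCompactSupport (k N) := fun N => by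
    obtain ⟨r, hr⟩ := (hRc N).isCompact.isBounded.subset_closedBall 0
    refine HasCompactSupport.intro (isCompact_closedBall 0 (Real.exp 1 * r)) fun z hz => ?_
    have : ∀ t ∈ uIcc (0 : ℝ) 1, Real.exp (-t) ^ N * R N (squeeze t z) = 0 := by
      intro t ht
      rw [uIcc_of_le zero_le_one] at ht
      suffices squeeze t z ∉ tsupport (R N) by
        rw [image_eq_zero_of_notMem_tsupport this, mul_zero]
      intro hmem
      apply hz
      have h1 := hr hmem
      rw [mem_closedBall_zero_iff] at h1 ⊢
      have h2 : squeeze (-t) (squeeze t z) = z := by rw [← squeeze_add]; simp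
      have h3 := (squeeze (-t)).le_of_opNorm_le (norm_squeeze_le _) (squeeze t z)
      rw [h2, abs_neg, abs_of_nonneg ht.1] at h3
      refine h3.trans ?_
      have := Real.exp_le_exp.2 ht.2
      gcongr
    simp only [k]
    rw [intervalIntegral.integral_congr this]
    simp
  obtain ⟨ψ, hψ, hψc, -, hψ1⟩ := exists_contDiff_cutoff (x := (0 : ℝ × ℝ × ℝ)) Filter.univ_mem
  let T : ℕ → ℝ × ℝ × ℝ → ℝ := fun n z => ψ z * h (squeeze n z)
  have hh : ContDiff ℝ ∞ h := by
    convert! hk 0 using 1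
    funext z
    simp [hhk 0]
  have hT : ∀ n, ContDiff ℝ ∞ (T n) := fun n => hψ.mul (hh.comp (squeeze n).contDiff)
  have hbound : ∀ k : ℕ, ∃ C, ∀ n z, ‖iteratedFDeriv ℝ k (T n) z‖ ≤ C * Real.exp (-1) ^ n := by
    intro i
    -- For derivatives of order `i` the power `i + 1` of `v` is used: it gains `e ^ (-n (i + 1))`
    -- against a growth `e ^ (n i)`, leaving `e ^ (-n)`.
    let P : ℝ × ℝ × ℝ → ℝ := fun z => ψ z * z.2.2 ^ (i + 1)
    have hP : ContDiff ℝ ∞ P := hψ.mul (by fun_prop)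
    obtain ⟨C, hC⟩ := exists_bound_iteratedFDeriv_mul_comp_squeeze hP hψc.mul_right (hk (i + 1))
      (hkc (i + 1)) i
    refine ⟨C, fun n z => ?_⟩
    have h1 : T n = Real.exp (-n) ^ (i + 1) • fun z => P z * k (i + 1) (squeeze n z) := by
      funext z
      simp only [T, P, hhk (i + 1), squeeze_apply, Pi.smul_apply, smul_eq_mul]
      ring
    have h2 : ContDiff ℝ i fun z => P z * k (i + 1) (squeeze n z) :=
      (hP.mul ((hk (i + 1)).comp (squeeze n).contDiff)).of_le (by exact_mod_cast le_top)
    rw [h1, iteratedFDeriv_const_smul_apply h2.contDiffAt, norm_smul,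
      Real.norm_of_nonneg (by positivity)]
    calc Real.exp (-n) ^ (i + 1) *
          ‖iteratedFDeriv ℝ i (fun z => P z * k (i + 1) (squeeze n z)) z‖
        ≤ Real.exp (-n) ^ (i + 1) * (C * Real.exp n ^ i) := by
          have := hC n z
          gcongr
      _ = C * (Real.exp (-n) * Real.exp n) ^ i * Real.exp (-n) := by ring
      _ = C * Real.exp (-1) ^ n := by
          rw [← Real.exp_add, neg_add_cancel, Real.exp_zero, one_pow, mul_one, ← Real.exp_nat_mul]
          simp
  choose C hC using hbound
  have hsum : Summable fun n : ℕ => Real.exp (-1) ^ n :=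
    summable_geometric_of_lt_one (Real.exp_pos _).le (by simp)
  have hfsm : ContDiff ℝ ∞ fun z => ∑' n, T n z :=
    contDiff_tsum hT (fun i _ => hsum.mul_left (C i)) fun i n z _ => hC i n z
  refine ⟨fun z => -∑' n, T n z, hfsm.neg, ?_⟩
  obtain ⟨K, hK⟩ := (hRc 1).exists_bound_of_continuous (hR 1).continuous
  filter_upwards [eventually_eventually_nhds.2 hψ1] with z hz
  have hd1 : ∀ n x, ‖fderiv ℝ (T n) x‖ ≤ C 1 * Real.exp (-1) ^ n := fun n x => by
    rw [← norm_iteratedFDeriv_one]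
    exact hC 1 n x
  have hT0 : Summable fun n => T n 0 :=
    Summable.of_norm_bounded (hsum.mul_left (C 0)) fun n => by
      simpa using hC 0 n 0
  have hder := hasFDerivAt_tsum (hsum.mul_left (C 1))
    (fun n x => ((hT n).differentiable (by simp) x).hasFDerivAt) hd1 hT0 z
  have hds : Summable fun n => fderiv ℝ (T n) z :=
    Summable.of_norm_bounded (hsum.mul_left (C 1)) fun n => hd1 n z
  have hval : ∀ n, fderiv ℝ (T n) z (0, z.2.1, -z.2.2) =
      ρ (squeeze (n + 1 : ℕ) z) - ρ (squeeze n z) := fun n => by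
    rw [← hyp_integral_squeeze hρ n z]
    refine hyp_congr ?_
    filter_upwards [hz] with y hy
    simp [T, h, hy]
  have hS := ((ContinuousLinearMap.apply ℝ ℝ ((0, z.2.1, -z.2.2) : ℝ × ℝ × ℝ)).hasSum
    hds.hasSum).tendsto_sum_nat
  simp only [ContinuousLinearMap.apply_apply, hval] at hS
  -- Since `ρ = v R` with `R` bounded and `v` contracted by the flow, the telescoping sum tends to
  -- `-ρ z`.
  have hlim : Filter.Tendsto (fun n : ℕ => ρ (squeeze n z)) Filter.atTop (𝓝 0) := by
    have h0 : Filter.Tendsto (fun n : ℕ => Real.exp (-1) ^ n * (|z.2.2| * K)) Filter.atTop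
        (𝓝 0) := by
      simpa using (tendsto_pow_atTop_nhds_zero_of_lt_one (Real.exp_pos _).le
        (by simp : Real.exp (-1) < 1)).mul_const (|z.2.2| * K)
    refine squeeze_zero_norm (fun n => ?_) h0
    rw [hRρ 1, norm_mul, pow_one, squeeze_apply, norm_mul, ← Real.exp_nat_mul, mul_assoc]
    simp only [Real.norm_eq_abs, Real.abs_exp, mul_neg, mul_one]
    have := hK (z.1, Real.exp n * z.2.1, Real.exp (-n) * z.2.2)
    rw [Real.norm_eq_abs] at this
    gcongr
  have hS' := hlim.sub_const (ρ z)
  have hS2 : (fun N : ℕ => ∑ n ∈ Finset.range N, (ρ (squeeze (n + 1 : ℕ) z) - ρ (squeeze n z))) =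
      fun N : ℕ => ρ (squeeze N z) - ρ z := by
    funext N
    rw [Finset.sum_range_sub (fun n : ℕ => ρ (squeeze n z))]
    simp
  rw [hS2] at hS
  have := tendsto_nhds_unique hS hS'
  rw [hyp, fderiv_fun_neg, hder.fderiv, neg_apply, this]
  ring

end Hyperbolic

/-! ### The cohomological equation for smooth functions -/

section Cohomological

/-- The operator `u ∂_u - j` kills `u ^ j`, so this resonant term must be set aside. For the
induction write `c = c(s, 0) + u r`: the solution for `r` and `j`, multiplied by `u`, handles `u r`
at `j + 1`, and `-c(s, 0) / (j + 1)` handles the constant term. -/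
theorem exists_euler_eq (j : ℕ) : ∀ {c : ℝ × ℝ → ℝ}, ContDiff ℝ ∞ c →
    ∃ (a : ℝ → ℝ) (f : ℝ × ℝ → ℝ), ContDiff ℝ ∞ a ∧ ContDiff ℝ ∞ f ∧
      ∀ x, x.2 * fderiv ℝ f x (0, 1) - j * f x = c x - a x.1 * x.2 ^ j := by
  have he : ContinuousLinearMap.snd ℝ ℝ ℝ (0, 1) = 1 := rfl
  have hsub : ∀ x : ℝ × ℝ, x - ContinuousLinearMap.snd ℝ ℝ ℝ x • ((0 : ℝ), (1 : ℝ)) = (x.1, 0) := by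
    intro x
    ext <;> simp
  induction j with
  | zero =>
    intro c hc
    obtain ⟨r, hr, hcr, -⟩ := exists_hadamard_along (ContinuousLinearMap.snd ℝ ℝ ℝ) (0, 1) he hc
    obtain ⟨q, hq, hqr⟩ := exists_primitive_along (ContinuousLinearMap.snd ℝ ℝ ℝ) (0, 1) he hr
    refine ⟨fun s => c (s, 0), _, hc.comp (by fun_prop),
      (ContinuousLinearMap.snd ℝ ℝ ℝ).contDiff.mul hq, fun x => ?_⟩
    have := hcr x
    rw [hsub] at this
    rw [hqr, this]
    simp
  | succ j ih =>
    intro c hc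
    obtain ⟨r, hr, hcr, -⟩ := exists_hadamard_along (ContinuousLinearMap.snd ℝ ℝ ℝ) (0, 1) he hc
    obtain ⟨a, f, ha, hf, h⟩ := ih hr
    have hc0 : ContDiff ℝ ∞ fun s : ℝ => c (s, 0) / (j + 1) :=
      (hc.comp (by fun_prop : ContDiff ℝ ∞ fun s : ℝ => (s, (0 : ℝ)))).div_const _
    refine ⟨a, fun x => x.2 * f x - c (x.1, 0) / (j + 1), ha,
      (contDiff_snd.mul hf).sub (hc0.comp contDiff_fst), fun x => ?_⟩
    have h1 : HasFDerivAt (fun x : ℝ × ℝ => c (x.1, 0) / ((j : ℝ) + 1))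
        ((fderiv ℝ (fun s : ℝ => c (s, 0) / ((j : ℝ) + 1)) x.1) ∘L ContinuousLinearMap.fst ℝ ℝ ℝ)
        x :=
      (hc0.differentiable (by simp) x.1).hasFDerivAt.comp x hasFDerivAt_fst
    have h2 := ((hasFDerivAt_snd (𝕜 := ℝ) (p := x)).mul
      (hf.differentiable (by simp) x).hasFDerivAt).sub h1
    have h3 := hcr x
    rw [hsub] at h3
    have h4 := h x
    have h5 : fderiv ℝ (fun x => x.2 * f x - c (x.1, 0) / (j + 1)) x (0, 1) =
        x.2 * fderiv ℝ f x (0, 1) + f x := by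
      rw [HasFDerivAt.fderiv (f := fun x : ℝ × ℝ => x.2 * f x - c (x.1, 0) / ((j : ℝ) + 1)) h2]
      simp
    rw [h5, h3, pow_succ]
    have h6 : (j : ℝ) + 1 ≠ 0 := by positivity
    simp only [ContinuousLinearMap.coe_snd']
    push_cast
    field_simp
    linear_combination x.2 * h4

theorem exists_taylor_quotients {g : ℝ × ℝ × ℝ → ℝ} (hg : ContDiff ℝ ∞ g) :
    ∃ G : ℕ → ℝ × ℝ × ℝ → ℝ, (∀ j, ContDiff ℝ ∞ (G j)) ∧ ∀ N z,
      g z = ∑ j ∈ Finset.range N, z.2.2 ^ j * G j (z.1, z.2.1, 0) + z.2.2 ^ N * G N z := by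
  let ℓ : ℝ × ℝ × ℝ →L[ℝ] ℝ := ContinuousLinearMap.snd ℝ ℝ ℝ ∘L ContinuousLinearMap.snd ℝ ℝ (ℝ × ℝ)
  have hstep : ∀ G : {G : ℝ × ℝ × ℝ → ℝ // ContDiff ℝ ∞ G},
      ∃ G' : {G : ℝ × ℝ × ℝ → ℝ // ContDiff ℝ ∞ G}, ∀ z,
        G.1 z = G.1 (z.1, z.2.1, 0) + z.2.2 * G'.1 z := by
    rintro ⟨G, hG⟩
    obtain ⟨r, hr, h, -⟩ := exists_hadamard_along ℓ (0, 0, 1) rfl hG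
    refine ⟨⟨r, hr⟩, fun z => ?_⟩
    convert! h z using 3
    ext <;> simp [ℓ]
  choose nxt hnxt using hstep
  refine ⟨fun n => (nxt^[n] ⟨g, hg⟩).1, fun n => (nxt^[n] ⟨g, hg⟩).2, fun N z => ?_⟩
  induction N with
  | zero => simp
  | succ N ih =>
    rw [ih, Finset.sum_range_succ]
    simp only [Function.iterate_succ_apply']
    linear_combination z.2.2 ^ N * hnxt (nxt^[N] ⟨g, hg⟩) z

/-- The hyperbolic cohomological equation: every smooth function is, near the origin, the sum of a
function of `(s, uv)` and of a derivative along `u ∂_u - v ∂_v`. -/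
theorem exists_hyp_cohomological {g : ℝ × ℝ × ℝ → ℝ} (hg : ContDiff ℝ ∞ g) :
    ∃ (A : ℝ × ℝ → ℝ) (f : ℝ × ℝ × ℝ → ℝ), ContDiff ℝ ∞ A ∧ ContDiff ℝ ∞ f ∧
      ∀ᶠ z in 𝓝 0, g z = A (z.1, z.2.1 * z.2.2) + hyp f z := by
  obtain ⟨G, hG, hGg⟩ := exists_taylor_quotients hg
  have hc : ∀ j, ContDiff ℝ ∞ fun x : ℝ × ℝ => G j (x.1, x.2, 0) := fun j =>
    (hG j).comp (by fun_prop)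
  -- Each Taylor term splits as `v ^ j c_j = a_j (uv) ^ j + hyp (v ^ j φ_j)`. Borel's lemma then
  -- sums the `φ_j` into `F` and the `a_j` into `A`.
  choose a φ ha hφ haφ using fun j => exists_euler_eq j (hc j)
  obtain ⟨F, hF, U₁, hU₁, hFR⟩ := exists_contDiff_taylor φ hφ (0, 0)
  obtain ⟨A, hA, U₂, hU₂, hAR⟩ := exists_contDiff_taylor a ha 0
  choose RF hRF hFeq using hFR
  choose RA hRA hAeq using hAR
  let ι : ℝ × ℝ × ℝ → (ℝ × ℝ) × ℝ := fun z => ((z.1, z.2.1), z.2.2)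
  have hι : ContDiff ℝ ∞ ι := by fun_prop
  let F₃ : ℝ × ℝ × ℝ → ℝ := fun z => F (ι z)
  have hF₃ : ContDiff ℝ ∞ F₃ := hF.comp hι
  let RF₃ : ℕ → ℝ × ℝ × ℝ → ℝ := fun N z => RF N (ι z)
  have hRF₃ : ∀ N, ContDiff ℝ ∞ (RF₃ N) := fun N => (hRF N).comp hι
  let V : Set (ℝ × ℝ × ℝ) :=
    (fun z => (z.1, z.2.1)) ⁻¹' interior U₁ ∩ (fun z => z.1) ⁻¹' U₂
  have hV : V ∈ 𝓝 0 := by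
    refine Filter.inter_mem ?_ ?_
    · exact ContinuousAt.preimage_mem_nhds (by fun_prop) (interior_mem_nhds.2 hU₁)
    · exact ContinuousAt.preimage_mem_nhds (by fun_prop) hU₂
  let R : ℕ → ℝ × ℝ × ℝ → ℝ := fun N z =>
    G N z - z.2.1 ^ N * RA N (z.1, z.2.1 * z.2.2) - (hyp (RF₃ N) z - N * RF₃ N z)
  have hR : ∀ N, ContDiff ℝ ∞ (R N) := fun N =>
    ((hG N).sub ((by fun_prop : ContDiff ℝ ∞ fun z : ℝ × ℝ × ℝ => z.2.1 ^ N).mul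
      ((hRA N).comp (by fun_prop)))).sub
      ((contDiff_hyp (hRF₃ N)).sub (contDiff_const.mul (hRF₃ N)))
  have hφ₃ : ∀ j, ContDiff ℝ ∞ fun z : ℝ × ℝ × ℝ => φ j (z.1, z.2.1) := fun j =>
    (hφ j).comp (by fun_prop)
  have hhyp : ∀ j z, hyp (fun z => φ j (z.1, z.2.1)) z =
      z.2.1 * fderiv ℝ (φ j) (z.1, z.2.1) (0, 1) := fun j z => by
    have h1 := ((hφ j).differentiable (by simp) (z.1, z.2.1)).hasFDerivAt.comp z
      ((hasFDerivAt_fst (𝕜 := ℝ) (p := z)).prodMk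
        ((hasFDerivAt_fst (𝕜 := ℝ) (p := z.2)).comp z hasFDerivAt_snd))
    rw [hyp, HasFDerivAt.fderiv (f := fun z : ℝ × ℝ × ℝ => φ j (z.1, z.2.1)) h1]
    have h2 : ((0 : ℝ), z.2.1) = z.2.1 • ((0 : ℝ), (1 : ℝ)) := by simp
    simp only [ContinuousLinearMap.comp_apply, ContinuousLinearMap.prod_apply,
      ContinuousLinearMap.coe_fst', ContinuousLinearMap.coe_snd']
    rw [h2, map_smul, smul_eq_mul]
  -- The Taylor polynomials cancel by `haφ`, for every `N` on the same set `V`: the error of the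
  -- Borel sums is flat on `v = 0`.
  have hρ : ∀ N, ∀ z ∈ V, g z - A (z.1, z.2.1 * z.2.2) - hyp F₃ z = z.2.2 ^ N * R N z := by
    rintro N z ⟨hz1, hz2⟩
    have h1 : F₃ =ᶠ[𝓝 z] fun z => ∑ j ∈ Finset.range N, z.2.2 ^ j * φ j (z.1, z.2.1) +
        z.2.2 ^ N * RF₃ N z := by
      have hc : ContinuousAt (fun z : ℝ × ℝ × ℝ => (z.1, z.2.1)) z := by fun_prop
      filter_upwards [hc.preimage_mem_nhds (isOpen_interior.mem_nhds hz1)] with y hy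
      simp only [F₃, RF₃, ι, hFeq N _ (interior_subset hy)]
      congr 1
      exact Finset.sum_congr rfl fun j _ => mul_comm _ _
    have hv : Differentiable ℝ fun z : ℝ × ℝ × ℝ => z.2.2 := by fun_prop
    have h2 : hyp F₃ z = ∑ j ∈ Finset.range N,
        z.2.2 ^ j * (z.2.1 * fderiv ℝ (φ j) (z.1, z.2.1) (0, 1) - j * φ j (z.1, z.2.1)) +
        z.2.2 ^ N * (hyp (RF₃ N) z - N * RF₃ N z) := by
      have hd : ∀ j, DifferentiableAt ℝ (fun z : ℝ × ℝ × ℝ => z.2.2 ^ j * φ j (z.1, z.2.1)) z :=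
        fun j => ((hv z).pow j).mul ((hφ₃ j).differentiable (by simp) z)
      have hd' : DifferentiableAt ℝ (fun z : ℝ × ℝ × ℝ => z.2.2 ^ N * RF₃ N z) z :=
        ((hv z).pow N).mul ((hRF₃ N).differentiable (by simp) z)
      rw [hyp_congr h1, hyp, fderiv_fun_add (DifferentiableAt.fun_sum fun j _ => hd j) hd',
        fderiv_fun_sum fun j _ => hd j, add_apply, sum_apply]
      congr 1
      · refine Finset.sum_congr rfl fun j _ => ?_
        rw [← hhyp, ← hyp_pow_mul j ((hφ₃ j).differentiable (by simp) z)]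
        rfl
      · exact hyp_pow_mul N ((hRF₃ N).differentiable (by simp) z)
    have h3 := hGg N z
    have h4 := hAeq N z.1 hz2 (z.2.1 * z.2.2)
    have h5 : ∑ j ∈ Finset.range N, z.2.2 ^ j * G j (z.1, z.2.1, 0) =
        ∑ j ∈ Finset.range N, a j z.1 * (z.2.1 * z.2.2) ^ j + ∑ j ∈ Finset.range N,
        z.2.2 ^ j * (z.2.1 * fderiv ℝ (φ j) (z.1, z.2.1) (0, 1) - j * φ j (z.1, z.2.1)) := by
      rw [← Finset.sum_add_distrib]
      refine Finset.sum_congr rfl fun j _ => ?_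
      have := haφ j (z.1, z.2.1)
      simp only at this
      rw [this, mul_pow]
      ring
    rw [h2, h3, h4, h5, mul_pow]
    simp only [R]
    ring
  -- The flow expands `u`, so the flat error is cut off to compact support before being integrated
  -- along it.
  obtain ⟨θ, hθ, hθc, hθV, hθ1⟩ := exists_contDiff_cutoff hV
  obtain ⟨f, hf, hfeq⟩ := exists_hyp_eq_of_flat
    (ρ := fun z => θ z * (g z - A (z.1, z.2.1 * z.2.2) - hyp F₃ z)) fun N =>
    ⟨fun z => θ z * R N z, hθ.mul (hR N), hθc.mul_right, fun z => by
      by_cases hz : z ∈ tsupport θ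
      · rw [hρ N z (hθV hz)]
        ring
      · simp [image_eq_zero_of_notMem_tsupport hz]⟩
  refine ⟨A, fun z => F₃ z + f z, hA, hF₃.add hf, ?_⟩
  filter_upwards [hfeq, hθ1] with z h1 h2
  rw [hyp, fderiv_fun_add (hF₃.differentiable (by simp) z) (hf.differentiable (by simp) z),
    add_apply]
  rw [h2, one_mul] at h1
  simp only [hyp] at h1 ⊢
  rw [h1]
  ring

end Cohomological

/-! ### The Morse lemma with a parameter at a saddle -/

section Morse

/-- The isotropic vectors are `v + a w` for the two roots `a` of `Q v v + 2 a Q v w + a² Q w w`,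
which are real and distinct because `Q v v` and `Q w w` have opposite signs. If they were
proportional, `Q e₁ e₂` would vanish. -/
theorem exists_isotropic_basis (Q : ℝ × ℝ →L[ℝ] ℝ × ℝ →L[ℝ] ℝ) (hQ : ∀ x y, Q x y = Q y x)
    {v w : ℝ × ℝ} (hv : 0 < Q v v) (hw : Q w w < 0) :
    ∃ e₁ e₂ : ℝ × ℝ, Q e₁ e₁ = 0 ∧ Q e₂ e₂ = 0 ∧ 0 < Q e₁ e₂ ∧
      e₁.1 * e₂.2 - e₁.2 * e₂.1 ≠ 0 := by
  have hd : 0 < Q v w ^ 2 - Q v v * Q w w := by nlinarith [sq_nonneg (Q v w), mul_pos hv (neg_pos.2 hw)]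
  set δ := √(Q v w ^ 2 - Q v v * Q w w) with hδ
  have hδ2 : δ ^ 2 = Q v w ^ 2 - Q v v * Q w w := Real.sq_sqrt hd.le
  have hexp : ∀ a b : ℝ, Q (v + a • w) (v + b • w) =
      Q v v + (a + b) * Q v w + a * b * Q w w := fun a b => by
    simp only [map_add, map_smul, add_apply, smul_apply, smul_eq_mul, hQ w v]
    ring
  have h1 : Q (v + ((-Q v w + δ) / Q w w) • w) (v + ((-Q v w + δ) / Q w w) • w) = 0 := by
    rw [hexp]
    field_simp [hw.ne]
    linear_combination hδ2
  have h2 : Q (v + ((-Q v w - δ) / Q w w) • w) (v + ((-Q v w - δ) / Q w w) • w) = 0 := by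
    rw [hexp]
    field_simp [hw.ne]
    linear_combination hδ2
  have h3 : 0 < Q (v + ((-Q v w + δ) / Q w w) • w) (v + ((-Q v w - δ) / Q w w) • w) := by
    have : Q (v + ((-Q v w + δ) / Q w w) • w) (v + ((-Q v w - δ) / Q w w) • w) =
        2 * δ ^ 2 / (-Q w w) := by
      rw [hexp]
      field_simp [hw.ne]
      linear_combination hδ2
    rw [this]
    have : 0 < δ := Real.sqrt_pos.2 hd
    exact div_pos (by positivity) (neg_pos.2 hw)
  generalize v + ((-Q v w + δ) / Q w w) • w = e₁ at *
  generalize v + ((-Q v w - δ) / Q w w) • w = e₂ at *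
  refine ⟨e₁, e₂, h1, h2, h3, fun h0 => ?_⟩
  have ha : e₁.1 • e₂ = e₂.1 • e₁ := by
    ext
    · simp; ring
    · simp; linarith
  have hb : e₁.2 • e₂ = e₂.2 • e₁ := by
    ext
    · simp; linarith
    · simp; ring
  have ha' := congrArg (Q e₁) ha
  have hb' := congrArg (Q e₁) hb
  rw [map_smul, map_smul, h1, smul_zero, smul_eq_mul, mul_eq_zero] at ha' hb'
  have h4 : e₁ = 0 := Prod.ext (ha'.resolve_right h3.ne') (hb'.resolve_right h3.ne')
  rw [h4] at h3
  simp at h3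

theorem fderiv_fderiv_comp_clm {E F : Type*} [NormedAddCommGroup E] [NormedSpace ℝ E]
    [NormedAddCommGroup F] [NormedSpace ℝ F] {f : F → ℝ} (hf : ContDiff ℝ ∞ f) (L : E →L[ℝ] F)
    (z x y : E) :
    fderiv ℝ (fderiv ℝ (f ∘ L)) z x y = fderiv ℝ (fderiv ℝ f) (L z) (L x) (L y) := by
  have h1 : fderiv ℝ (f ∘ L) = fun z => (fderiv ℝ f (L z)) ∘L L := by
    funext z
    rw [fderiv_comp z (hf.differentiable (by simp) _) L.differentiableAt, L.fderiv]
  have h2 : Differentiable ℝ (fderiv ℝ f) :=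
    (hf.fderiv_right (m := ∞) (by simp)).differentiable (by simp)
  have h3 : HasFDerivAt (fun z => fderiv ℝ f (L z)) ((fderiv ℝ (fderiv ℝ f) (L z)) ∘L L) z :=
    (h2 (L z)).hasFDerivAt.comp z L.hasFDerivAt
  rw [h1, (h3.clm_comp (hasFDerivAt_const L z)).fderiv]
  simp

theorem fderiv_apply_comm {E : Type*} [NormedAddCommGroup E] [NormedSpace ℝ E]
    {F : Type*} [NormedAddCommGroup F] [NormedSpace ℝ F] {f : E → F}
    (hf : ContDiff ℝ ∞ f) (z x y : E) :
    fderiv ℝ (fun z => fderiv ℝ f z x) z y = fderiv ℝ (fun z => fderiv ℝ f z y) z x := by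
  have h2 : Differentiable ℝ (fderiv ℝ f) :=
    (hf.fderiv_right (m := ∞) (by simp)).differentiable (by simp)
  rw [fderiv_clm_apply (h2 z) (differentiableAt_const _),
    fderiv_clm_apply (h2 z) (differentiableAt_const _)]
  have h3 := ((contDiff_infty.1 hf 2).contDiffAt (x := z)).isSymmSndFDerivAt (by simp)
  simpa using h3.eq y x

theorem contDiff_fderiv_apply_const {E : Type*} [NormedAddCommGroup E] [NormedSpace ℝ E]
    {F : Type*} [NormedAddCommGroup F] [NormedSpace ℝ F] {f : E → F} (hf : ContDiff ℝ ∞ f) (e : E) : ContDiff ℝ ∞ fun z => fderiv ℝ f z e :=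
  (hf.fderiv_right (m := ∞) (by simp)).clm_apply contDiff_const

theorem fderiv_comp_shift {f : ℝ × ℝ × ℝ → ℝ} (hf : ContDiff ℝ ∞ f) {c : ℝ → ℝ × ℝ}
    (hc : ContDiff ℝ ∞ c) (z : ℝ × ℝ × ℝ) (w : ℝ × ℝ) :
    fderiv ℝ (fun z : ℝ × ℝ × ℝ => f (z.1, c z.1 + z.2)) z (0, w) =
      fderiv ℝ f (z.1, c z.1 + z.2) (0, w) := by
  have h1 : HasFDerivAt (fun z : ℝ × ℝ × ℝ => (z.1, c z.1 + z.2)) _ z :=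
    (hasFDerivAt_fst (𝕜 := ℝ) (p := z)).prodMk
      (((hc.differentiable (by simp) z.1).hasFDerivAt.comp z hasFDerivAt_fst).add hasFDerivAt_snd)
  have h2 := (hf.differentiable (by simp) (z.1, c z.1 + z.2)).hasFDerivAt.comp z h1
  rw [HasFDerivAt.fderiv (f := fun z : ℝ × ℝ × ℝ => f (z.1, c z.1 + z.2)) h2]
  simp

/-- A family of functions of two variables with a nondegenerate critical point at the origin for
the value `0` of the parameter can be shifted so that the origin is critical for all parameters. -/
theorem exists_critical_shift {h : ℝ × ℝ × ℝ → ℝ} (hh : ContDiff ℝ ∞ h)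
    (hu : fderiv ℝ h 0 (0, 1, 0) = 0) (hv : fderiv ℝ h 0 (0, 0, 1) = 0)
    (huu : fderiv ℝ (fun z => fderiv ℝ h z (0, 1, 0)) 0 (0, 1, 0) = 0)
    (hvv : fderiv ℝ (fun z => fderiv ℝ h z (0, 0, 1)) 0 (0, 0, 1) = 0)
    (huv : 0 < fderiv ℝ (fun z => fderiv ℝ h z (0, 1, 0)) 0 (0, 0, 1)) :
    ∃ c : ℝ → ℝ × ℝ, ContDiff ℝ ∞ c ∧ c 0 = 0 ∧
      ∀ᶠ s in 𝓝 0, fderiv ℝ h (s, c s) (0, 1, 0) = 0 ∧ fderiv ℝ h (s, c s) (0, 0, 1) = 0 := by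
  have hcu := contDiff_fderiv_apply_const hh (0, 1, 0)
  have hcv := contDiff_fderiv_apply_const hh (0, 0, 1)
  have hvu := fderiv_apply_comm hh 0 (0, 1, 0) (0, 0, 1)
  -- The critical points are the preimages of `(s, 0, 0)` under `P`, a local diffeomorphism because
  -- the Hessian block in `(u, v)` is antidiagonal with nonzero entries.
  let P : ℝ × ℝ × ℝ → ℝ × ℝ × ℝ :=
    fun z => (z.1, fderiv ℝ h z (0, 1, 0), fderiv ℝ h z (0, 0, 1))
  have hP : ContDiff ℝ ∞ P := contDiff_fst.prodMk (hcu.prodMk hcv)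
  have hP0 : P 0 = 0 := by simp only [P, hu, hv]; rfl
  have hPd : fderiv ℝ P 0 = _ :=
    ((hasFDerivAt_fst (𝕜 := ℝ) (p := (0 : ℝ × ℝ × ℝ))).prodMk
      ((hcu.differentiable (by simp) 0).hasFDerivAt.prodMk
        (hcv.differentiable (by simp) 0).hasFDerivAt)).fderiv
  have hinj : Function.Injective (fderiv ℝ P 0) := by
    rw [injective_iff_map_eq_zero]
    rintro ⟨a, b, d⟩ hx
    rw [hPd] at hx
    have h1 : a = 0 := congrArg Prod.fst hx
    subst h1
    have hdec : ((0 : ℝ), b, d) = b • ((0 : ℝ), (1 : ℝ), (0 : ℝ)) + d • ((0 : ℝ), (0 : ℝ), (1 : ℝ)) := by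
      simp
    have h2 := congrArg (fun y => y.2.1) hx
    have h3 := congrArg (fun y => y.2.2) hx
    simp only [ContinuousLinearMap.prod_apply, Prod.snd_zero, Prod.fst_zero] at h2 h3
    rw [hdec, map_add, map_smul, map_smul] at h2 h3
    rw [huu, smul_zero, zero_add, smul_eq_mul, mul_eq_zero] at h2
    rw [hvv, smul_zero, add_zero, ← hvu, smul_eq_mul, mul_eq_zero] at h3
    rw [h2.resolve_right huv.ne', h3.resolve_right huv.ne']
    rfl
  obtain ⟨g, hg, hg1, hg2⟩ := exists_contDiff_local_inverse hP 0 hinj rfl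
  rw [hP0] at hg2
  refine ⟨fun s => (g (s, 0, 0)).2, contDiff_snd.comp (hg.comp (by fun_prop)), ?_, ?_⟩
  · have := hg1.self_of_nhds
    rw [hP0] at this
    exact congrArg Prod.snd this
  · have hc : ContinuousAt (fun s : ℝ => (s, (0 : ℝ), (0 : ℝ))) 0 := by fun_prop
    filter_upwards [hc.eventually hg2] with s hs
    have h1 : (g (s, 0, 0)).1 = s := congrArg Prod.fst hs
    have h2 : (s, (g (s, 0, 0)).2) = g (s, 0, 0) := Prod.ext h1.symm rfl
    rw [h2]
    exact ⟨congrArg (fun y => y.2.1) hs, congrArg (fun y => y.2.2) hs⟩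

/-- The second-order Taylor expansion, with smooth coefficients, of a family of functions. -/
theorem exists_quadratic_expansion {h : ℝ × ℝ × ℝ → ℝ} (hh : ContDiff ℝ ∞ h) :
    ∃ α κ γ : ℝ × ℝ × ℝ → ℝ, ContDiff ℝ ∞ α ∧ ContDiff ℝ ∞ κ ∧ ContDiff ℝ ∞ γ ∧
      (∀ z, h z = h (z.1, 0, 0) + z.2.1 * fderiv ℝ h (z.1, 0, 0) (0, 1, 0) +
        z.2.2 * fderiv ℝ h (z.1, 0, 0) (0, 0, 1) +
        (α z * z.2.1 ^ 2 + κ z * (z.2.1 * z.2.2) + γ z * z.2.2 ^ 2)) ∧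
      2 * α 0 = fderiv ℝ (fun z => fderiv ℝ h z (0, 1, 0)) 0 (0, 1, 0) ∧
      2 * γ 0 = fderiv ℝ (fun z => fderiv ℝ h z (0, 0, 1)) 0 (0, 0, 1) ∧
      κ 0 = fderiv ℝ (fun z => fderiv ℝ h z (0, 1, 0)) 0 (0, 0, 1) := by
  let ℓu : ℝ × ℝ × ℝ →L[ℝ] ℝ := ContinuousLinearMap.fst ℝ ℝ ℝ ∘L ContinuousLinearMap.snd ℝ ℝ (ℝ × ℝ)
  let ℓv : ℝ × ℝ × ℝ →L[ℝ] ℝ := ContinuousLinearMap.snd ℝ ℝ ℝ ∘L ContinuousLinearMap.snd ℝ ℝ (ℝ × ℝ)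
  have hsu : ∀ z : ℝ × ℝ × ℝ, z - ℓu z • ((0 : ℝ), (1 : ℝ), (0 : ℝ)) = (z.1, 0, z.2.2) := by
    intro z; ext <;> simp [ℓu]
  have hsv : ∀ z : ℝ × ℝ × ℝ, z - ℓv z • ((0 : ℝ), (0 : ℝ), (1 : ℝ)) = (z.1, z.2.1, 0) := by
    intro z; ext <;> simp [ℓv]
  have second : ∀ (ℓ : ℝ × ℝ × ℝ →L[ℝ] ℝ) (e : ℝ × ℝ × ℝ) (r : ℝ × ℝ × ℝ → ℝ) (e' : ℝ × ℝ × ℝ),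
      ContDiff ℝ ∞ r → (∀ z, fderiv ℝ h z e = r z + ℓ z * fderiv ℝ r z e) →
      fderiv ℝ (fun z => fderiv ℝ h z e) 0 e' = fderiv ℝ r 0 e' + ℓ e' * fderiv ℝ r 0 e := by
    intro ℓ e r e' hr hre
    have h1 : Differentiable ℝ r := hr.differentiable (by simp)
    have h2 : Differentiable ℝ fun z => fderiv ℝ r z e :=
      (contDiff_fderiv_apply_const hr e).differentiable (by simp)
    simp only [hre]
    rw [fderiv_fun_add (h1 0) (ℓ.differentiableAt.fun_mul (h2 0)), fderiv_fun_mul ℓ.differentiableAt (h2 0)]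
    simp [mul_comm]
  obtain ⟨k, hk, hk1, hk2⟩ := exists_hadamard_along ℓu (0, 1, 0) rfl hh
  obtain ⟨κ, hκ, hκ1, hκ2⟩ := exists_hadamard_along ℓv (0, 0, 1) rfl hk
  obtain ⟨k₃, hk₃, hk₃1, hk₃2⟩ := exists_hadamard_along ℓu (0, 1, 0) rfl hk
  obtain ⟨l, hl, hl1, hl2⟩ := exists_hadamard_along ℓv (0, 0, 1) rfl hh
  obtain ⟨l₂, hl₂, hl₂1, hl₂2⟩ := exists_hadamard_along ℓv (0, 0, 1) rfl hl
  simp only [hsu, hsv] at hk1 hκ1 hk₃1 hl1 hl₂1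
  refine ⟨fun z => k₃ (z.1, z.2.1, 0), κ, fun z => l₂ (z.1, 0, z.2.2), hk₃.comp (by fun_prop), hκ,
    hl₂.comp (by fun_prop), fun z => ?_, ?_, ?_, ?_⟩
  · have e1 := hk1 z
    have e2 := hκ1 z
    have e3 := hk₃1 (z.1, z.2.1, 0)
    have e4 := hl1 (z.1, 0, z.2.2)
    have e5 := hl₂1 (z.1, 0, z.2.2)
    have e6 := hk2 (z.1, 0, 0)
    have e7 := hl2 (z.1, 0, 0)
    simp only [ℓu, ℓv, ContinuousLinearMap.comp_apply, ContinuousLinearMap.coe_fst',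
      ContinuousLinearMap.coe_snd', zero_mul, add_zero] at e1 e2 e3 e4 e5 e6 e7
    rw [e6, e7, e1, e4, e5, e2, e3]
    ring
  · have e1 := second ℓu _ k (0, 1, 0) hk hk2
    have e2 := hk₃2 0
    simp only [map_zero, zero_mul, add_zero] at e2
    rw [e1, e2]
    simp only [ℓu, ContinuousLinearMap.comp_apply, ContinuousLinearMap.coe_fst',
      ContinuousLinearMap.coe_snd', Prod.fst_zero, Prod.snd_zero]
    rw [show ((0 : ℝ), (0 : ℝ), (0 : ℝ)) = 0 from rfl]
    ring
  · have e1 := second ℓv _ l (0, 0, 1) hl hl2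
    have e2 := hl₂2 0
    simp only [map_zero, zero_mul, add_zero] at e2
    rw [e1, e2]
    simp only [ℓv, ContinuousLinearMap.comp_apply,
      ContinuousLinearMap.coe_snd', Prod.fst_zero, Prod.snd_zero]
    rw [show ((0 : ℝ), (0 : ℝ), (0 : ℝ)) = 0 from rfl]
    ring
  · have e1 := second ℓu _ k (0, 0, 1) hk hk2
    have e2 := hκ2 0
    simp only [map_zero, zero_mul, add_zero] at e2
    rw [e1, e2]
    simp [ℓu]

/-- One has `α u² + κ uv + γ v² = (r u + γ v)(v + (α / r) u)` when `r² - κ r + α γ = 0`. The root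
with `r 0 = κ 0 > 0` is smooth since the discriminant is positive near `0`, and `α 0 = γ 0 = 0`
makes the derivative of `T` at `0` diagonal. -/
theorem exists_saddle_factorization {α κ γ : ℝ × ℝ × ℝ → ℝ} (hα : ContDiff ℝ ∞ α)
    (hκ : ContDiff ℝ ∞ κ) (hγ : ContDiff ℝ ∞ γ) (hα0 : α 0 = 0) (hγ0 : γ 0 = 0) (hκ0 : 0 < κ 0) :
    ∃ T : ℝ × ℝ × ℝ → ℝ × ℝ × ℝ, ContDiff ℝ ∞ T ∧ T 0 = 0 ∧ Function.Injective (fderiv ℝ T 0) ∧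
      (∀ z, (T z).1 = z.1) ∧ ∀ᶠ z in 𝓝 0, α z * z.2.1 ^ 2 + κ z * (z.2.1 * z.2.2) +
        γ z * z.2.2 ^ 2 = (T z).2.1 * (T z).2.2 := by
  let D : ℝ × ℝ × ℝ → ℝ := fun z => (κ z / 2) ^ 2 - α z * γ z
  have hD : ContDiff ℝ ∞ D := ((hκ.div_const 2).pow 2).sub (hα.mul hγ)
  have hD0 : 0 < D 0 := by simp only [D, hα0, zero_mul, sub_zero]; positivity
  have hDo : IsOpen {z | 0 < D z} := isOpen_lt continuous_const hD.continuous
  obtain ⟨r, hr, hr'⟩ := exists_contDiff_eventuallyEq (f := fun z => κ z / 2 + √(D z))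
    (hDo.mem_nhds hD0)
    ((hκ.div_const 2).contDiffOn.add (hD.contDiffOn.sqrt fun z hz => (ne_of_gt hz)))
  have hr0 : 0 < r 0 := by
    rw [hr'.self_of_nhds]
    have := Real.sqrt_nonneg (D 0)
    positivity
  have hro : IsOpen {z | 0 < r z} := isOpen_lt continuous_const hr.continuous
  obtain ⟨q, hq, hq'⟩ := exists_contDiff_eventuallyEq (f := fun z => α z / r z)
    (hro.mem_nhds hr0) (hα.contDiffOn.div hr.contDiffOn fun z hz => (ne_of_gt hz))
  have hq0 : q 0 = 0 := by rw [hq'.self_of_nhds, hα0, zero_div]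
  have hu : HasFDerivAt (fun z : ℝ × ℝ × ℝ => z.2.1) (ContinuousLinearMap.fst ℝ ℝ ℝ ∘L
      ContinuousLinearMap.snd ℝ ℝ (ℝ × ℝ)) 0 := hasFDerivAt_fst.comp 0 hasFDerivAt_snd
  have hv : HasFDerivAt (fun z : ℝ × ℝ × ℝ => z.2.2) (ContinuousLinearMap.snd ℝ ℝ ℝ ∘L
      ContinuousLinearMap.snd ℝ ℝ (ℝ × ℝ)) 0 := hasFDerivAt_snd.comp 0 hasFDerivAt_snd
  refine ⟨fun z => (z.1, r z * z.2.1 + γ z * z.2.2, z.2.2 + q z * z.2.1), by fun_prop, by simp,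
    ?_, fun z => rfl, ?_⟩
  · have hd := (hasFDerivAt_fst (𝕜 := ℝ) (p := (0 : ℝ × ℝ × ℝ))).prodMk
      ((((hr.differentiable (by simp) 0).hasFDerivAt.mul hu).add
        ((hγ.differentiable (by simp) 0).hasFDerivAt.mul hv)).prodMk
        (hv.add ((hq.differentiable (by simp) 0).hasFDerivAt.mul hu)))
    rw [HasFDerivAt.fderiv (f := fun z : ℝ × ℝ × ℝ =>
      (z.1, r z * z.2.1 + γ z * z.2.2, z.2.2 + q z * z.2.1)) hd, injective_iff_map_eq_zero]
    rintro ⟨a, b, c⟩ hx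
    simp [hγ0, hq0] at hx
    obtain ⟨h1, h2, h3⟩ := hx
    simp only [h1, h3, h2.resolve_left hr0.ne']
    rfl
  · filter_upwards [hr', hq', hro.mem_nhds hr0, hDo.mem_nhds hD0] with z h1 h2 h3 h4
    have h3' : r z ≠ 0 := ne_of_gt h3
    have h4' : √(D z) ^ 2 = D z := Real.sq_sqrt (le_of_lt h4)
    have h5 : r z * κ z = r z ^ 2 + α z * γ z := by
      simp only [D] at h4'
      rw [h1]
      linear_combination -h4'
    rw [h2]
    field_simp
    linear_combination z.2.1 * z.2.2 * h5

/-- After the shift to the critical points the linear terms vanish for every small `s`, leaving a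
quadratic form with variable coefficients, which factors into two new coordinates. -/
theorem exists_morse_saddle_normalized {h : ℝ × ℝ × ℝ → ℝ} (hh : ContDiff ℝ ∞ h)
    (hu : fderiv ℝ h 0 (0, 1, 0) = 0) (hv : fderiv ℝ h 0 (0, 0, 1) = 0)
    (huu : fderiv ℝ (fun z => fderiv ℝ h z (0, 1, 0)) 0 (0, 1, 0) = 0)
    (hvv : fderiv ℝ (fun z => fderiv ℝ h z (0, 0, 1)) 0 (0, 0, 1) = 0)
    (huv : 0 < fderiv ℝ (fun z => fderiv ℝ h z (0, 1, 0)) 0 (0, 0, 1)) :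
    ∃ (S S' : ℝ × ℝ × ℝ → ℝ × ℝ × ℝ) (h₀ : ℝ → ℝ), ContDiff ℝ ∞ S ∧ ContDiff ℝ ∞ S' ∧
      ContDiff ℝ ∞ h₀ ∧ S 0 = 0 ∧ (∀ᶠ z in 𝓝 0, S' (S z) = z) ∧ (∀ᶠ z in 𝓝 0, (S z).1 = z.1) ∧
      ∀ᶠ z in 𝓝 0, h (S z) = h₀ z.1 + z.2.1 * z.2.2 := by
  obtain ⟨c, hc, hc0, hcrit⟩ := exists_critical_shift hh hu hv huu hvv huv
  let τ : ℝ × ℝ × ℝ → ℝ × ℝ × ℝ := fun z => (z.1, c z.1 + z.2)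
  have hτ : ContDiff ℝ ∞ τ := by fun_prop
  have hτ0 : τ 0 = 0 := by simp [τ, hc0]
  let h₁ : ℝ × ℝ × ℝ → ℝ := fun z => h (τ z)
  have hh₁ : ContDiff ℝ ∞ h₁ := hh.comp hτ
  have h₁d : ∀ w z, fderiv ℝ h₁ z (0, w) = fderiv ℝ h (τ z) (0, w) := fun w z =>
    fderiv_comp_shift hh hc z w
  have h₁dd : ∀ w w', fderiv ℝ (fun z => fderiv ℝ h₁ z (0, w)) 0 (0, w') =
      fderiv ℝ (fun z => fderiv ℝ h z (0, w)) 0 (0, w') := fun w w' => by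
    simp only [h₁d]
    have := fderiv_comp_shift (contDiff_fderiv_apply_const hh (0, w)) hc 0 w'
    refine this.trans ?_
    rw [show (((0 : ℝ × ℝ × ℝ).1, c (0 : ℝ × ℝ × ℝ).1 + (0 : ℝ × ℝ × ℝ).2) : ℝ × ℝ × ℝ) = 0
      from hτ0]
  obtain ⟨α, κ, γ, hα, hκ, hγ, hexp, hα0, hγ0, hκ0⟩ := exists_quadratic_expansion hh₁
  rw [h₁dd] at hα0 hγ0 hκ0
  obtain ⟨T, hT, hT0, hTinj, hT1, hTeq⟩ := exists_saddle_factorization hα hκ hγ (by linarith)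
    (by linarith) (by linarith)
  obtain ⟨g, hg, hgT, hTg⟩ := exists_contDiff_local_inverse hT 0 hTinj rfl
  rw [hT0] at hTg
  have hg0 : g 0 = 0 := by
    have := hgT.self_of_nhds
    rwa [hT0] at this
  have hgc : Filter.Tendsto g (𝓝 0) (𝓝 0) := by
    have := hg.continuous.tendsto 0
    rwa [hg0] at this
  have hg1 : ∀ᶠ z in 𝓝 0, (g z).1 = z.1 := by
    filter_upwards [hTg] with z hz
    rw [← hT1, hz]
  refine ⟨fun z => τ (g z), fun z => T (z.1, z.2 - c z.1), fun s => h₁ (s, 0, 0), hτ.comp hg,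
    hT.comp (by fun_prop), hh₁.comp (by fun_prop), by simp only [hg0, hτ0], ?_, ?_, ?_⟩
  · filter_upwards [hTg] with z hz
    simpa [τ] using hz
  · filter_upwards [hg1] with z hz
    exact hz
  · have hfst : Filter.Tendsto (fun z : ℝ × ℝ × ℝ => z.1) (𝓝 0) (𝓝 0) :=
      continuous_fst.tendsto _
    filter_upwards [hTg, hg1, hgc.eventually hTeq, hfst.eventually hcrit] with z h1 h2 h3 h4
    have h5 := hexp (g z)
    have hτs : τ (z.1, 0, 0) = (z.1, c z.1) := by simp [τ, ← Prod.zero_eq_mk]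
    rw [h3, h2, h₁d, h₁d, hτs, h4.1, h4.2, h1] at h5
    simpa using h5

/-- The Morse lemma with a parameter for saddle points of functions of two variables. -/
theorem exists_morse_saddle {h : ℝ × ℝ × ℝ → ℝ} (hh : ContDiff ℝ ∞ h)
    (hcrit : fderiv ℝ (fun w : ℝ × ℝ => h (0, w)) 0 = 0)
    (hpos : ∃ v, 0 < hessian (fun w => h (0, w)) 0 v v)
    (hneg : ∃ w, hessian (fun w => h (0, w)) 0 w w < 0) :
    ∃ (S S' : ℝ × ℝ × ℝ → ℝ × ℝ × ℝ) (h₀ : ℝ → ℝ), ContDiff ℝ ∞ S ∧ ContDiff ℝ ∞ S' ∧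
      ContDiff ℝ ∞ h₀ ∧ S 0 = 0 ∧ (∀ᶠ z in 𝓝 0, S' (S z) = z) ∧ (∀ᶠ z in 𝓝 0, (S z).1 = z.1) ∧
      ∀ᶠ z in 𝓝 0, h (S z) = h₀ z.1 + z.2.1 * z.2.2 := by
  obtain ⟨v, hv⟩ := hpos
  obtain ⟨w, hw⟩ := hneg
  let ι : ℝ × ℝ →L[ℝ] ℝ × ℝ × ℝ := ContinuousLinearMap.inr ℝ ℝ (ℝ × ℝ)
  have hk : (fun w : ℝ × ℝ => h (0, w)) = h ∘ ι := rfl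
  have hess : ∀ x y, hessian (fun w => h (0, w)) 0 x y =
      fderiv ℝ (fderiv ℝ h) 0 (0, x) (0, y) := fun x y => by
    rw [hessian, hk, fderiv_fderiv_comp_clm hh, map_zero]
    rfl
  have h2d : Differentiable ℝ (fderiv ℝ h) :=
    (hh.fderiv_right (m := ∞) (by simp)).differentiable (by simp)
  have happ : ∀ {f : ℝ × ℝ × ℝ → ℝ}, ContDiff ℝ ∞ f → ∀ x y,
      fderiv ℝ (fun z => fderiv ℝ f z x) 0 y = fderiv ℝ (fderiv ℝ f) 0 y x := fun hf x y => by
    rw [fderiv_clm_apply (((hf.fderiv_right (m := ∞) (by simp)).differentiable (by simp)) 0)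
      (differentiableAt_const _)]
    simp
  have hsymm : ∀ x y, fderiv ℝ (fderiv ℝ h) 0 x y = fderiv ℝ (fderiv ℝ h) 0 y x := fun x y => by
    rw [← happ hh, ← happ hh, fderiv_apply_comm hh]
  let Q : ℝ × ℝ →L[ℝ] ℝ × ℝ →L[ℝ] ℝ := fderiv ℝ (fderiv ℝ (fun w => h (0, w))) 0
  have hQ : ∀ x y, Q x y = fderiv ℝ (fderiv ℝ h) 0 (0, x) (0, y) := hess
  -- In an isotropic basis the pure second derivatives vanish and the mixed one is positive, which
  -- is the normalized case.
  obtain ⟨e₁, e₂, h11, h22, h12, hdet⟩ := exists_isotropic_basis Q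
    (fun x y => by rw [hQ, hQ, hsymm]) hv hw
  let Λ : ℝ × ℝ × ℝ →L[ℝ] ℝ × ℝ × ℝ := (ContinuousLinearMap.fst ℝ ℝ (ℝ × ℝ)).prod
    (((ContinuousLinearMap.fst ℝ ℝ ℝ).smulRight e₁ + (ContinuousLinearMap.snd ℝ ℝ ℝ).smulRight e₂) ∘L
      ContinuousLinearMap.snd ℝ ℝ (ℝ × ℝ))
  have hΛ : ∀ z, Λ z = (z.1, z.2.1 • e₁ + z.2.2 • e₂) := fun z => by simp [Λ]
  let Λ' : ℝ × ℝ × ℝ → ℝ × ℝ × ℝ := fun z =>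
    (z.1, (z.2.1 * e₂.2 - z.2.2 * e₂.1) / (e₁.1 * e₂.2 - e₁.2 * e₂.1),
      (z.2.2 * e₁.1 - z.2.1 * e₁.2) / (e₁.1 * e₂.2 - e₁.2 * e₂.1))
  have hΛ' : ∀ z, Λ' (Λ z) = z := fun z => by
    rw [hΛ]
    ext
    · rfl
    · simp only [Λ', Prod.fst_add, Prod.snd_add, Prod.smul_fst, Prod.smul_snd, smul_eq_mul]
      rw [div_eq_iff hdet]
      ring
    · simp only [Λ', Prod.fst_add, Prod.snd_add, Prod.smul_fst, Prod.smul_snd, smul_eq_mul]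
      rw [div_eq_iff hdet]
      ring
  have hΛs : ContDiff ℝ ∞ (h ∘ Λ) := hh.comp Λ.contDiff
  have hdd : ∀ x y, fderiv ℝ (fun z => fderiv ℝ (h ∘ Λ) z x) 0 y =
      fderiv ℝ (fderiv ℝ h) 0 (Λ y) (Λ x) := fun x y => by
    rw [happ hΛs, fderiv_fderiv_comp_clm hh, map_zero]
  have hΛ1 : Λ (0, 1, 0) = (0, e₁) := by rw [hΛ]; simp
  have hΛ2 : Λ (0, 0, 1) = (0, e₂) := by rw [hΛ]; simp
  have hd0 : ∀ w : ℝ × ℝ, fderiv ℝ h 0 (0, w) = 0 := fun w => by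
    have h1 := (hh.differentiable (by simp) (ι 0)).hasFDerivAt.comp 0 ι.hasFDerivAt
    rw [map_zero] at h1
    have h2 := h1.fderiv
    rw [← hk, hcrit] at h2
    exact (DFunLike.congr_fun h2 w).symm
  have hd1 : ∀ x, fderiv ℝ (h ∘ Λ) 0 x = fderiv ℝ h 0 (Λ x) := fun x => by
    have h1 := (hh.differentiable (by simp) (Λ 0)).hasFDerivAt.comp 0 Λ.hasFDerivAt
    rw [map_zero] at h1
    rw [h1.fderiv]
    rfl
  obtain ⟨S, S', h₀, hS, hS', hh₀, hS0, hSS, hS1, hSh⟩ := exists_morse_saddle_normalized hΛs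
    (by rw [hd1, hΛ1, hd0]) (by rw [hd1, hΛ2, hd0])
    (by rw [hdd, hΛ1, ← hQ, h11]) (by rw [hdd, hΛ2, ← hQ, h22])
    (by rw [hdd, hΛ1, hΛ2, hsymm, ← hQ]; exact h12)
  refine ⟨fun z => Λ (S z), fun z => S' (Λ' z), h₀, Λ.contDiff.comp hS, hS'.comp ?_, hh₀, ?_, ?_,
    ?_, hSh⟩
  · simp only [Λ']
    fun_prop
  · simp only [hS0, map_zero]
  · filter_upwards [hSS] with z hz
    rw [hΛ', hz]
  · filter_upwards [hS1] with z hz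
    rw [hΛ, hz]

end Morse

/-! ### The volume-preserving Morse lemma and fibrewise potentials -/

section Isochore

theorem hyp_eq {f : ℝ × ℝ × ℝ → ℝ} (z : ℝ × ℝ × ℝ) :
    hyp f z = z.2.1 * fderiv ℝ f z (0, 1, 0) - z.2.2 * fderiv ℝ f z (0, 0, 1) := by
  have h : ((0 : ℝ), z.2.1, -z.2.2) =
      z.2.1 • ((0 : ℝ), (1 : ℝ), (0 : ℝ)) - z.2.2 • ((0 : ℝ), (0 : ℝ), (1 : ℝ)) := by simp
  rw [hyp, h, map_sub, map_smul, map_smul, smul_eq_mul, smul_eq_mul]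

theorem hasFDerivAt_mid (z : ℝ × ℝ × ℝ) : HasFDerivAt (fun z : ℝ × ℝ × ℝ => z.2.1)
    (ContinuousLinearMap.fst ℝ ℝ ℝ ∘L ContinuousLinearMap.snd ℝ ℝ (ℝ × ℝ)) z :=
  hasFDerivAt_fst.comp z hasFDerivAt_snd

theorem hasFDerivAt_last (z : ℝ × ℝ × ℝ) : HasFDerivAt (fun z : ℝ × ℝ × ℝ => z.2.2)
    (ContinuousLinearMap.snd ℝ ℝ ℝ ∘L ContinuousLinearMap.snd ℝ ℝ (ℝ × ℝ)) z :=
  hasFDerivAt_snd.comp z hasFDerivAt_snd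

/-- The partial derivatives of a function of `(s, uv)`. -/
theorem fderiv_comp_saddle {A : ℝ × ℝ → ℝ} (hA : ContDiff ℝ ∞ A) (z : ℝ × ℝ × ℝ) :
    fderiv ℝ (fun z : ℝ × ℝ × ℝ => A (z.1, z.2.1 * z.2.2)) z (0, 1, 0) =
        z.2.2 * fderiv ℝ A (z.1, z.2.1 * z.2.2) (0, 1) ∧
      fderiv ℝ (fun z : ℝ × ℝ × ℝ => A (z.1, z.2.1 * z.2.2)) z (0, 0, 1) =
        z.2.1 * fderiv ℝ A (z.1, z.2.1 * z.2.2) (0, 1) := by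
  have h1 := (hA.differentiable (by simp) (z.1, z.2.1 * z.2.2)).hasFDerivAt.comp z
    ((hasFDerivAt_fst (𝕜 := ℝ) (p := z)).prodMk ((hasFDerivAt_mid z).mul (hasFDerivAt_last z)))
  rw [HasFDerivAt.fderiv (f := fun z : ℝ × ℝ × ℝ => A (z.1, z.2.1 * z.2.2)) h1]
  have h2 : ∀ t : ℝ, ((0 : ℝ), t) = t • ((0 : ℝ), (1 : ℝ)) := fun t => by simp
  constructor
  · rw [show z.2.2 * fderiv ℝ A (z.1, z.2.1 * z.2.2) (0, 1) =
      fderiv ℝ A (z.1, z.2.1 * z.2.2) (0, z.2.2) by rw [h2 z.2.2, map_smul, smul_eq_mul]]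
    simp
  · rw [show z.2.1 * fderiv ℝ A (z.1, z.2.1 * z.2.2) (0, 1) =
      fderiv ℝ A (z.1, z.2.1 * z.2.2) (0, z.2.1) by rw [h2 z.2.1, map_smul, smul_eq_mul]]
    simp

theorem hyp_comp_saddle {A : ℝ × ℝ → ℝ} (hA : ContDiff ℝ ∞ A) (z : ℝ × ℝ × ℝ) :
    hyp (fun z : ℝ × ℝ × ℝ => A (z.1, z.2.1 * z.2.2)) z = 0 := by
  rw [hyp_eq, (fderiv_comp_saddle hA z).1, (fderiv_comp_saddle hA z).2]
  ring

/-- The map `c ↦ c A(s, c)` has derivative `A(0, 0) > 0` at the origin. Its inverse `b` recovers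
`uv` from `YN`, and the sign of its derivative becomes that of `∂₂Φ`. -/
theorem exists_saddle_action_inverse {A : ℝ × ℝ → ℝ} (hA : ContDiff ℝ ∞ A) (h0 : 0 < A (0, 0)) :
    ∃ b : ℝ × ℝ → ℝ, ContDiff ℝ ∞ b ∧ 0 < deriv (fun t : ℝ => b (0, t)) 0 ∧
      ∀ᶠ x in 𝓝 ((0 : ℝ), (0 : ℝ)), b (x.1, x.2 * A x) = x.2 := by
  let G : ℝ × ℝ → ℝ × ℝ := fun x => (x.1, x.2 * A x)
  have hG : ContDiff ℝ ∞ G := by fun_prop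
  have hG0 : G (0, 0) = (0, 0) := by simp [G]
  have hd : fderiv ℝ G (0, 0) = _ := ((hasFDerivAt_fst (𝕜 := ℝ) (p := ((0 : ℝ), (0 : ℝ)))).prodMk
    (hasFDerivAt_snd.mul (hA.differentiable (by simp) (0, 0)).hasFDerivAt)).fderiv
  have hinj : Function.Injective (fderiv ℝ G (0, 0)) := by
    rw [hd, injective_iff_map_eq_zero]
    rintro ⟨x, y⟩ hx
    simp [h0.ne'] at hx
    simp [hx]
  obtain ⟨g, hg, hg1, -⟩ := exists_contDiff_local_inverse hG (0, 0) hinj rfl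
  have hb : ContDiff ℝ ∞ fun x => (g x).2 := contDiff_snd.comp hg
  refine ⟨fun x => (g x).2, hb, ?_, ?_⟩
  · have hb' : ContDiff ℝ ∞ fun t : ℝ => (g (0, t)).2 := hb.comp (by fun_prop)
    have hβ := (hb'.differentiable (by simp) 0).hasDerivAt
    set β := deriv (fun t : ℝ => (g (0, t)).2) 0
    have hA1 : ContDiff ℝ ∞ fun t : ℝ => A (0, t) := hA.comp (by fun_prop)
    have h1 := (hasDerivAt_id (0 : ℝ)).mul (hA1.differentiable (by simp) 0).hasDerivAt
    have h2 : HasDerivAt (fun t : ℝ => t * A (0, t)) (A (0, 0)) 0 :=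
      h1.congr_deriv (by simp)
    have h3 : HasDerivAt (fun t : ℝ => (g (0, t)).2) β ((fun t : ℝ => t * A (0, t)) 0) := by
      simpa using hβ
    have h4 := h3.comp (0 : ℝ) h2
    have hc : ContinuousAt (fun t : ℝ => ((0 : ℝ), t)) 0 := by fun_prop
    have h5 : HasDerivAt (fun t : ℝ => t) (β * A (0, 0)) 0 := by
      refine h4.congr_of_eventuallyEq ?_
      filter_upwards [hc.eventually hg1] with t ht
      exact (congrArg Prod.snd ht).symm
    have h6 := h5.unique (hasDerivAt_id' 0)
    exact pos_of_mul_pos_left (h6 ▸ one_pos) h0.le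
  · filter_upwards [hg1] with x hx
    exact congrArg Prod.snd hx

/-- The volume-preserving Morse lemma with a parameter, for saddles already in Morse form: a change
of coordinates `(u, v) ↦ (Y, N)` preserving the levels of `uv` turns a density into `1`. -/
theorem exists_isochore {g : ℝ × ℝ × ℝ → ℝ} (hg : ContDiff ℝ ∞ g) (hg0 : g 0 < 0) :
    ∃ (Y N : ℝ × ℝ × ℝ → ℝ) (b : ℝ × ℝ → ℝ), ContDiff ℝ ∞ Y ∧ ContDiff ℝ ∞ N ∧ ContDiff ℝ ∞ b ∧
      Y 0 = 0 ∧ N 0 = 0 ∧ 0 < deriv (fun t : ℝ => b (0, t)) 0 ∧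
      ∀ᶠ z in 𝓝 0, b (z.1, Y z * N z) = z.2.1 * z.2.2 ∧
        fderiv ℝ N z (0, 1, 0) * fderiv ℝ Y z (0, 0, 1) -
          fderiv ℝ N z (0, 0, 1) * fderiv ℝ Y z (0, 1, 0) = g z := by
  -- The equation is solved for `-g`, so that `A(0, 0) = -g(0) > 0`.
  obtain ⟨A, f₀, hA, hf₀, hAf⟩ := exists_hyp_cohomological hg.neg
  have hA0 : 0 < A (0, 0) := by
    have := hAf.self_of_nhds
    have h2 : hyp f₀ 0 = 0 := by simp [hyp_eq]
    rw [h2] at this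
    simp only [Prod.fst_zero, Prod.snd_zero, mul_zero, add_zero] at this
    linarith
  obtain ⟨Ā, hĀ, hĀA⟩ := exists_primitive_along (ContinuousLinearMap.snd ℝ ℝ ℝ) (0, 1) rfl hA
  have hĀA' : ∀ x : ℝ × ℝ, Ā x + x.2 * fderiv ℝ Ā x (0, 1) = A x := fun x => by
    rw [← hĀA, fderiv_fun_mul (ContinuousLinearMap.snd ℝ ℝ ℝ).differentiableAt
      (hĀ.differentiable (by simp) x)]
    simp [fderiv_snd, add_comm]
  have hĀ0 : 0 < Ā (0, 0) := by
    have := hĀA' (0, 0)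
    simp only [zero_mul, add_zero] at this
    rwa [this]
  obtain ⟨b, hb, hb0, hbA⟩ := exists_saddle_action_inverse hĀ hĀ0
  let As : ℝ × ℝ × ℝ → ℝ := fun z => A (z.1, z.2.1 * z.2.2)
  have hAs : ContDiff ℝ ∞ As := hA.comp (by fun_prop)
  have hAso : IsOpen {z | As z ≠ 0} := isOpen_ne_fun hAs.continuous continuous_const
  have hAs0 : As 0 ≠ 0 := by
    simp only [As, Prod.fst_zero, Prod.snd_zero, mul_zero]
    exact hA0.ne'
  obtain ⟨a, ha, haA⟩ := exists_contDiff_eventuallyEq (f := fun z => (As z)⁻¹)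
    (hAso.mem_nhds hAs0) (hAs.contDiffOn.inv fun z hz => hz)
  -- Functions of `(s, uv)` are killed by `hyp`, so dividing `f₀` by `A(s, uv)` gives `A hyp f = hyp
  -- f₀`.
  let f : ℝ × ℝ × ℝ → ℝ := fun z => f₀ z * a z
  have hf : ContDiff ℝ ∞ f := hf₀.mul ha
  let Ās : ℝ × ℝ × ℝ → ℝ := fun z => Ā (z.1, z.2.1 * z.2.2)
  have hĀs : ContDiff ℝ ∞ Ās := hĀ.comp (by fun_prop)
  have hfa : ∀ᶠ z in 𝓝 0, As z * hyp f z = hyp f₀ z := by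
    have h1 : ∀ᶠ z in 𝓝 0, a z * As z = 1 := by
      filter_upwards [haA, hAso.mem_nhds hAs0] with z h1 h2
      rw [h1, inv_mul_cancel₀ h2]
    filter_upwards [eventually_eventually_nhds.2 h1] with z hz
    have hda := ha.differentiable (by simp) z
    have h2 : hyp (fun z => a z * As z) z = 0 := by
      rw [hyp_congr hz, hyp]
      simp
    rw [hyp_mul hda (hAs.differentiable (by simp) z), hyp_comp_saddle hA, mul_zero, zero_add] at h2
    have h3 := hyp_mul (hf₀.differentiable (by simp) z) hda
    have h4 := hz.self_of_nhds
    simp only [f, h3]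
    linear_combination f₀ z * h2 + hyp f₀ z * h4
  -- The exponentials cancel in `YN = uv Ā(s, uv)`. Since `Ā` satisfies `∂_c (c Ā) = A`, the
  -- Jacobian is `-A (1 + hyp f) = -(A + hyp f₀) = g`.
  refine ⟨fun z => z.2.1 * Real.exp (f z), fun z => z.2.2 * (Ās z * Real.exp (-f z)), b,
    by fun_prop, by fun_prop, hb, by simp, by simp, hb0, ?_⟩
  have hcs : Filter.Tendsto (fun z : ℝ × ℝ × ℝ => (z.1, z.2.1 * z.2.2)) (𝓝 0)
      (𝓝 ((0 : ℝ), (0 : ℝ))) := by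
    have : Continuous fun z : ℝ × ℝ × ℝ => (z.1, z.2.1 * z.2.2) := by fun_prop
    simpa using this.tendsto 0
  filter_upwards [hfa, hAf, hcs.eventually hbA] with z h1 h2 h3
  have hE : Real.exp (f z) * Real.exp (-f z) = 1 := by rw [← Real.exp_add]; simp
  constructor
  · have : z.2.1 * Real.exp (f z) * (z.2.2 * (Ās z * Real.exp (-f z))) =
        z.2.1 * z.2.2 * Ā (z.1, z.2.1 * z.2.2) := by
      simp only [Ās]
      linear_combination z.2.1 * z.2.2 * Ā (z.1, z.2.1 * z.2.2) * hE
    rw [this]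
    exact h3
  · have hdf := (hf.differentiable (by simp) z).hasFDerivAt
    have hY := (hasFDerivAt_mid z).mul hdf.exp
    have hN := (hasFDerivAt_last z).mul
      ((hĀs.differentiable (by simp) z).hasFDerivAt.mul hdf.neg.exp)
    rw [HasFDerivAt.fderiv (f := fun z : ℝ × ℝ × ℝ => z.2.1 * Real.exp (f z)) hY,
      HasFDerivAt.fderiv (f := fun z : ℝ × ℝ × ℝ => z.2.2 * (Ās z * Real.exp (-f z))) hN]
    have h4 := hyp_eq (f := f) z
    have h5 := hĀA' (z.1, z.2.1 * z.2.2)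
    obtain ⟨h6, h7⟩ := fderiv_comp_saddle hĀ z
    simp [Ās, h6, h7]
    generalize Real.exp (f z) = E at *
    generalize Real.exp (-f z) = E' at *
    generalize fderiv ℝ f z (0, 1, 0) = fu at *
    generalize fderiv ℝ f z (0, 0, 1) = fv at *
    simp only [As] at h1
    generalize A (z.1, z.2.1 * z.2.2) = A₁ at *
    generalize fderiv ℝ Ā (z.1, z.2.1 * z.2.2) (0, 1) = Āc at *
    generalize Ā (z.1, z.2.1 * z.2.2) = Ā₁ at *
    linear_combination -(Ā₁ + z.2.1 * z.2.2 * Āc) * (1 + (z.2.1 * fu - z.2.2 * fv)) * hE -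
      (1 + (z.2.1 * fu - z.2.2 * fv)) * h5 + A₁ * h4 - h1 + h2

/-- The Poincaré lemma for one-forms in two variables, with a parameter. -/
theorem exists_potential {β₁ β₂ : ℝ × ℝ × ℝ → ℝ} (hβ₁ : ContDiff ℝ ∞ β₁) (hβ₂ : ContDiff ℝ ∞ β₂)
    (hcl : ∀ᶠ z in 𝓝 0, fderiv ℝ β₂ z (0, 1, 0) = fderiv ℝ β₁ z (0, 0, 1)) :
    ∃ S : ℝ × ℝ × ℝ → ℝ, ContDiff ℝ ∞ S ∧ S 0 = 0 ∧
      ∀ᶠ z in 𝓝 0, fderiv ℝ S z (0, 1, 0) = β₁ z ∧ fderiv ℝ S z (0, 0, 1) = β₂ z := by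
  let ℓu : ℝ × ℝ × ℝ →L[ℝ] ℝ := ContinuousLinearMap.fst ℝ ℝ ℝ ∘L ContinuousLinearMap.snd ℝ ℝ (ℝ × ℝ)
  let ℓv : ℝ × ℝ × ℝ →L[ℝ] ℝ := ContinuousLinearMap.snd ℝ ℝ ℝ ∘L ContinuousLinearMap.snd ℝ ℝ (ℝ × ℝ)
  let π : ℝ × ℝ × ℝ →L[ℝ] ℝ × ℝ × ℝ := (ContinuousLinearMap.fst ℝ ℝ (ℝ × ℝ)).prod
    ((0 : ℝ × ℝ × ℝ →L[ℝ] ℝ).prod ℓv)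
  have hsu : ∀ z : ℝ × ℝ × ℝ, z - ℓu z • ((0 : ℝ), (1 : ℝ), (0 : ℝ)) = π z := by
    intro z; ext <;> simp [ℓu, ℓv, π]
  obtain ⟨r₁, hr₁, h₁⟩ := exists_primitive_along ℓu (0, 1, 0) rfl hβ₁
  obtain ⟨r₂, hr₂, h₂⟩ := exists_primitive_along ℓv (0, 0, 1) rfl hβ₂
  have hI : ContDiff ℝ ∞ fun z => ℓu z * r₁ z := ℓu.contDiff.mul hr₁
  have hJ : ContDiff ℝ ∞ fun z => ℓv z * r₂ z := ℓv.contDiff.mul hr₂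
  have hJπ : ContDiff ℝ ∞ fun z => ℓv (π z) * r₂ (π z) := hJ.comp π.contDiff
  have hJd : ∀ z x, fderiv ℝ (fun z => ℓv (π z) * r₂ (π z)) z x =
      fderiv ℝ (fun z => ℓv z * r₂ z) (π z) (π x) := fun z x => by
    have := (hJ.differentiable (by simp) (π z)).hasFDerivAt.comp z π.hasFDerivAt
    rw [HasFDerivAt.fderiv (f := fun z => ℓv (π z) * r₂ (π z)) this]
    rfl
  have hπu : π (0, 1, 0) = 0 := by simp [π, ℓv]
  have hπv : π (0, 0, 1) = (0, 0, 1) := by simp [π, ℓv]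
  -- `S` integrates `β₂` along the axis `u = 0` and then `β₁` in the direction of `u`.
  let S : ℝ × ℝ × ℝ → ℝ := fun z => ℓu z * r₁ z + ℓv (π z) * r₂ (π z)
  have hS : ContDiff ℝ ∞ S := hI.add hJπ
  have hSd : ∀ z x, fderiv ℝ S z x = fderiv ℝ (fun z => ℓu z * r₁ z) z x +
      fderiv ℝ (fun z => ℓv z * r₂ z) (π z) (π x) := fun z x => by
    rw [← hJd]
    simp only [S]
    rw [fderiv_fun_add (hI.differentiable (by simp) z) (hJπ.differentiable (by simp) z)]
    rfl
  have hSu : ∀ z, fderiv ℝ S z (0, 1, 0) = β₁ z := fun z => by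
    rw [hSd, hπu, map_zero, add_zero, h₁]
  have hSvs := contDiff_fderiv_apply_const hS (0, 0, 1)
  -- The defect `R` is independent of `u` by closedness and vanishes on `u = 0`.
  let R : ℝ × ℝ × ℝ → ℝ := fun z => fderiv ℝ S z (0, 0, 1) - β₂ z
  have hR : ContDiff ℝ ∞ R := hSvs.sub hβ₂
  have hRu : ∀ᶠ z in 𝓝 0, fderiv ℝ R z (0, 1, 0) = 0 := by
    filter_upwards [hcl] with z hz
    simp only [R]
    rw [fderiv_fun_sub (hSvs.differentiable (by simp) z) (hβ₂.differentiable (by simp) z), sub_apply,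
      ← fderiv_apply_comm hS, hz]
    simp only [hSu, sub_self]
  have hconst := eventually_eq_of_fderiv_apply_eq_zero (hR.differentiable (by simp)) ℓu (0, 1, 0) 0
    (map_zero _) hRu
  refine ⟨S, hS, by simp [S], ?_⟩
  filter_upwards [hconst] with z hz
  refine ⟨hSu z, ?_⟩
  rw [hsu] at hz
  have h3 : ℓu (π z) = 0 := rfl
  have h4 : π (π z) = π z := rfl
  have h5 : R (π z) = 0 := by
    simp only [R]
    rw [hSd, hπv, h₂, h4, fderiv_fun_mul ℓu.differentiableAt (hr₁.differentiable (by simp) _)]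
    simp [h3, ℓu]
  rw [h5] at hz
  simp only [R] at hz
  linarith

end Isochore

/-! ### Closed forms in flow-box coordinates -/

section Box

variable {E : Type*} [NormedAddCommGroup E] [NormedSpace ℝ E]
  {Q : Type*} [NormedAddCommGroup Q] [NormedSpace ℝ Q]

/-- The pullback of a field of bilinear forms. -/
def pullback (B : E → E →L[ℝ] E →L[ℝ] ℝ) (Ψ : Q → E) (q : Q) : Q →L[ℝ] Q →L[ℝ] ℝ :=
  (B (Ψ q)).bilinearComp (fderiv ℝ Ψ q) (fderiv ℝ Ψ q)

theorem pullback_apply (B : E → E →L[ℝ] E →L[ℝ] ℝ) (Ψ : Q → E) (q x y : Q) :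
    pullback B Ψ q x y = B (Ψ q) (fderiv ℝ Ψ q x) (fderiv ℝ Ψ q y) := rfl

theorem contDiff_pullback {B : E → E →L[ℝ] E →L[ℝ] ℝ} {Ψ : Q → E} (hB : ContDiff ℝ ∞ B)
    (hΨ : ContDiff ℝ ∞ Ψ) (x y : Q) : ContDiff ℝ ∞ fun q => pullback B Ψ q x y :=
  ((hB.comp hΨ).clm_apply (contDiff_fderiv_apply_const hΨ x)).clm_apply
    (contDiff_fderiv_apply_const hΨ y)

/-- The pullback of a closed form is closed. -/
theorem fderiv_pullback_cyclic {B : E → E →L[ℝ] E →L[ℝ] ℝ} {Ψ : Q → E} (hB : ContDiff ℝ ∞ B)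
    (hΨ : ContDiff ℝ ∞ Ψ) (q : Q) (halt : ∀ v w, B (Ψ q) v w = -B (Ψ q) w v)
    (hcl : ∀ x y z, fderiv ℝ B (Ψ q) x y z + fderiv ℝ B (Ψ q) y z x + fderiv ℝ B (Ψ q) z x y = 0)
    (x y z : Q) :
    fderiv ℝ (fun q => pullback B Ψ q y z) q x + fderiv ℝ (fun q => pullback B Ψ q z x) q y +
      fderiv ℝ (fun q => pullback B Ψ q x y) q z = 0 := by
  have hd : ∀ x y z : Q, fderiv ℝ (fun q => pullback B Ψ q y z) q x =
      fderiv ℝ B (Ψ q) (fderiv ℝ Ψ q x) (fderiv ℝ Ψ q y) (fderiv ℝ Ψ q z) +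
        B (Ψ q) (fderiv ℝ (fun q => fderiv ℝ Ψ q y) q x) (fderiv ℝ Ψ q z) +
        B (Ψ q) (fderiv ℝ Ψ q y) (fderiv ℝ (fun q => fderiv ℝ Ψ q z) q x) := fun x y z => by
    have h1 := (hB.differentiable (by simp) (Ψ q)).hasFDerivAt.comp q
      (hΨ.differentiable (by simp) q).hasFDerivAt
    have h2 := ((contDiff_fderiv_apply_const hΨ y).differentiable (by simp) q).hasFDerivAt
    have h3 := ((contDiff_fderiv_apply_const hΨ z).differentiable (by simp) q).hasFDerivAt
    rw [HasFDerivAt.fderiv (f := fun q => pullback B Ψ q y z) ((h1.clm_apply h2).clm_apply h3)]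
    simp
    ring
  -- The terms with second derivatives of `Ψ` cancel in pairs, by their symmetry and the
  -- antisymmetry of `B`.
  rw [hd, hd, hd, fderiv_apply_comm hΨ q y x, fderiv_apply_comm hΨ q z x,
    fderiv_apply_comm hΨ q z y]
  have h := hcl (fderiv ℝ Ψ q x) (fderiv ℝ Ψ q y) (fderiv ℝ Ψ q z)
  linear_combination h + halt (fderiv ℝ (fun q => fderiv ℝ Ψ q x) q y) (fderiv ℝ Ψ q z) +
    halt (fderiv ℝ Ψ q y) (fderiv ℝ (fun q => fderiv ℝ Ψ q x) q z) +
    halt (fderiv ℝ (fun q => fderiv ℝ Ψ q y) q z) (fderiv ℝ Ψ q x)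

/-- A closed 2-form on `ℝ × ℝ³ ∋ (t, s, u, v)` whose contraction with `∂/∂t` is `-ds` is brought
into Darboux form by coordinates `(t + S, Y, s, N)` such that `YN` is a function of `(s, uv)`. -/
theorem exists_darboux_saddle {θ : ℝ × ℝ × ℝ × ℝ → (ℝ × ℝ × ℝ × ℝ) →L[ℝ] (ℝ × ℝ × ℝ × ℝ) →L[ℝ] ℝ}
    (hθ : ∀ x y, ContDiff ℝ ∞ fun q => θ q x y)
    (halt : ∀ᶠ q in 𝓝 0, ∀ x y, θ q x y = -θ q y x)
    (hcl : ∀ᶠ q in 𝓝 0, ∀ x y z, fderiv ℝ (fun q => θ q y z) q x + fderiv ℝ (fun q => θ q z x) q y +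
      fderiv ℝ (fun q => θ q x y) q z = 0)
    (ht : ∀ᶠ q in 𝓝 0, ∀ y, θ q (1, 0) y = -y.2.1)
    (hneg : θ 0 (0, 0, 1, 0) (0, 0, 0, 1) < 0) :
    ∃ (S Y N : ℝ × ℝ × ℝ → ℝ) (b : ℝ × ℝ → ℝ), ContDiff ℝ ∞ S ∧ ContDiff ℝ ∞ Y ∧ ContDiff ℝ ∞ N ∧
      ContDiff ℝ ∞ b ∧ S 0 = 0 ∧ Y 0 = 0 ∧ N 0 = 0 ∧ 0 < deriv (fun t : ℝ => b (0, t)) 0 ∧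
      (∀ᶠ z in 𝓝 0, b (z.1, Y z * N z) = z.2.1 * z.2.2) ∧
      ∀ᶠ q in 𝓝 0, ∀ x y, θ q x y =
        (x.2.1 * (y.1 + fderiv ℝ S q.2 y.2) - (x.1 + fderiv ℝ S q.2 x.2) * y.2.1) +
        (fderiv ℝ N q.2 x.2 * fderiv ℝ Y q.2 y.2 - fderiv ℝ Y q.2 x.2 * fderiv ℝ N q.2 y.2) := by
  let ι : ℝ × ℝ × ℝ →L[ℝ] ℝ × ℝ × ℝ × ℝ := ContinuousLinearMap.inr ℝ ℝ (ℝ × ℝ × ℝ)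
  let c : (ℝ × ℝ × ℝ) → (ℝ × ℝ × ℝ) → ℝ × ℝ × ℝ → ℝ := fun x y z => θ (ι z) (ι x) (ι y)
  have hc : ∀ x y, ContDiff ℝ ∞ (c x y) := fun x y => (hθ _ _).comp ι.contDiff
  have hι : Filter.Tendsto ι (𝓝 0) (𝓝 0) := by simpa using ι.continuous.tendsto 0
  have hcd : ∀ x y z ζ, fderiv ℝ (c x y) z ζ = fderiv ℝ (fun q => θ q (ι x) (ι y)) (ι z) (ι ζ) :=
    fun x y z ζ => by
      have := ((hθ (ι x) (ι y)).differentiable (by simp) (ι z)).hasFDerivAt.comp z ι.hasFDerivAt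
      rw [HasFDerivAt.fderiv (f := c x y) this]
      rfl
  -- This is Cartan's formula: the form is closed and its contraction with `∂_t` is the closed form
  -- `-ds`, so its coefficients do not depend on `t`.
  have hconst : ∀ y z, ∀ᶠ q in 𝓝 0, fderiv ℝ (fun q => θ q y z) q (1, 0) = 0 := fun y z => by
    have h1 : ∀ᶠ q in 𝓝 0, ∀ y, θ q y (1, 0) = y.2.1 := by
      filter_upwards [halt, ht] with q h1 h2 y
      rw [h1, h2, neg_neg]
    filter_upwards [hcl, eventually_eventually_nhds.2 h1, eventually_eventually_nhds.2 ht]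
      with q h2 h3 h4
    have h5 : fderiv ℝ (fun q => θ q z (1, 0)) q y = 0 := by
      rw [Filter.EventuallyEq.fderiv_eq (f := fun _ => z.2.1) (h3.mono fun q hq => hq z)]
      simp
    have h6 : fderiv ℝ (fun q => θ q (1, 0) y) q z = 0 := by
      rw [Filter.EventuallyEq.fderiv_eq (f := fun _ => -y.2.1) (h4.mono fun q hq => hq y)]
      simp
    have := h2 (1, 0) y z
    linarith
  have hind : ∀ x y, ∀ᶠ q in 𝓝 (0 : ℝ × ℝ × ℝ × ℝ), θ q (ι x) (ι y) = c x y q.2 := fun x y => by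
    filter_upwards [eventually_eq_of_fderiv_apply_eq_zero ((hθ (ι x) (ι y)).differentiable (by simp))
      (ContinuousLinearMap.fst ℝ ℝ (ℝ × ℝ × ℝ)) (1, 0) 0 rfl (hconst _ _)] with q hq
    rw [← hq]
    have : q - (ContinuousLinearMap.fst ℝ ℝ (ℝ × ℝ × ℝ)) q • ((1 : ℝ), (0 : ℝ × ℝ × ℝ)) = ι q.2 := by
      ext <;> simp [ι]
    rw [this]
  have hcl' : ∀ᶠ z in 𝓝 0, fderiv ℝ (c (0, 1, 0) (0, 0, 1)) z (1, 0, 0) -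
      fderiv ℝ (c (1, 0, 0) (0, 0, 1)) z (0, 1, 0) + fderiv ℝ (c (1, 0, 0) (0, 1, 0)) z (0, 0, 1)
        = 0 := by
    filter_upwards [hι.eventually hcl, hι.eventually (eventually_eventually_nhds.2 halt)] with z h1 h2
    have h3 := h1 (ι (1, 0, 0)) (ι (0, 1, 0)) (ι (0, 0, 1))
    have h4 : fderiv ℝ (fun q => θ q (ι (0, 0, 1)) (ι (1, 0, 0))) (ι z) =
        -fderiv ℝ (fun q => θ q (ι (1, 0, 0)) (ι (0, 0, 1))) (ι z) := by
      rw [← fderiv_fun_neg]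
      exact Filter.EventuallyEq.fderiv_eq (h2.mono fun q hq => hq _ _)
    rw [h4, neg_apply] at h3
    rw [hcd, hcd, hcd]
    linarith
  obtain ⟨Y, N, b, hY, hN, hb, hY0, hN0, hb0, hYN⟩ := exists_isochore (hc (0, 1, 0) (0, 0, 1)) (by
    change θ (ι 0) (0, 0, 1, 0) (0, 0, 0, 1) < 0
    rwa [map_zero])
  have D := fun {f : ℝ × ℝ × ℝ → ℝ} (hf : ContDiff ℝ ∞ f) e => contDiff_fderiv_apply_const hf e
  -- What remains of the form after subtracting `ds ∧ dt + dN ∧ dY` is `ds ∧ (β₁ du + β₂ dv)`.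
  let β₁ : ℝ × ℝ × ℝ → ℝ := fun z => c (1, 0, 0) (0, 1, 0) z -
    (fderiv ℝ N z (1, 0, 0) * fderiv ℝ Y z (0, 1, 0) -
      fderiv ℝ N z (0, 1, 0) * fderiv ℝ Y z (1, 0, 0))
  let β₂ : ℝ × ℝ × ℝ → ℝ := fun z => c (1, 0, 0) (0, 0, 1) z -
    (fderiv ℝ N z (1, 0, 0) * fderiv ℝ Y z (0, 0, 1) -
      fderiv ℝ N z (0, 0, 1) * fderiv ℝ Y z (1, 0, 0))
  have hw : ∀ e e' : ℝ × ℝ × ℝ, ContDiff ℝ ∞ fun z =>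
      fderiv ℝ N z e * fderiv ℝ Y z e' - fderiv ℝ N z e' * fderiv ℝ Y z e := fun e e' =>
    ((D hN e).mul (D hY e')).sub ((D hN e').mul (D hY e))
  have hwd : ∀ (e e' : ℝ × ℝ × ℝ) z ζ, fderiv ℝ (fun z =>
      fderiv ℝ N z e * fderiv ℝ Y z e' - fderiv ℝ N z e' * fderiv ℝ Y z e) z ζ =
      (fderiv ℝ (fun z => fderiv ℝ N z e) z ζ * fderiv ℝ Y z e' +
        fderiv ℝ N z e * fderiv ℝ (fun z => fderiv ℝ Y z e') z ζ) -
      (fderiv ℝ (fun z => fderiv ℝ N z e') z ζ * fderiv ℝ Y z e +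
        fderiv ℝ N z e' * fderiv ℝ (fun z => fderiv ℝ Y z e) z ζ) := fun e e' z ζ => by
    have d := fun {f : ℝ × ℝ × ℝ → ℝ} (hf : ContDiff ℝ ∞ f) e =>
      ((D hf e).differentiable (by simp) z).hasFDerivAt
    rw [HasFDerivAt.fderiv (((d hN e).fun_mul (d hY e')).fun_sub ((d hN e').fun_mul (d hY e)))]
    simp
    ring
  have hβ₁ : ContDiff ℝ ∞ β₁ := (hc _ _).sub (hw _ _)
  have hβ₂ : ContDiff ℝ ∞ β₂ := (hc _ _).sub (hw _ _)
  -- The restricted form and `dN ∧ dY` are both closed and share their `du ∧ dv` coefficient;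
  -- comparing `s`-derivatives of that coefficient gives the identity.
  have hβ : ∀ᶠ z in 𝓝 0, fderiv ℝ β₂ z (0, 1, 0) = fderiv ℝ β₁ z (0, 0, 1) := by
    filter_upwards [hcl', eventually_eventually_nhds.2 hYN] with z h1 h2
    have h3 := congrArg (fun L => L (1, 0, 0)) (Filter.EventuallyEq.fderiv_eq (𝕜 := ℝ) (x := z)
      (h2.mono fun z hz => hz.2))
    simp only [hwd] at h3
    simp only [β₁, β₂]
    rw [fderiv_fun_sub ((hc _ _).differentiable (by simp) z) ((hw _ _).differentiable (by simp) z),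
      fderiv_fun_sub ((hc _ _).differentiable (by simp) z) ((hw _ _).differentiable (by simp) z),
      sub_apply, sub_apply, hwd, hwd]
    rw [fderiv_apply_comm hN z (1, 0, 0) (0, 1, 0), fderiv_apply_comm hN z (1, 0, 0) (0, 0, 1),
      fderiv_apply_comm hN z (0, 0, 1) (0, 1, 0), fderiv_apply_comm hY z (1, 0, 0) (0, 1, 0),
      fderiv_apply_comm hY z (1, 0, 0) (0, 0, 1), fderiv_apply_comm hY z (0, 0, 1) (0, 1, 0)]
    linear_combination -h1 - h3
  obtain ⟨S, hS, hS0, hSd⟩ := exists_potential hβ₁ hβ₂ hβ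
  have hsnd : Filter.Tendsto (fun q : ℝ × ℝ × ℝ × ℝ => q.2) (𝓝 0) (𝓝 0) :=
    continuous_snd.tendsto' _ _ rfl
  refine ⟨S, Y, N, b, hS, hY, hN, hb, hS0, hY0, hN0, hb0, hYN.mono fun z hz => hz.1, ?_⟩
  filter_upwards [halt, ht, hind (0, 1, 0) (0, 0, 1), hind (1, 0, 0) (0, 1, 0),
    hind (1, 0, 0) (0, 0, 1), hsnd.eventually hSd, hsnd.eventually hYN]
    with q h1 h2 h3 h4 h5 h6 h7 x y
  have e : ∀ x : ℝ × ℝ × ℝ, x = x.1 • ((1 : ℝ), (0 : ℝ), (0 : ℝ)) +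
      x.2.1 • ((0 : ℝ), (1 : ℝ), (0 : ℝ)) + x.2.2 • ((0 : ℝ), (0 : ℝ), (1 : ℝ)) := fun x => by
    ext <;> simp
  have e' : ∀ x : ℝ × ℝ × ℝ × ℝ, x = x.1 • ((1 : ℝ), (0 : ℝ × ℝ × ℝ)) + x.2.1 • ι (1, 0, 0) +
      x.2.2.1 • ι (0, 1, 0) + x.2.2.2 • ι (0, 0, 1) := fun x => by
    ext <;> simp [ι]
  have ef : ∀ (L : (ℝ × ℝ × ℝ) →L[ℝ] ℝ) x, L x = x.1 * L (1, 0, 0) + x.2.1 * L (0, 1, 0) +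
      x.2.2 * L (0, 0, 1) := fun L x => by
    conv_lhs => rw [e x]
    simp only [map_add, map_smul, smul_eq_mul]
  have a0 : ∀ x, θ q x x = 0 := fun x => by linarith [h1 x x]
  have eθ : θ q x y = x.1 * -y.2.1 + x.2.1 * y.1 +
      (x.2.1 * y.2.2.1 - x.2.2.1 * y.2.1) * θ q (ι (1, 0, 0)) (ι (0, 1, 0)) +
      (x.2.1 * y.2.2.2 - x.2.2.2 * y.2.1) * θ q (ι (1, 0, 0)) (ι (0, 0, 1)) +
      (x.2.2.1 * y.2.2.2 - x.2.2.2 * y.2.2.1) * θ q (ι (0, 1, 0)) (ι (0, 0, 1)) := by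
    conv_lhs => rw [e' x, e' y]
    simp only [map_add, map_smul, add_apply, smul_apply, smul_eq_mul, a0, h2, h1 _ (1, 0),
      h1 (ι (0, 1, 0)) (ι (1, 0, 0)), h1 (ι (0, 0, 1)) (ι (1, 0, 0)),
      h1 (ι (0, 0, 1)) (ι (0, 1, 0))]
    simp [ι]
    ring
  rw [eθ, h3, h4, h5, ef (fderiv ℝ S q.2) x.2, ef (fderiv ℝ S q.2) y.2, ef (fderiv ℝ N q.2) x.2,
    ef (fderiv ℝ N q.2) y.2, ef (fderiv ℝ Y q.2) x.2, ef (fderiv ℝ Y q.2) y.2, h6.1, h6.2, ← h7.2]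
  simp only [β₁, β₂]
  ring

end Box

/-! ### Flow box and canonical coordinates near a slice -/

section Local

variable {E : Type} [NormedAddCommGroup E] [NormedSpace ℝ E] [FiniteDimensional ℝ E]

/-- A function that is constant along a vector field is constant along its flow. -/
theorem eventually_comp_flow_eq {X : E → E} {Ψ : ℝ × ℝ × ℝ × ℝ → E} (hΨ : ContDiff ℝ ∞ Ψ)
    (hΨX : ∀ᶠ q in 𝓝 0, fderiv ℝ Ψ q (1, 0) = X (Ψ q)) {K : E → ℝ} (hK : ContDiff ℝ ∞ K)
    (hXK : ∀ᶠ p in 𝓝 (Ψ 0), fderiv ℝ K p (X p) = 0) :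
    ∀ᶠ q in 𝓝 0, K (Ψ q) = K (Ψ (0, q.2)) := by
  have hd : ∀ᶠ q in 𝓝 (0 : ℝ × ℝ × ℝ × ℝ), fderiv ℝ (fun q => K (Ψ q)) q (1, 0) = 0 := by
    filter_upwards [hΨX, hΨ.continuous.continuousAt.eventually hXK] with q h1 h2
    have := (hK.differentiable (by simp) (Ψ q)).hasFDerivAt.comp q
      (hΨ.differentiable (by simp) q).hasFDerivAt
    rw [HasFDerivAt.fderiv (f := fun q => K (Ψ q)) this, ContinuousLinearMap.comp_apply, h1, h2]
  filter_upwards [eventually_eq_of_fderiv_apply_eq_zero ((hK.comp hΨ).differentiable (by simp))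
    (ContinuousLinearMap.fst ℝ ℝ (ℝ × ℝ × ℝ)) (1, 0) 0 rfl hd] with q hq
  have h : q - (ContinuousLinearMap.fst ℝ ℝ (ℝ × ℝ × ℝ)) q • ((1 : ℝ), (0 : ℝ × ℝ × ℝ)) =
      (0, q.2) := by ext <;> simp
  rw [← h]
  exact hq.symm

/-- The flow box: a slice transversal to a vector field is extended to coordinates `(t, z)` that
turn the vector field into `∂/∂t`. -/
theorem exists_flow_box {X : E → E} (hX : ContDiff ℝ ∞ X) {σ : ℝ × ℝ × ℝ → E}
    (hσ : ContDiff ℝ ∞ σ) (hinj : Function.Injective (fderiv ℝ σ 0))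
    (hXσ : X (σ 0) ∉ range (fderiv ℝ σ 0)) :
    ∃ Ψ : ℝ × ℝ × ℝ × ℝ → E, ContDiff ℝ ∞ Ψ ∧ (∀ᶠ z in 𝓝 0, Ψ (0, z) = σ z) ∧
      (∀ᶠ q in 𝓝 0, fderiv ℝ Ψ q (1, 0) = X (Ψ q)) ∧
      (∀ ζ, fderiv ℝ Ψ 0 (0, ζ) = fderiv ℝ σ 0 ζ) ∧ Function.Injective (fderiv ℝ Ψ 0) := by
  obtain ⟨φ, hφ, hφ0, hφX⟩ := exists_local_flow hX (σ 0)
  let Ψ : ℝ × ℝ × ℝ × ℝ → E := fun q => φ (q.1, σ q.2)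
  have hΨ : ContDiff ℝ ∞ Ψ := by fun_prop
  have hΨσ : ∀ᶠ z in 𝓝 0, Ψ (0, z) = σ z := hσ.continuous.continuousAt.eventually hφ0
  have hΨ0 : Ψ 0 = σ 0 := hΨσ.self_of_nhds
  have hΨX : ∀ᶠ q in 𝓝 0, fderiv ℝ Ψ q (1, 0) = X (Ψ q) := by
    have hc : Filter.Tendsto (fun q : ℝ × ℝ × ℝ × ℝ => (q.1, σ q.2)) (𝓝 0) (𝓝 (0, σ 0)) := by
      have : Continuous fun q : ℝ × ℝ × ℝ × ℝ => (q.1, σ q.2) :=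
        continuous_fst.prodMk (hσ.continuous.comp continuous_snd)
      exact this.tendsto' _ _ rfl
    filter_upwards [hc.eventually hφX] with q hq
    have h1 := (hΨ.differentiable (by simp) q).hasFDerivAt.comp_hasDerivAt_of_eq q.1
      ((hasDerivAt_id q.1).prodMk (hasDerivAt_const q.1 q.2)) rfl
    exact h1.unique hq
  have hΨs : ∀ ζ, fderiv ℝ Ψ 0 (0, ζ) = fderiv ℝ σ 0 ζ := fun ζ => by
    have h1 := (hΨ.differentiable (by simp) 0).hasFDerivAt.comp (0 : ℝ × ℝ × ℝ)
      (ContinuousLinearMap.inr ℝ ℝ (ℝ × ℝ × ℝ)).hasFDerivAt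
    have h2 := h1.congr_of_eventuallyEq (f₁ := σ) (by
      filter_upwards [hΨσ] with z hz
      exact hz.symm)
    rw [h2.fderiv]
    rfl
  refine ⟨Ψ, hΨ, hΨσ, hΨX, hΨs, ?_⟩
  rw [injective_iff_map_eq_zero]
  rintro ⟨t, ζ⟩ h
  have h1 : ((t, ζ) : ℝ × ℝ × ℝ × ℝ) = t • ((1 : ℝ), (0 : ℝ × ℝ × ℝ)) + (0, ζ) := by simp
  rw [h1, map_add, map_smul, hΨX.self_of_nhds, hΨs, hΨ0] at h
  have ht : t = 0 := by
    by_contra ht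
    refine hXσ ⟨-(t⁻¹ • ζ), ?_⟩
    rw [map_neg, map_smul, eq_neg_of_add_eq_zero_right h, smul_neg, neg_neg, smul_smul,
      inv_mul_cancel₀ ht, one_smul]
  rw [ht, zero_smul, zero_add] at h
  rw [ht, (injective_iff_map_eq_zero _).1 hinj ζ h]
  rfl

/-- Canonical coordinates `(x, y, ξ, η)` with `H = ξ + a` and `K = Φ(ξ, yη)`, for Poisson commuting
functions `H, K`, near a slice on which `K` is in Morse form. -/
theorem exists_canonical_of_slice_of_neg (hE : Module.finrank ℝ E = 4)
    {B : E → E →L[ℝ] E →L[ℝ] ℝ} (hB : ContDiff ℝ ∞ B) {H K : E → ℝ} (hH : ContDiff ℝ ∞ H)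
    (hK : ContDiff ℝ ∞ K) {X : E → E} (hX : ContDiff ℝ ∞ X) {σ : ℝ × ℝ × ℝ → E}
    (hσ : ContDiff ℝ ∞ σ)
    (halt : ∀ᶠ p in 𝓝 (σ 0), ∀ v w, B p v w = -B p w v)
    (hcl : ∀ᶠ p in 𝓝 (σ 0), ∀ x y z,
      fderiv ℝ B p x y z + fderiv ℝ B p y z x + fderiv ℝ B p z x y = 0)
    (hXH : ∀ᶠ p in 𝓝 (σ 0), ∀ w, B p (X p) w = -fderiv ℝ H p w)
    (hXK : ∀ᶠ p in 𝓝 (σ 0), fderiv ℝ K p (X p) = 0)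
    (hinj : Function.Injective (fderiv ℝ σ 0)) (hXσ : X (σ 0) ∉ range (fderiv ℝ σ 0))
    {a : ℝ} (hHσ : ∀ᶠ z in 𝓝 0, H (σ z) = z.1 + a)
    {h₀ : ℝ → ℝ} (hh₀ : ContDiff ℝ ∞ h₀)
    (hKσ : ∀ᶠ z in 𝓝 0, K (σ z) = h₀ z.1 + z.2.1 * z.2.2)
    (hneg : B (σ 0) (fderiv ℝ σ 0 (0, 1, 0)) (fderiv ℝ σ 0 (0, 0, 1)) < 0) :
    ∃ (x y ξ η : E → ℝ) (Φ : ℝ × ℝ → ℝ), ContDiff ℝ ∞ x ∧ ContDiff ℝ ∞ y ∧ ContDiff ℝ ∞ ξ ∧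
      ContDiff ℝ ∞ η ∧ ContDiff ℝ ∞ Φ ∧ 0 < deriv (fun t : ℝ => Φ (0, t)) 0 ∧
      x (σ 0) = 0 ∧ y (σ 0) = 0 ∧ ξ (σ 0) = 0 ∧ η (σ 0) = 0 ∧
      ∀ᶠ p in 𝓝 (σ 0), H p = ξ p + a ∧ K p = Φ (ξ p, y p * η p) ∧
        ∀ v w, B p v w =
          (fderiv ℝ ξ p v * fderiv ℝ x p w - fderiv ℝ x p v * fderiv ℝ ξ p w) +
          (fderiv ℝ η p v * fderiv ℝ y p w - fderiv ℝ y p v * fderiv ℝ η p w) := by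
  obtain ⟨Ψ, hΨ, hΨσ, hΨX, hΨs, hΨi⟩ := exists_flow_box hX hσ hinj hXσ
  have hΨ0 : Ψ 0 = σ 0 := hΨσ.self_of_nhds
  have hΨc : Filter.Tendsto Ψ (𝓝 0) (𝓝 (σ 0)) := hΨ0 ▸ hΨ.continuous.continuousAt
  have hsnd : Filter.Tendsto (fun q : ℝ × ℝ × ℝ × ℝ => q.2) (𝓝 0) (𝓝 0) :=
    continuous_snd.tendsto' _ _ rfl
  have hXX : ∀ᶠ p in 𝓝 (σ 0), fderiv ℝ H p (X p) = 0 := by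
    filter_upwards [halt, hXH] with p h1 h2
    linarith [h1 (X p) (X p), h2 (X p)]
  have hHΨ : ∀ᶠ q in 𝓝 0, H (Ψ q) = q.2.1 + a := by
    filter_upwards [eventually_comp_flow_eq hΨ hΨX hH (hΨ0 ▸ hXX), hsnd.eventually hΨσ,
      hsnd.eventually hHσ] with q h1 h2 h3
    rw [h1, h2, h3]
  have hKΨ : ∀ᶠ q in 𝓝 0, K (Ψ q) = h₀ q.2.1 + q.2.2.1 * q.2.2.2 := by
    filter_upwards [eventually_comp_flow_eq hΨ hΨX hK (hΨ0 ▸ hXK), hsnd.eventually hΨσ,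
      hsnd.eventually hKσ] with q h1 h2 h3
    rw [h1, h2, h3]
  have ht : ∀ᶠ q in 𝓝 0, ∀ y, pullback B Ψ q (1, 0) y = -y.2.1 := by
    filter_upwards [hΨX, hΨc.eventually hXH, eventually_eventually_nhds.2 hHΨ] with q h1 h2 h3 y
    have h4 := (hH.differentiable (by simp) (Ψ q)).hasFDerivAt.comp q
      (hΨ.differentiable (by simp) q).hasFDerivAt
    have h5 : HasFDerivAt (fun q : ℝ × ℝ × ℝ × ℝ => q.2.1 + a) _ q :=
      (ContinuousLinearMap.fst ℝ ℝ (ℝ × ℝ) ∘L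
        ContinuousLinearMap.snd ℝ ℝ (ℝ × ℝ × ℝ)).hasFDerivAt.add_const a
    have h6 := DFunLike.congr_fun ((h4.congr_of_eventuallyEq (h3.mono fun q hq => hq.symm)).unique h5) y
    rw [pullback_apply, h1, h2]
    exact congrArg Neg.neg h6
  obtain ⟨S, Y, N, b, hS, hY, hN, hb, hS0, hY0, hN0, hb0, hYN, hθ⟩ := exists_darboux_saddle
    (contDiff_pullback hB hΨ) (hΨc.eventually halt |>.mono fun q hq x y => hq _ _)
    (by
      filter_upwards [hΨc.eventually halt, hΨc.eventually hcl] with q h1 h2 x y z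
      exact fderiv_pullback_cyclic hB hΨ q h1 h2 x y z)
    ht (by rwa [pullback_apply, hΨs, hΨs, hΨ0])
  obtain ⟨r, hr, hr1, hr2⟩ := exists_contDiff_local_inverse hΨ 0 hΨi (by simp [hE])
  have hr0 : r (σ 0) = 0 := hΨ0 ▸ hr1.self_of_nhds
  have hrc : Filter.Tendsto r (𝓝 (σ 0)) (𝓝 0) := by
    have := hr.continuous.continuousAt (x := σ 0)
    rwa [ContinuousAt, hr0] at this
  have hrs : ContDiff ℝ ∞ fun p => (r p).2 := contDiff_snd.comp hr
  -- `K = h₀(s) + uv` and `uv = b(s, YN)` give this `Φ`; the term `h₀` does not affect its second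
  -- partial derivative.
  have hΦ : ContDiff ℝ ∞ fun c : ℝ × ℝ => h₀ c.1 + b c := (hh₀.comp contDiff_fst).add hb
  rw [hΨ0] at hr2
  refine ⟨fun p => (r p).1 + S (r p).2, fun p => Y (r p).2, fun p => (r p).2.1, fun p => N (r p).2,
    fun c => h₀ c.1 + b c, (contDiff_fst.comp hr).add (hS.comp hrs), hY.comp hrs,
    contDiff_fst.comp hrs, hN.comp hrs, hΦ, by simpa using hb0, by simp [hr0, hS0],
    by simp [hr0, hY0], by simp [hr0], by simp [hr0, hN0], ?_⟩
  filter_upwards [eventually_eventually_nhds.2 hr2, hrc.eventually hHΨ, hrc.eventually hKΨ,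
    (hsnd.comp hrc).eventually hYN, hrc.eventually hθ] with p h1 h2 h3 h4 h5
  have hp : Ψ (r p) = p := h1.self_of_nhds
  rw [hp] at h2 h3
  refine ⟨h2, ?_, fun v w => ?_⟩
  · rw [h3]
    exact congrArg _ h4.symm
  have hrd := (hr.differentiable (by simp) p).hasFDerivAt
  have h6 : ∀ v, fderiv ℝ Ψ (r p) (fderiv ℝ r p v) = v := fun v => by
    have h7 := ((hΨ.differentiable (by simp) (r p)).hasFDerivAt.comp p hrd).congr_of_eventuallyEq
      (f₁ := id) (h1.mono fun z hz => hz.symm)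
    exact DFunLike.congr_fun (h7.unique (hasFDerivAt_id p)) v
  have hrs' : HasFDerivAt (fun p => (r p).2) (ContinuousLinearMap.snd ℝ ℝ _ ∘L fderiv ℝ r p) p :=
    hrd.snd
  have hc : ∀ {f : ℝ × ℝ × ℝ → ℝ}, ContDiff ℝ ∞ f → HasFDerivAt (fun p => f (r p).2)
      (fderiv ℝ f (r p).2 ∘L ContinuousLinearMap.snd ℝ ℝ _ ∘L fderiv ℝ r p) p := fun hf =>
    (hf.differentiable (by simp) (r p).2).hasFDerivAt.comp p hrs'
  rw [HasFDerivAt.fderiv (hrd.fst.fun_add (hc hS)), HasFDerivAt.fderiv (hc hY),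
    HasFDerivAt.fderiv (hc hN), HasFDerivAt.fderiv hrs'.fst]
  have h8 := h5 (fderiv ℝ r p v) (fderiv ℝ r p w)
  rw [pullback_apply, h6, h6, hp] at h8
  exact h8

end Local

/-! ### The normal form in a vector space -/

section LocalNormalForm

variable {E : Type} [NormedAddCommGroup E] [NormedSpace ℝ E] [FiniteDimensional ℝ E]

theorem injective_fderiv_of_leftInverse {E F : Type*} [NormedAddCommGroup E] [NormedSpace ℝ E]
    [NormedAddCommGroup F] [NormedSpace ℝ F] {f : E → F} {g : F → E} {x : E}
    (hf : DifferentiableAt ℝ f x) (hg : DifferentiableAt ℝ g (f x))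
    (h : ∀ᶠ y in 𝓝 x, g (f y) = y) : Function.Injective (fderiv ℝ f x) := by
  have h1 := (hg.hasFDerivAt.comp x hf.hasFDerivAt).congr_of_eventuallyEq (f₁ := id)
    (h.mono fun y hy => hy.symm)
  intro v w hvw
  have h2 := fun v => DFunLike.congr_fun (h1.unique (hasFDerivAt_id x)) v
  simp only [ContinuousLinearMap.comp_apply, ContinuousLinearMap.id_apply] at h2
  rw [← h2 v, hvw, h2 w]

theorem hasFDerivAt_comp_of_eq {E F G : Type*} [NormedAddCommGroup E] [NormedSpace ℝ E]
    [NormedAddCommGroup F] [NormedSpace ℝ F] [NormedAddCommGroup G] [NormedSpace ℝ G]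
    {f : E → F} {g : F → G} {x : E} {y : F} {f' : E →L[ℝ] F} {g' : F →L[ℝ] G}
    (hg : HasFDerivAt g g' y) (hf : HasFDerivAt f f' x) (h : f x = y) :
    HasFDerivAt (fun z => g (f z)) (g' ∘L f') x := by
  subst h
  exact hg.comp x hf

/-- A slice transversal to a vector field `X`, tangent to the levels of `H`, that is parametrised by
`(s, u, v)` with `s = H - H(p₀)`. -/
theorem exists_slice (hE : Module.finrank ℝ E = 4) {H : E → ℝ} (hH : ContDiff ℝ ∞ H) (p₀ : E)
    {ξ : E} (hξ : ξ ≠ 0) (hξH : fderiv ℝ H p₀ ξ = 0) (hdH : fderiv ℝ H p₀ ≠ 0) :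
    ∃ (σ : ℝ × ℝ × ℝ → E) (ρ : E → ℝ × ℝ × ℝ), ContDiff ℝ ∞ σ ∧ ContDiff ℝ ∞ ρ ∧ σ 0 = p₀ ∧
      (∀ᶠ z in 𝓝 0, ρ (σ z) = z) ∧ (∀ᶠ z in 𝓝 0, H (σ z) = z.1 + H p₀) ∧
      ξ ∉ range (fderiv ℝ σ 0) := by
  set α := fderiv ℝ H p₀
  -- The slice will lie in the affine hyperplane `p₀ + ker ℓ`, which makes it transversal to `ξ`
  -- because `ℓ ξ = 1`.
  obtain ⟨ℓ, hℓ⟩ := SeparatingDual.exists_eq_one (R := ℝ) hξ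
  obtain ⟨e, he⟩ : ∃ e, α e ≠ 0 := by
    by_contra! h
    exact hdH (ContinuousLinearMap.ext h)
  obtain ⟨e₁, hα₁, hℓ₁⟩ : ∃ e₁, α e₁ = 1 ∧ ℓ e₁ = 0 := by
    refine ⟨(α e)⁻¹ • e - ((α e)⁻¹ * ℓ e) • ξ, ?_, ?_⟩
    · simp [hξH, he]
    · simp [hℓ]
  have hsurj : LinearMap.range (ℓ.prod α).toLinearMap = ⊤ := by
    rw [LinearMap.range_eq_top]
    rintro ⟨a, b⟩
    exact ⟨a • ξ + b • e₁, by simp [hℓ, hξH, hα₁, hℓ₁]⟩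
  have hker : Module.finrank ℝ (LinearMap.ker (ℓ.prod α).toLinearMap) = 2 := by
    have := LinearMap.finrank_range_add_finrank_ker (ℓ.prod α).toLinearMap
    rw [hsurj, finrank_top, hE, Module.finrank_prod, Module.finrank_self] at this
    omega
  let k : (ℝ × ℝ) ≃L[ℝ] LinearMap.ker (ℓ.prod α).toLinearMap :=
    ContinuousLinearEquiv.ofFinrankEq (by
      rw [hker, Module.finrank_prod, Module.finrank_self])
  have hk : ∀ w, ℓ (k w) = 0 ∧ α (k w) = 0 := fun w => Prod.mk.inj (k w).2
  let L : ℝ × ℝ × ℝ →L[ℝ] E := (ContinuousLinearMap.fst ℝ ℝ (ℝ × ℝ)).smulRight e₁ +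
    (LinearMap.ker (ℓ.prod α).toLinearMap).subtypeL ∘L k.toContinuousLinearMap ∘L
      ContinuousLinearMap.snd ℝ ℝ (ℝ × ℝ)
  have hL : ∀ z, L z = z.1 • e₁ + k z.2 := fun z => rfl
  have hLα : ∀ z, α (L z) = z.1 := fun z => by
    rw [hL, map_add, (hk z.2).2, map_smul, hα₁, add_zero, smul_eq_mul, mul_one]
  have hLℓ : ∀ z, ℓ (L z) = 0 := fun z => by
    rw [hL, map_add, (hk z.2).1, map_smul, hℓ₁, add_zero, smul_zero]
  have hLi : Function.Injective L := by
    rw [injective_iff_map_eq_zero]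
    intro z hz
    have h1 : z.1 = 0 := by rw [← hLα, hz, map_zero]
    rw [hL, h1, zero_smul, zero_add] at hz
    have h2 : z.2 = 0 := k.map_eq_zero_iff.1 (Subtype.ext hz)
    exact Prod.ext h1 h2
  obtain ⟨P, hP⟩ := LinearMap.exists_leftInverse_of_injective L.toLinearMap
    (LinearMap.ker_eq_bot.2 hLi)
  have hPL : ∀ z, P.toContinuousLinearMap (L z) = z := fun z => LinearMap.congr_fun hP z
  -- Replacing the first linear coordinate by `H - H p₀` has identity derivative at `0`; inverting
  -- `G` straightens the levels of `H` in the slice.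
  let G : ℝ × ℝ × ℝ → ℝ × ℝ × ℝ := fun z => (H (p₀ + L z) - H p₀, z.2)
  have hG : ContDiff ℝ ∞ G :=
    ((hH.comp (contDiff_const.add L.contDiff)).sub contDiff_const).prodMk contDiff_snd
  have hG0 : G 0 = 0 := by simp [G]
  have hGd : fderiv ℝ G 0 = ContinuousLinearMap.id ℝ _ := by
    have h1 : HasFDerivAt (fun z => p₀ + L z) L 0 := L.hasFDerivAt.const_add p₀
    have h2 := (hH.differentiable (by simp) (p₀ + L 0)).hasFDerivAt.comp 0 h1
    rw [HasFDerivAt.fderiv (f := G) ((h2.sub_const (H p₀)).prodMk hasFDerivAt_snd), map_zero, add_zero]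
    refine ContinuousLinearMap.ext fun z => Prod.ext (hLα z) rfl
  obtain ⟨g, hg, hg1, hg2⟩ := exists_contDiff_local_inverse hG 0
    (by rw [hGd]; exact Function.injective_id) rfl
  have hg0 : g 0 = 0 := by simpa [hG0] using hg1.self_of_nhds
  rw [hG0] at hg2
  have hLg : ContDiff ℝ ∞ fun z => L (g z) := L.contDiff.comp hg
  refine ⟨fun z => p₀ + L (g z), fun p => G (P.toContinuousLinearMap (p - p₀)),
    contDiff_const.add hLg, hG.comp (P.toContinuousLinearMap.contDiff.comp
      (contDiff_id.sub contDiff_const)), by simp [hg0], ?_, ?_, ?_⟩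
  · filter_upwards [hg2] with z hz
    rw [add_sub_cancel_left, hPL, hz]
  · filter_upwards [hg2] with z hz
    have h1 : H (p₀ + L (g z)) - H p₀ = z.1 := congrArg Prod.fst hz
    linarith
  · rintro ⟨ζ, hζ⟩
    have h1 := L.hasFDerivAt.comp 0 (hg.differentiable (by simp) 0).hasFDerivAt
    have h2 : HasFDerivAt (fun z => p₀ + L (g z)) _ 0 := h1.const_add p₀
    rw [h2.fderiv, ContinuousLinearMap.comp_apply] at hζ
    have h3 := hLℓ (fderiv ℝ g 0 ζ)
    rw [hζ, hℓ] at h3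
    exact one_ne_zero h3

/-- The restriction of a nondegenerate form to a surface transversal to `X` in a level of `H` does
not vanish. -/
theorem form_apply_ne_zero (hE : Module.finrank ℝ E = 4) {B : E →L[ℝ] E →L[ℝ] ℝ}
    (halt : ∀ v w, B v w = -B w v) (hnd : ∀ v, (∀ w, B v w = 0) → v = 0) {α : E →L[ℝ] ℝ} {ξ : E}
    (hξ : ∀ w, B ξ w = -α w) {L : ℝ × ℝ × ℝ →L[ℝ] E} (hL : Function.Injective L)
    (hLα : ∀ z, α (L z) = z.1) (hξL : ξ ∉ range L) : B (L (0, 1, 0)) (L (0, 0, 1)) ≠ 0 := by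
  intro h0
  let T : ℝ × ℝ × ℝ × ℝ →ₗ[ℝ] E := (LinearMap.fst ℝ ℝ (ℝ × ℝ × ℝ)).smulRight ξ +
    L.toLinearMap ∘ₗ LinearMap.snd ℝ ℝ (ℝ × ℝ × ℝ)
  have hT : ∀ q, T q = q.1 • ξ + L q.2 := fun q => rfl
  have hTi : Function.Injective T := by
    rw [injective_iff_map_eq_zero]
    rintro ⟨t, ζ⟩ h
    rw [hT] at h
    have ht : t = 0 := by
      by_contra ht
      refine hξL ⟨-(t⁻¹ • ζ), ?_⟩
      rw [map_neg, map_smul, eq_neg_of_add_eq_zero_right h, smul_neg, neg_neg, smul_smul,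
        inv_mul_cancel₀ ht, one_smul]
    simp only [ht, zero_smul, zero_add] at h
    rw [ht, (injective_iff_map_eq_zero _).1 hL ζ h]
    rfl
  have hTs : Function.Surjective T :=
    (LinearMap.injective_iff_surjective_of_finrank_eq_finrank (by simp [hE])).1 hTi
  -- If the value were `0`, the nonzero vector `L (0, 1, 0) + β ξ` would be in the kernel of `B`;
  -- `β` is chosen to cancel the pairing with `L (1, 0, 0)`.
  set β := B (L (0, 1, 0)) (L (1, 0, 0))
  have a0 : ∀ x, B x x = 0 := fun x => by linarith [halt x x]
  have hv := hnd (L (0, 1, 0) + β • ξ) fun w => by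
    obtain ⟨q, rfl⟩ := hTs w
    have e : L q.2 = q.2.1 • L (1, 0, 0) + q.2.2.1 • L (0, 1, 0) + q.2.2.2 • L (0, 0, 1) := by
      simp only [← map_smul, ← map_add]
      congr 1
      ext <;> simp
    rw [hT, e]
    simp only [map_add, map_smul, add_apply, smul_apply, smul_eq_mul, hξ, hLα,
      halt (L (0, 1, 0)) ξ, a0, h0]
    have : α ξ = 0 := by linarith [hξ ξ, a0 ξ]
    rw [this]
    simp only [β]
    ring
  have h1 : T (β, (0, 1, 0)) = 0 := by rw [hT, add_comm]; exact hv
  have h2 := (injective_iff_map_eq_zero _).1 hTi _ h1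
  simp at h2

/-- Nondegeneracy gives the coefficient of `du ∧ dv` a sign. Exchanging `u` and `v` reverses that
sign and preserves `uv`, so the negative case suffices. -/
theorem exists_canonical_of_slice (hE : Module.finrank ℝ E = 4)
    {B : E → E →L[ℝ] E →L[ℝ] ℝ} (hB : ContDiff ℝ ∞ B) {H K : E → ℝ} (hH : ContDiff ℝ ∞ H)
    (hK : ContDiff ℝ ∞ K) {X : E → E} (hX : ContDiff ℝ ∞ X) {σ : ℝ × ℝ × ℝ → E}
    (hσ : ContDiff ℝ ∞ σ)
    (halt : ∀ᶠ p in 𝓝 (σ 0), ∀ v w, B p v w = -B p w v)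
    (hcl : ∀ᶠ p in 𝓝 (σ 0), ∀ x y z,
      fderiv ℝ B p x y z + fderiv ℝ B p y z x + fderiv ℝ B p z x y = 0)
    (hnd : ∀ v, (∀ w, B (σ 0) v w = 0) → v = 0)
    (hXH : ∀ᶠ p in 𝓝 (σ 0), ∀ w, B p (X p) w = -fderiv ℝ H p w)
    (hXK : ∀ᶠ p in 𝓝 (σ 0), fderiv ℝ K p (X p) = 0)
    (hinj : Function.Injective (fderiv ℝ σ 0)) (hXσ : X (σ 0) ∉ range (fderiv ℝ σ 0))
    {a : ℝ} (hHσ : ∀ᶠ z in 𝓝 0, H (σ z) = z.1 + a)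
    {h₀ : ℝ → ℝ} (hh₀ : ContDiff ℝ ∞ h₀)
    (hKσ : ∀ᶠ z in 𝓝 0, K (σ z) = h₀ z.1 + z.2.1 * z.2.2) :
    ∃ (x y ξ η : E → ℝ) (Φ : ℝ × ℝ → ℝ), ContDiff ℝ ∞ x ∧ ContDiff ℝ ∞ y ∧ ContDiff ℝ ∞ ξ ∧
      ContDiff ℝ ∞ η ∧ ContDiff ℝ ∞ Φ ∧ 0 < deriv (fun t : ℝ => Φ (0, t)) 0 ∧
      x (σ 0) = 0 ∧ y (σ 0) = 0 ∧ ξ (σ 0) = 0 ∧ η (σ 0) = 0 ∧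
      ∀ᶠ p in 𝓝 (σ 0), H p = ξ p + a ∧ K p = Φ (ξ p, y p * η p) ∧
        ∀ v w, B p v w =
          (fderiv ℝ ξ p v * fderiv ℝ x p w - fderiv ℝ x p v * fderiv ℝ ξ p w) +
          (fderiv ℝ η p v * fderiv ℝ y p w - fderiv ℝ y p v * fderiv ℝ η p w) := by
  have hσα : ∀ z, fderiv ℝ H (σ 0) (fderiv ℝ σ 0 z) = z.1 := fun z => by
    have h1 := ((hH.differentiable (by simp) (σ 0)).hasFDerivAt.comp 0
      (hσ.differentiable (by simp) 0).hasFDerivAt).congr_of_eventuallyEq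
      (hHσ.mono fun z hz => hz.symm)
    exact DFunLike.congr_fun (h1.unique
      ((ContinuousLinearMap.fst ℝ ℝ (ℝ × ℝ)).hasFDerivAt.add_const a)) z
  rcases lt_or_gt_of_ne (form_apply_ne_zero hE halt.self_of_nhds hnd hXH.self_of_nhds hinj hσα hXσ)
    with hneg | hpos
  · exact exists_canonical_of_slice_of_neg hE hB hH hK hX hσ halt hcl hXH hXK hinj hXσ hHσ hh₀ hKσ
      hneg
  · let s : (ℝ × ℝ × ℝ) ≃L[ℝ] ℝ × ℝ × ℝ :=
      (ContinuousLinearEquiv.refl ℝ ℝ).prodCongr (ContinuousLinearEquiv.prodComm ℝ ℝ ℝ)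
    have hs : ∀ z, s z = (z.1, z.2.2, z.2.1) := fun z => rfl
    have hsc : Filter.Tendsto s (𝓝 0) (𝓝 0) := s.continuous.tendsto' _ _ (map_zero s)
    have hs0 : (σ ∘ s) 0 = σ 0 := by simp
    have hd : fderiv ℝ (σ ∘ s) 0 = fderiv ℝ σ 0 ∘L s.toContinuousLinearMap := by
      have := (hσ.differentiable (by simp) (s 0)).hasFDerivAt.comp 0 s.hasFDerivAt
      rw [this.fderiv, map_zero]
    have := exists_canonical_of_slice_of_neg (σ := σ ∘ s) (a := a) (h₀ := h₀) hE hB hH hK hX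
      (hσ.comp s.contDiff)
    rw [hs0, hd] at this
    refine this halt hcl hXH hXK (hinj.comp s.injective) ?_ ?_ hh₀ ?_ ?_
    · rintro ⟨z, hz⟩
      exact hXσ ⟨s z, hz⟩
    · filter_upwards [hsc.eventually hHσ] with z hz
      exact hz
    · filter_upwards [hsc.eventually hKσ] with z hz
      exact hz.trans (by rw [hs, mul_comm])
    · simp only [ContinuousLinearMap.comp_apply, ContinuousLinearEquiv.coe_coe, hs]
      rw [halt.self_of_nhds]
      exact neg_neg_of_pos hpos

/-- The local normal form of a saddle system. -/
theorem exists_canonical_coordinates (hE : Module.finrank ℝ E = 4)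
    {B : E → E →L[ℝ] E →L[ℝ] ℝ} (hB : ContDiff ℝ ∞ B) {H K : E → ℝ} (hH : ContDiff ℝ ∞ H)
    (hK : ContDiff ℝ ∞ K) {X : E → E} (hX : ContDiff ℝ ∞ X) {p₀ : E}
    (halt : ∀ᶠ p in 𝓝 p₀, ∀ v w, B p v w = -B p w v)
    (hcl : ∀ᶠ p in 𝓝 p₀, ∀ x y z,
      fderiv ℝ B p x y z + fderiv ℝ B p y z x + fderiv ℝ B p z x y = 0)
    (hnd : ∀ v, (∀ w, B p₀ v w = 0) → v = 0)
    (hXH : ∀ᶠ p in 𝓝 p₀, ∀ w, B p (X p) w = -fderiv ℝ H p w)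
    (hXK : ∀ᶠ p in 𝓝 p₀, fderiv ℝ K p (X p) = 0)
    (hdH : fderiv ℝ H p₀ ≠ 0) (hcrit : ∀ v, fderiv ℝ H p₀ v = 0 → fderiv ℝ K p₀ v = 0)
    (hsaddle : ∀ (τ : ℝ × ℝ → E) (ρ : E → ℝ × ℝ), ContDiff ℝ ∞ τ → ContDiff ℝ ∞ ρ → τ 0 = p₀ →
      (∀ᶠ w in 𝓝 0, ρ (τ w) = w) → (∀ᶠ w in 𝓝 0, H (τ w) = H p₀) →
      X p₀ ∉ range (fderiv ℝ τ 0) → fderiv ℝ (K ∘ τ) 0 = 0 →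
      (∃ v, 0 < hessian (K ∘ τ) 0 v v) ∧ ∃ w, hessian (K ∘ τ) 0 w w < 0) :
    ∃ (x y ξ η : E → ℝ) (Φ : ℝ × ℝ → ℝ), ContDiff ℝ ∞ x ∧ ContDiff ℝ ∞ y ∧ ContDiff ℝ ∞ ξ ∧
      ContDiff ℝ ∞ η ∧ ContDiff ℝ ∞ Φ ∧ 0 < deriv (fun t : ℝ => Φ (0, t)) 0 ∧
      x p₀ = 0 ∧ y p₀ = 0 ∧ ξ p₀ = 0 ∧ η p₀ = 0 ∧
      ∀ᶠ p in 𝓝 p₀, H p = ξ p + H p₀ ∧ K p = Φ (ξ p, y p * η p) ∧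
        ∀ v w, B p v w =
          (fderiv ℝ ξ p v * fderiv ℝ x p w - fderiv ℝ x p v * fderiv ℝ ξ p w) +
          (fderiv ℝ η p v * fderiv ℝ y p w - fderiv ℝ y p v * fderiv ℝ η p w) := by
  have hX0 : X p₀ ≠ 0 := fun h => hdH <| ContinuousLinearMap.ext fun w => by
    have := hXH.self_of_nhds w
    rw [h, map_zero] at this
    simpa using this.symm
  have hXX : fderiv ℝ H p₀ (X p₀) = 0 := by
    linarith [halt.self_of_nhds (X p₀) (X p₀), hXH.self_of_nhds (X p₀)]
  obtain ⟨σ, ρ, hσ, hρ, hσ0, hρσ, hHσ, hXσ⟩ := exists_slice hE hH p₀ hX0 hXX hdH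
  let ι : ℝ × ℝ →L[ℝ] ℝ × ℝ × ℝ := ContinuousLinearMap.inr ℝ ℝ (ℝ × ℝ)
  have hιc : Filter.Tendsto ι (𝓝 0) (𝓝 0) := ι.continuous.tendsto' _ _ (map_zero ι)
  have hσι : HasFDerivAt (fun w => σ (ι w)) (fderiv ℝ σ 0 ∘L ι) 0 :=
    hasFDerivAt_comp_of_eq (hσ.differentiable (by simp) 0).hasFDerivAt ι.hasFDerivAt (map_zero ι)
  have hHd : HasFDerivAt (fun w => H (σ (ι w))) (fderiv ℝ H p₀ ∘L fderiv ℝ σ 0 ∘L ι) 0 :=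
    hasFDerivAt_comp_of_eq (hH.differentiable (by simp) p₀).hasFDerivAt hσι (by simp [hσ0])
  have hKd : HasFDerivAt (fun w => K (σ (ι w))) (fderiv ℝ K p₀ ∘L fderiv ℝ σ 0 ∘L ι) 0 :=
    hasFDerivAt_comp_of_eq (hK.differentiable (by simp) p₀).hasFDerivAt hσι (by simp [hσ0])
  have hHι : ∀ᶠ w in 𝓝 0, H (σ (ι w)) = H p₀ := by
    filter_upwards [hιc.eventually hHσ] with w hw
    exact hw.trans (zero_add _)
  have hcr : fderiv ℝ (fun w => K (σ (ι w))) 0 = 0 := by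
    rw [hKd.fderiv]
    refine ContinuousLinearMap.ext fun w => hcrit _ ?_
    exact DFunLike.congr_fun ((hHd.congr_of_eventuallyEq (hHι.mono fun w hw => hw.symm)).unique
      (hasFDerivAt_const (H p₀) 0)) w
  -- The saddle hypothesis is applied to the surface `s = 0` of the slice.
  obtain ⟨hp, hn⟩ := hsaddle (fun w => σ (ι w)) (fun p => (ρ p).2) (hσ.comp ι.contDiff)
    (contDiff_snd.comp hρ) (by simp [hσ0])
    ((hιc.eventually hρσ).mono fun w hw => congrArg Prod.snd hw) hHι
    (by
      rw [hσι.fderiv]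
      rintro ⟨w, hw⟩
      exact hXσ ⟨ι w, hw⟩) hcr
  obtain ⟨S, S', h₀, hS, hS', hh₀, hS0, hSS, hS1, hKS⟩ :=
    exists_morse_saddle (h := fun z => K (σ z)) (hK.comp hσ) hcr hp hn
  have hSc : Filter.Tendsto S (𝓝 0) (𝓝 0) := by
    have := hS.continuous.continuousAt (x := (0 : ℝ × ℝ × ℝ))
    rwa [ContinuousAt, hS0] at this
  have hσS : HasFDerivAt (fun z => σ (S z)) (fderiv ℝ σ 0 ∘L fderiv ℝ S 0) 0 :=
    hasFDerivAt_comp_of_eq (hσ.differentiable (by simp) 0).hasFDerivAt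
      (hS.differentiable (by simp) 0).hasFDerivAt hS0
  have h0 : σ (S 0) = p₀ := by rw [hS0, hσ0]
  have := exists_canonical_of_slice (σ := fun z => σ (S z)) (a := H p₀) (h₀ := h₀) hE hB hH hK hX
    (hσ.comp hS)
  simp only [h0] at this
  refine this halt hcl hnd hXH hXK ?_ ?_ ?_ hh₀ hKS
  · refine injective_fderiv_of_leftInverse (g := fun p => S' (ρ p)) hσS.differentiableAt
      ((hS'.comp hρ).differentiable (by simp) _) ?_
    filter_upwards [hSS, hSc.eventually hρσ] with z h1 h2
    rw [h2, h1]
  · rw [hσS.fderiv]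
    rintro ⟨w, hw⟩
    exact hXσ ⟨_, hw⟩
  · filter_upwards [hS1, hSc.eventually hHσ] with z h1 h2
    rw [h2, h1]

end LocalNormalForm

/-! ### Alternating forms as bilinear forms, and dual vector fields -/

section Forms

variable {E : Type*} [NormedAddCommGroup E] [NormedSpace ℝ E]

theorem map_two_add (ω₂ : E [⋀^Fin 2]→L[ℝ] ℝ) (v w w' : E) :
    ω₂ ![v, w + w'] = ω₂ ![v, w] + ω₂ ![v, w'] := by
  have h := ω₂.map_update_add ![v, w] 1 w w'
  have e : ∀ z, Function.update ![v, w] 1 z = ![v, z] := by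
    intro z; ext i; fin_cases i <;> simp
  simpa only [e] using h

theorem map_two_smul (ω₂ : E [⋀^Fin 2]→L[ℝ] ℝ) (c : ℝ) (v w : E) :
    ω₂ ![v, c • w] = c * ω₂ ![v, w] := by
  have h := ω₂.map_update_smul ![v, w] 1 c w
  have e : ∀ z, Function.update ![v, w] 1 z = ![v, z] := by
    intro z; ext i; fin_cases i <;> simp
  simpa only [e, smul_eq_mul] using h

theorem map_two_swap (ω₂ : E [⋀^Fin 2]→L[ℝ] ℝ) (v w : E) : ω₂ ![v, w] = -ω₂ ![w, v] := by
  have h := ω₂.toAlternatingMap.map_swap ![w, v] (i := 0) (j := 1) (by simp)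
  have e : ![w, v] ∘ Equiv.swap (0 : Fin 2) 1 = ![v, w] := by
    ext i; fin_cases i <;> simp
  rw [e] at h
  exact h

/-- The bilinear form of an alternating form. -/
def bilinearForm [FiniteDimensional ℝ E] (ω₂ : E [⋀^Fin 2]→L[ℝ] ℝ) : E →L[ℝ] E →L[ℝ] ℝ :=
  LinearMap.toContinuousLinearMap (LinearMap.toContinuousLinearMap.toLinearMap ∘ₗ
    LinearMap.mk₂ ℝ (fun v w => ω₂ ![v, w])
      (fun v v' w => ω₂.toAlternatingMap.map_vecCons_add ![w] v v')
      (fun c v w => ω₂.toAlternatingMap.map_vecCons_smul ![w] c v)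
      (map_two_add ω₂) (fun c => map_two_smul ω₂ c))

theorem bilinearForm_apply [FiniteDimensional ℝ E] (ω₂ : E [⋀^Fin 2]→L[ℝ] ℝ) (v w : E) :
    bilinearForm ω₂ v w = ω₂ ![v, w] := rfl

theorem contDiffOn_bilinearForm [FiniteDimensional ℝ E] {θ : E → E [⋀^Fin 2]→L[ℝ] ℝ} {U : Set E}
    (hθ : ContDiffOn ℝ ∞ θ U) : ContDiffOn ℝ ∞ (fun q => bilinearForm (θ q)) U := by
  refine contDiffOn_clm_apply.2 fun v => contDiffOn_clm_apply.2 fun w => ?_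
  exact (ContinuousAlternatingMap.apply ℝ E ℝ ![v, w]).contDiff.comp_contDiffOn hθ

/-- In the formula for the exterior derivative on three vectors, antisymmetry turns the alternating
sum into the cyclic one. -/
theorem fderiv_bilinearForm_cyclic [FiniteDimensional ℝ E] {θ : E → E [⋀^Fin 2]→L[ℝ] ℝ} {q : E}
    (hθ : DifferentiableAt ℝ θ q) (hB : DifferentiableAt ℝ (fun q => bilinearForm (θ q)) q)
    (h : extDeriv θ q = 0) (x y z : E) :
    fderiv ℝ (fun q => bilinearForm (θ q)) q x y z + fderiv ℝ (fun q => bilinearForm (θ q)) q y z x +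
      fderiv ℝ (fun q => bilinearForm (θ q)) q z x y = 0 := by
  have h1 := extDeriv_apply hθ ![x, y, z]
  have h2 : ∀ x y z : E, fderiv ℝ (fun q => bilinearForm (θ q)) q x y z =
      fderiv ℝ (fun q => θ q ![y, z]) q x := fun x y z => by
    have := (hB.hasFDerivAt.clm_apply (hasFDerivAt_const y q)).clm_apply (hasFDerivAt_const z q)
    rw [HasFDerivAt.fderiv (f := fun q => θ q ![y, z]) this]
    simp
  have h3 : fderiv ℝ (fun q => θ q ![x, z]) q y = -fderiv ℝ (fun q => θ q ![z, x]) q y := by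
    simp_rw [map_two_swap _ x z, fderiv_fun_neg]
    rfl
  have e0 : (0 : Fin 3).removeNth ![x, y, z] = ![y, z] := by
    ext i; fin_cases i <;> rfl
  have e1 : (1 : Fin 3).removeNth ![x, y, z] = ![x, z] := by
    ext i; fin_cases i <;> rfl
  have e2 : (2 : Fin 3).removeNth ![x, y, z] = ![x, y] := by
    ext i; fin_cases i <;> rfl
  rw [h, Fin.sum_univ_three, e0, e1, e2] at h1
  simp only [Fin.val_zero, Fin.val_one, Fin.val_two, pow_zero, pow_one, Matrix.cons_val, h3, one_smul,
    neg_smul, neg_neg, even_two, Even.neg_pow, one_pow] at h1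
  change 0 = _ at h1
  rw [h2, h2, h2]
  linarith

/-- The vector field dual to a 1-form with respect to a nondegenerate 2-form. -/
theorem exists_dual_field [FiniteDimensional ℝ E] {B : E → E →L[ℝ] E →L[ℝ] ℝ}
    (hB : ContDiff ℝ ∞ B) {α : E → E →L[ℝ] ℝ} (hα : ContDiff ℝ ∞ α) {p₀ : E}
    (hnd : ∀ v, (∀ w, B p₀ v w = 0) → v = 0) :
    ∃ X : E → E, ContDiff ℝ ∞ X ∧ ∀ᶠ p in 𝓝 p₀, ∀ w, B p (X p) w = α p w := by
  have hinj : Function.Injective (B p₀) := (injective_iff_map_eq_zero _).2 fun v hv =>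
    hnd v fun w => by rw [hv]; rfl
  have hdim : Module.finrank ℝ E = Module.finrank ℝ (E →L[ℝ] ℝ) := by
    rw [← (LinearMap.toContinuousLinearMap (𝕜 := ℝ) (E := E) (F' := ℝ)).finrank_eq]
    exact Subspace.dual_finrank_eq.symm
  let e₀ : E ≃L[ℝ] (E →L[ℝ] ℝ) :=
    (LinearEquiv.ofInjectiveOfFinrankEq (B p₀).toLinearMap hinj hdim).toContinuousLinearEquiv
  let U : Set E := B ⁻¹' range ((↑) : (E ≃L[ℝ] (E →L[ℝ] ℝ)) → E →L[ℝ] E →L[ℝ] ℝ)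
  have hU : IsOpen U := ContinuousLinearEquiv.isOpen.preimage hB.continuous
  have hp₀ : p₀ ∈ U := ⟨e₀, by ext v w; rfl⟩
  have hinv : ContDiffOn ℝ ∞ (fun p => ContinuousLinearMap.inverse (B p) (α p)) U := by
    rintro p ⟨e, he⟩
    have h1 := (he ▸ contDiffAt_map_inverse e : ContDiffAt ℝ ∞ ContinuousLinearMap.inverse (B p))
    exact ((h1.comp p hB.contDiffAt).clm_apply hα.contDiffAt).contDiffWithinAt
  obtain ⟨X, hX, hXe⟩ := exists_contDiff_eventuallyEq (hU.mem_nhds hp₀) hinv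
  refine ⟨X, hX, ?_⟩
  filter_upwards [hXe, hU.mem_nhds hp₀] with p h1 h2 w
  obtain ⟨e, he⟩ := h2
  rw [h1, ← he, ContinuousLinearMap.inverse_equiv]
  simp

end Forms

/-! ### Changes of chart in the maximal atlas -/

section Charts

variable {M : Type*} [TopologicalSpace M] [ChartedSpace R4 M]

theorem mem_contDiffGroupoid_of_contDiffOn {κ : OpenPartialHomeomorph R4 R4}
    (h : ContDiffOn ℝ ∞ κ κ.source) (h' : ContDiffOn ℝ ∞ κ.symm κ.target) :
    κ ∈ contDiffGroupoid ∞ (𝓡 4) := by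
  refine mem_groupoid_of_pregroupoid.2 ⟨?_, ?_⟩
  · simpa [contDiffPregroupoid] using h
  · simpa [contDiffPregroupoid] using h'

theorem trans_mem_maximalAtlas [IsManifold (𝓡 4) ∞ M] {e : OpenPartialHomeomorph M R4}
    (he : e ∈ IsManifold.maximalAtlas (𝓡 4) ∞ M) {κ : OpenPartialHomeomorph R4 R4}
    (hκ : κ ∈ contDiffGroupoid ∞ (𝓡 4)) :
    e ≫ₕ κ ∈ IsManifold.maximalAtlas (𝓡 4) ∞ M := by
  refine mem_maximalAtlas_iff.2 fun e' he' => ?_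
  have h := mem_maximalAtlas_iff.1 he e' he'
  constructor
  · rw [OpenPartialHomeomorph.trans_symm_eq_symm_trans_symm, OpenPartialHomeomorph.trans_assoc]
    exact StructureGroupoid.trans _ (StructureGroupoid.symm _ hκ) h.1
  · rw [← OpenPartialHomeomorph.trans_assoc]
    exact StructureGroupoid.trans _ h.2 hκ

end Charts

/-! ### Hamiltonian data read in a chart -/

section Transfer

variable {M : Type*} [TopologicalSpace M] [ChartedSpace R4 M]

/-- The derivative of the inverse of a chart. -/
def chartDeriv (e : OpenPartialHomeomorph M R4) (q : R4) :
    R4 →L[ℝ] TangentSpace (𝓡 4) (e.symm q) :=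
  mfderiv (𝓡 4) (𝓡 4) e.symm q

theorem chartDeriv_bijective {e : OpenPartialHomeomorph M R4} [IsManifold (𝓡 4) ∞ M]
    (he : e.MDifferentiable (𝓡 4) (𝓡 4)) {q : R4} (hq : q ∈ e.target) :
    Function.Bijective (chartDeriv e q) :=
  he.symm.mfderiv_bijective (x := q) hq

theorem inChart_apply (Ω : TwoForm M) (e : OpenPartialHomeomorph M R4) (q v w : R4) :
    inChart Ω e q ![v, w] = Ω (e.symm q) ![chartDeriv e q v, chartDeriv e q w] := by
  refine congrArg (Ω (e.symm q)) (funext fun i => ?_)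
  fin_cases i <;> rfl

theorem fderiv_comp_chart_symm {e : OpenPartialHomeomorph M R4} [IsManifold (𝓡 4) ∞ M]
    (he : e.MDifferentiable (𝓡 4) (𝓡 4)) {H : M → ℝ} (hH : ContMDiff (𝓡 4) 𝓘(ℝ, ℝ) ∞ H) {q : R4}
    (hq : q ∈ e.target) (v : R4) :
    fderiv ℝ (H ∘ e.symm) q v =
      mfderiv (𝓡 4) 𝓘(ℝ, ℝ) H (e.symm q) (chartDeriv e q v) := by
  rw [← mfderiv_eq_fderiv, mfderiv_comp q ((hH.mdifferentiable (by simp)) _)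
    (he.mdifferentiableAt_symm hq)]
  rfl

theorem eq_zero_of_inChart_eq_zero (Ω : SymplecticForm M) {e : OpenPartialHomeomorph M R4}
    [IsManifold (𝓡 4) ∞ M] (he : e.MDifferentiable (𝓡 4) (𝓡 4)) {q : R4} (hq : q ∈ e.target)
    {v : R4} (h : ∀ w, inChart Ω.form e q ![v, w] = 0) : v = 0 := by
  have hb := chartDeriv_bijective he hq
  have h1 := Ω.nondegenerate (e.symm q) (chartDeriv e q v) fun w => by
    obtain ⟨w, rfl⟩ := hb.2 w
    rw [← inChart_apply, h]
  exact hb.1 (h1.trans (map_zero _).symm)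

/-- The Hamiltonian vector field in a chart. -/
theorem hamiltonianField_eq (Ω : SymplecticForm M) {e : OpenPartialHomeomorph M R4}
    [IsManifold (𝓡 4) ∞ M] (he : e.MDifferentiable (𝓡 4) (𝓡 4)) {H : M → ℝ}
    (hH : ContMDiff (𝓡 4) 𝓘(ℝ, ℝ) ∞ H) {q : R4} (hq : q ∈ e.target) {ξ : R4}
    (hξ : ∀ w, inChart Ω.form e q ![ξ, w] = -fderiv ℝ (H ∘ e.symm) q w) :
    Ω.hamiltonianField H (e.symm q) = chartDeriv e q ξ := by
  have hb := chartDeriv_bijective he hq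
  obtain ⟨ζ, hζ⟩ := hb.2 (Ω.hamiltonianField H (e.symm q))
  rw [← hζ]
  congr 1
  rw [← sub_eq_zero]
  refine eq_zero_of_inChart_eq_zero Ω he hq fun w => ?_
  have h1 : inChart Ω.form e q ![ζ, w] = -fderiv ℝ (H ∘ e.symm) q w := by
    rw [inChart_apply, hζ, Ω.form_hamiltonianField, fderiv_comp_chart_symm he hH hq]
    rfl
  rw [← bilinearForm_apply, map_sub, sub_apply, bilinearForm_apply, bilinearForm_apply,
    h1, hξ, sub_self]

/-- With these signs `dK(X_H) = {H, K}`, so `K` is constant along the field of `H`. -/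
theorem fderiv_comp_chart_symm_eq_zero (Ω : SymplecticForm M) {e : OpenPartialHomeomorph M R4}
    [IsManifold (𝓡 4) ∞ M] (he : e.MDifferentiable (𝓡 4) (𝓡 4)) {H K : M → ℝ}
    (hH : ContMDiff (𝓡 4) 𝓘(ℝ, ℝ) ∞ H) (hK : ContMDiff (𝓡 4) 𝓘(ℝ, ℝ) ∞ K) {q : R4}
    (hq : q ∈ e.target) {ξ : R4}
    (hξ : ∀ w, inChart Ω.form e q ![ξ, w] = -fderiv ℝ (H ∘ e.symm) q w)
    (hP : Ω.poissonBracket H K (e.symm q) = 0) : fderiv ℝ (K ∘ e.symm) q ξ = 0 := by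
  rw [fderiv_comp_chart_symm he hK hq, ← hamiltonianField_eq Ω he hH hq hξ]
  have h1 := Ω.form_hamiltonianField K (e.symm q) (Ω.hamiltonianField H (e.symm q))
  have h2 := map_two_swap (E := R4) (Ω.form (e.symm q)) (Ω.hamiltonianField K (e.symm q))
    (Ω.hamiltonianField H (e.symm q))
  have h3 : differential K (e.symm q) (Ω.hamiltonianField H (e.symm q)) = 0 := by
    rw [SymplecticForm.poissonBracket] at hP
    have h4 : Ω.form (e.symm q) ![Ω.hamiltonianField K (e.symm q), Ω.hamiltonianField H (e.symm q)]
        = 0 := h2.trans (neg_eq_zero.2 hP)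
    linarith
  exact h3

/-- At a critical point of the momentum map, `dH₂` is a multiple of `dH₁ ≠ 0`. -/
theorem mfderiv_eq_zero_of_critical [IsManifold (𝓡 4) ∞ M] {H K : M → ℝ}
    (hH : ContMDiff (𝓡 4) 𝓘(ℝ, ℝ) ∞ H) (hK : ContMDiff (𝓡 4) 𝓘(ℝ, ℝ) ∞ K) {m : M}
    (hdH : differential H m ≠ 0)
    (hcr : ¬ Function.Surjective (mfderiv (𝓡 4) 𝓘(ℝ, ℝ × ℝ) (momentumMap H K) m))
    (v : TangentSpace (𝓡 4) m) (hv : mfderiv (𝓡 4) 𝓘(ℝ, ℝ) H m v = 0) :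
    mfderiv (𝓡 4) 𝓘(ℝ, ℝ) K m v = 0 := by
  by_contra hKv
  have hF : MDifferentiableAt (𝓡 4) 𝓘(ℝ, ℝ × ℝ) (momentumMap H K) m :=
    (hH.prodMk_space hK).mdifferentiable (by simp) m
  have h1 : ∀ w, (mfderiv (𝓡 4) 𝓘(ℝ, ℝ × ℝ) (momentumMap H K) m w : ℝ × ℝ).1 =
      mfderiv (𝓡 4) 𝓘(ℝ, ℝ) H m w := fun w => by
    have := mfderiv_comp m (ContinuousLinearMap.fst ℝ ℝ ℝ).mdifferentiableAt hF
    rw [mfderiv_eq_fderiv, ContinuousLinearMap.fderiv] at this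
    exact (DFunLike.congr_fun this w).symm
  have h2 : ∀ w, (mfderiv (𝓡 4) 𝓘(ℝ, ℝ × ℝ) (momentumMap H K) m w : ℝ × ℝ).2 =
      mfderiv (𝓡 4) 𝓘(ℝ, ℝ) K m w := fun w => by
    have := mfderiv_comp m (ContinuousLinearMap.snd ℝ ℝ ℝ).mdifferentiableAt hF
    rw [mfderiv_eq_fderiv, ContinuousLinearMap.fderiv] at this
    exact (DFunLike.congr_fun this w).symm
  obtain ⟨u, hu⟩ : ∃ u, differential H m u ≠ 0 := by
    by_contra! h
    exact hdH (LinearMap.ext h)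
  set dH : TangentSpace (𝓡 4) m →ₗ[ℝ] ℝ := differential H m
  set dK : TangentSpace (𝓡 4) m →ₗ[ℝ] ℝ := differential K m
  have hv' : dH v = 0 := hv
  have hKv' : dK v ≠ 0 := hKv
  refine hcr fun c => ?_
  obtain ⟨a, b⟩ : ℝ × ℝ := c
  -- As `dH v = 0`, the system for the two components is triangular in `u`, `v` and is solved for an
  -- arbitrary target, contradicting criticality.
  refine ⟨(a / dH u) • u + ((b - a / dH u * dK u) / dK v) • v, Prod.ext ?_ ?_⟩
  · refine (h1 _).trans ?_
    change dH _ = a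
    rw [map_add, map_smul, map_smul, hv', smul_zero, add_zero, smul_eq_mul, div_mul_cancel₀ _ hu]
  · refine (h2 _).trans ?_
    change dK _ = b
    rw [map_add, map_smul, map_smul, smul_eq_mul, smul_eq_mul, div_mul_cancel₀ _ hKv']
    ring

/-- A surface in a chart that is tangent to the levels of `H` and transversal to `X_H` is a Poincaré
section. -/
theorem exists_isPoincareSection [IsManifold (𝓡 4) ∞ M] (Ω : SymplecticForm M)
    {e : OpenPartialHomeomorph M R4} (he : e ∈ IsManifold.maximalAtlas (𝓡 4) ∞ M)
    (hed : e.MDifferentiable (𝓡 4) (𝓡 4)) {H : M → ℝ} (hH : ContMDiff (𝓡 4) 𝓘(ℝ, ℝ) ∞ H)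
    {X : R4 → R4} (hX : Continuous X) {τ : ℝ × ℝ → R4} (hτ : ContDiff ℝ ∞ τ) {ρ : R4 → ℝ × ℝ}
    (hρ : ContDiff ℝ ∞ ρ) (h0 : τ 0 ∈ e.target) {a : ℝ}
    (hXH : ∀ᶠ q in 𝓝 (τ 0), ∀ w, inChart Ω.form e q ![X q, w] = -fderiv ℝ (H ∘ e.symm) q w)
    (hρτ : ∀ᶠ w in 𝓝 0, ρ (τ w) = w) (hHτ : ∀ᶠ w in 𝓝 0, H (e.symm (τ w)) = a)
    (hXτ : X (τ 0) ∉ range (fderiv ℝ τ 0)) :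
    ∃ V : Set (ℝ × ℝ), (0 : ℝ × ℝ) ∈ V ∧ Ω.IsPoincareSection H V (e.symm ∘ τ) := by
  -- Injectivity of `T w` expresses immersivity and transversality together, and it is an open
  -- condition on `w`.
  let T : ℝ × ℝ → ℝ × (ℝ × ℝ) →L[ℝ] R4 := fun w =>
    (ContinuousLinearMap.toSpanSingleton ℝ (X (τ w)) : ℝ →L[ℝ] R4).coprod (fderiv ℝ τ w : ℝ × ℝ →L[ℝ] R4)
  have hT : ∀ w q, T w q = q.1 • X (τ w) + fderiv ℝ τ w q.2 := fun w q => rfl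
  have hi : Function.Injective (fderiv ℝ τ 0) := injective_fderiv_of_leftInverse
    (hτ.differentiable (by simp) 0) (hρ.differentiable (by simp) _) hρτ
  have hTc : ∀ᶠ w in 𝓝 0, Function.Injective (T w) := by
    have hc : Continuous T := by
      refine continuous_clm_apply.2 fun q => ?_
      simp only [hT]
      have h2 := (contDiff_fderiv_apply_const hτ q.2).continuous
      have h3 := hX.comp hτ.continuous
      exact (h3.const_smul q.1).add h2
    have hT0 : Function.Injective (T 0) := by
      rw [injective_iff_map_eq_zero]
      rintro ⟨t, ζ⟩ h
      rw [hT] at h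
      have ht : t = 0 := by
        by_contra ht
        refine hXτ ⟨-(t⁻¹ • ζ), ?_⟩
        rw [map_neg, map_smul, eq_neg_of_add_eq_zero_right h, smul_neg, neg_neg, smul_smul,
          inv_mul_cancel₀ ht, one_smul]
      simp only [ht, zero_smul, zero_add] at h
      rw [ht, (injective_iff_map_eq_zero _).1 hi ζ h]
      rfl
    exact (ContinuousLinearMap.isOpen_injective.preimage hc).mem_nhds hT0
  have hτc : Filter.Tendsto τ (𝓝 0) (𝓝 (τ 0)) := hτ.continuous.continuousAt
  obtain ⟨V, hV, hVo, hV0⟩ := eventually_nhds_iff.1 (((hρτ.and hHτ).and (hTc.and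
    (hτc.eventually hXH))).and (hτc.eventually (e.open_target.mem_nhds h0)))
  have hdσ : ∀ w ∈ V, mfderiv 𝓘(ℝ, ℝ × ℝ) (𝓡 4) (e.symm ∘ τ) w =
      (chartDeriv e (τ w)).comp (fderiv ℝ τ w) := fun w hw =>
    (mfderiv_comp w (hed.mdifferentiableAt_symm (hV w hw).2)
      (hτ.differentiable (by simp) w).mdifferentiableAt).trans
      (congrArg (chartDeriv e (τ w)).comp mfderiv_eq_fderiv)
  have hbij : ∀ w ∈ V, Function.Injective (chartDeriv e (τ w)) := fun w hw =>
    (chartDeriv_bijective hed (hV w hw).2).1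
  refine ⟨V, hV0, hVo, ?_, ?_, ?_, ⟨a, fun w hw => (hV w hw).1.1.2⟩, ?_⟩
  · exact (contMDiffOn_symm_of_mem_maximalAtlas he).comp hτ.contMDiff.contMDiffOn
      fun w hw => (hV w hw).2
  · let f : V → e.source := fun w => ⟨e.symm (τ w), e.map_target (hV w w.2).2⟩
    have hf : Continuous f := by
      refine Continuous.subtype_mk ?_ _
      exact (e.continuousOn_symm.comp hτ.continuous.continuousOn fun w hw => (hV w hw).2).domRestrict
    have hg : Continuous fun p : e.source => ρ (e p) :=
      hρ.continuous.comp e.continuousOn.domRestrict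
    have hgf : IsEmbedding ((fun p : e.source => ρ (e p)) ∘ f) := by
      have : (fun p : e.source => ρ (e p)) ∘ f = Subtype.val := by
        ext1 w
        simp only [Function.comp_apply, f]
        rw [e.right_inv (hV w w.2).2, (hV w w.2).1.1.1]
      rw [this]
      exact IsEmbedding.subtypeVal
    exact IsEmbedding.subtypeVal.comp (IsEmbedding.of_comp hf hg hgf)
  · intro w hw
    rw [hdσ w hw]
    intro x y hxy
    have h1 : fderiv ℝ τ w x = fderiv ℝ τ w y := hbij w hw hxy
    have h2 := (hV w hw).1.2.1 (a₁ := (0, x)) (a₂ := (0, y)) (by rw [hT, hT, h1])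
    exact congrArg Prod.snd h2
  · intro w hw
    rw [hdσ w hw, Function.comp_apply,
      hamiltonianField_eq Ω hed hH (hV w hw).2 (hV w hw).1.2.2]
    rintro ⟨x, hx⟩
    have h1 : fderiv ℝ τ w x = X (τ w) := hbij w hw hx
    have h2 := (hV w hw).1.2.1 (a₁ := (1, 0)) (a₂ := (0, x)) (by simp [hT, h1])
    exact one_ne_zero (congrArg Prod.fst h2)

end Transfer

/-! ### From canonical relations to a canonical chart -/

section CanonicalChart

variable {M : Type*} [TopologicalSpace M] [ChartedSpace R4 M]

/-- Functions that satisfy the canonical relations in a chart are canonical coordinates. -/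
theorem exists_isCanonicalChartAt [IsManifold (𝓡 4) ∞ M] (Ω : SymplecticForm M)
    {e : OpenPartialHomeomorph M R4} (he : e ∈ IsManifold.maximalAtlas (𝓡 4) ∞ M)
    (hed : e.MDifferentiable (𝓡 4) (𝓡 4)) {m : M} (hm : m ∈ e.source) {G : R4 → R4}
    (hG : ContDiff ℝ ∞ G) (hG0 : G (e m) = 0)
    (hω : ∀ᶠ q in 𝓝 (e m), ∀ v w, inChart Ω.form e q ![v, w] =
      (fderiv ℝ G q v 2 * fderiv ℝ G q w 0 - fderiv ℝ G q v 0 * fderiv ℝ G q w 2) +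
      (fderiv ℝ G q v 3 * fderiv ℝ G q w 1 - fderiv ℝ G q v 1 * fderiv ℝ G q w 3))
    {P : R4 → Prop} (hP : ∀ᶠ q in 𝓝 (e m), P q) :
    ∃ χ : OpenPartialHomeomorph M R4, Ω.IsCanonicalChartAt χ m ∧
      ∀ p ∈ χ.source, p ∈ e.source ∧ P (e p) ∧ χ p = G (e p) := by
  -- By the canonical relation the kernel of `dG` lies in the kernel of `Ω`, so `G` is a local
  -- diffeomorphism.
  have hinj : Function.Injective (fderiv ℝ G (e m)) := by
    rw [injective_iff_map_eq_zero]
    intro v hv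
    refine eq_zero_of_inChart_eq_zero Ω hed (e.map_source hm) fun w => ?_
    rw [hω.self_of_nhds, hv]
    simp
  let G' : R4 ≃L[ℝ] R4 :=
    (LinearEquiv.ofInjectiveEndo (fderiv ℝ G (e m)).toLinearMap hinj).toContinuousLinearEquiv
  obtain ⟨κ, hκm, hκG, hκs, hκd⟩ := exists_openPartialHomeomorph_of_contDiff hG (e m) G'
    (hG.differentiable (by simp) (e m)).hasFDerivAt
  obtain ⟨U, hU, hUo, hUm⟩ := eventually_nhds_iff.1 (hω.and hP)
  let κ' := κ.restrOpen U hUo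
  have hκ's : κ'.source = κ.source ∩ U := κ.restrOpen_source U hUo
  have hκ'G : ∀ q, κ' q = G q := hκG
  have hsub : κ'.target ⊆ κ.target := fun q hq => by
    have := κ'.map_target hq
    rw [hκ's] at this
    rw [← κ'.right_inv hq]
    exact κ.map_source this.1
  have hκ'mem : κ' ∈ contDiffGroupoid ∞ (𝓡 4) := mem_contDiffGroupoid_of_contDiffOn
    (hG.contDiffOn.congr fun q _ => hκ'G q) (hκs.mono hsub)
  have hmem := trans_mem_maximalAtlas he hκ'mem
  refine ⟨e ≫ₕ κ', ⟨hmem, ?_, ?_, ?_⟩, ?_⟩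
  · rw [OpenPartialHomeomorph.trans_source, hκ's]
    exact ⟨hm, hκm, hUm⟩
  · exact (hκ'G _).trans hG0
  · intro q hq v w
    rw [OpenPartialHomeomorph.trans_target] at hq
    obtain ⟨hq1, hq2⟩ := hq
    have hs := κ'.map_target hq1
    rw [hκ's] at hs
    have hsU : κ.symm q ∈ U := hs.2
    have hd1 : DifferentiableAt ℝ κ.symm q :=
      (hκs.contDiffAt (κ.open_target.mem_nhds (hsub hq1))).differentiableAt (by simp)
    have hχ : ∀ v, chartDeriv (e ≫ₕ κ') q v = chartDeriv e (κ.symm q) (fderiv ℝ κ.symm q v) :=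
      fun v => DFunLike.congr_fun ((mfderiv_comp q (hed.mdifferentiableAt_symm hq2)
        hd1.mdifferentiableAt).trans
          (congrArg (chartDeriv e (κ.symm q)).comp mfderiv_eq_fderiv)) v
    have hid : ∀ v, fderiv ℝ G (κ.symm q) (fderiv ℝ κ.symm q v) = v := fun v => by
      have h1 := ((hG.differentiable (by simp) (κ.symm q)).hasFDerivAt.comp q
        hd1.hasFDerivAt).congr_of_eventuallyEq (f₁ := id) (by
          filter_upwards [κ.open_target.mem_nhds (hsub hq1)] with z hz
          exact (κ.right_inv hz).symm.trans (hκG _))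
      exact DFunLike.congr_fun (h1.unique (hasFDerivAt_id q)) v
    have h2 : inChart Ω.form (e ≫ₕ κ') q ![v, w] =
        inChart Ω.form e (κ.symm q) ![fderiv ℝ κ.symm q v, fderiv ℝ κ.symm q w] := by
      rw [inChart_apply, inChart_apply, hχ, hχ]
      rfl
    rw [h2, (hU _ hsU).1, hid, hid]
  · intro p hp
    rw [OpenPartialHomeomorph.trans_source, hκ's] at hp
    exact ⟨hp.1, (hU _ hp.2.2).2, hκ'G _⟩

end CanonicalChart

end SaddleSystem

end

/-! ### The normal form on the manifold -/

theorem mainTheorem12 {M : Type*} [TopologicalSpace M] [T2Space M] [SecondCountableTopology M]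
    [ChartedSpace SaddleSystem.R4 M] [IsManifold (𝓡 4) ∞ M]
    (Ω : SaddleSystem.SymplecticForm M) (H₁ H₂ : M → ℝ) (o : ℝ × ℝ)
    (hF : SaddleSystem.IsSaddleSystem Ω H₁ H₂ o)
    (C : Set M) (hC : SaddleSystem.IsCriticalCircle H₁ H₂ o C) (m : M) (hm : m ∈ C) :
    ∃ (χ : OpenPartialHomeomorph M SaddleSystem.R4) (W : Set (ℝ × ℝ)) (Φ : ℝ × ℝ → ℝ),
      Ω.IsCanonicalChartAt χ m ∧
      IsOpen W ∧ (0, 0) ∈ W ∧ ContDiffOn ℝ ∞ Φ W ∧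
      0 < deriv (fun t : ℝ => Φ (0, t)) 0 ∧
      ∀ p ∈ χ.source,
        H₁ p - o.1 = χ p 2 ∧
        (χ p 2, χ p 1 * χ p 3) ∈ W ∧
        H₂ p = Φ (χ p 2, χ p 1 * χ p 3) := by
  open SaddleSystem in
  obtain ⟨c, -, rfl⟩ := hC
  have hmcr : m ∈ criticalSet H₁ H₂ o := connectedComponentIn_subset _ _ hm
  have hmo : H₁ m = o.1 := congrArg Prod.fst hmcr.1
  let e := chartAt R4 m
  have hea : e ∈ atlas R4 M := chart_mem_atlas R4 m
  have he : e ∈ IsManifold.maximalAtlas (𝓡 4) ∞ M := IsManifold.chart_mem_maximalAtlas m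
  have hed : e.MDifferentiable (𝓡 4) (𝓡 4) := mdifferentiable_chart m
  have hms : m ∈ e.source := mem_chart_source R4 m
  have hmt : e m ∈ e.target := e.map_source hms
  have hem : e.symm (e m) = m := e.left_inv hms
  have htn : e.target ∈ 𝓝 (e m) := e.open_target.mem_nhds hmt
  have hB₀ := contDiffOn_bilinearForm (Ω.smooth e hea)
  -- The form and the two functions, read in a chart, are replaced by global smooth objects with the
  -- same germs at `e m`.
  obtain ⟨B, hB, hBe⟩ := exists_contDiff_eventuallyEq htn hB₀
  have hglob : ∀ {H : M → ℝ}, ContMDiff (𝓡 4) 𝓘(ℝ, ℝ) ∞ H →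
      ContDiffOn ℝ ∞ (H ∘ e.symm) e.target := fun hH =>
    (hH.comp_contMDiffOn (contMDiffOn_symm_of_mem_maximalAtlas he)).contDiffOn
  obtain ⟨H, hH, hHe⟩ := exists_contDiff_eventuallyEq htn (hglob hF.smooth₁)
  obtain ⟨K, hK, hKe⟩ := exists_contDiff_eventuallyEq htn (hglob hF.smooth₂)
  have hHm : H (e m) = o.1 := by rw [hHe.self_of_nhds, Function.comp_apply, hem, hmo]
  have hHd : ∀ᶠ q in 𝓝 (e m), fderiv ℝ H q = fderiv ℝ (H₁ ∘ e.symm) q :=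
    (eventually_eventually_nhds.2 hHe).mono fun q hq => Filter.EventuallyEq.fderiv_eq hq
  have hKd : ∀ᶠ q in 𝓝 (e m), fderiv ℝ K q = fderiv ℝ (H₂ ∘ e.symm) q :=
    (eventually_eventually_nhds.2 hKe).mono fun q hq => Filter.EventuallyEq.fderiv_eq hq
  have hnd : ∀ v, (∀ w, B (e m) v w = 0) → v = 0 := fun v hv => by
    refine eq_zero_of_inChart_eq_zero Ω hed hmt fun w => ?_
    rw [← bilinearForm_apply, ← hBe.self_of_nhds, hv]
  obtain ⟨X, hX, hXB⟩ := exists_dual_field hB (hH.fderiv_right (m := ∞) (by simp)).neg hnd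
  have hXH : ∀ᶠ q in 𝓝 (e m), ∀ w,
      inChart Ω.form e q ![X q, w] = -fderiv ℝ (H₁ ∘ e.symm) q w := by
    filter_upwards [hXB, hBe, hHd] with q h1 h2 h3 w
    rw [← bilinearForm_apply, ← h2, h1, ← h3]
    rfl
  have hdH : fderiv ℝ H (e m) ≠ 0 := fun h => by
    have hns : differential H₁ (e.symm (e m)) ≠ 0 := hem.symm ▸ hF.nonsingular m hmcr.1
    refine hns (LinearMap.ext fun v => ?_)
    obtain ⟨w, rfl⟩ := (chartDeriv_bijective hed hmt).2 v
    have h1 := fderiv_comp_chart_symm hed hF.smooth₁ hmt w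
    rw [← hHd.self_of_nhds, h] at h1
    exact h1.symm
  obtain ⟨x, y, ξ, η, Φ, hx, hy, hξ, hη, hΦ, hΦ0, hx0, hy0, hξ0, hη0, hall⟩ :=
    exists_canonical_coordinates (E := R4) (by simp) hB hH hK hX (p₀ := e m)
      (by
        filter_upwards [hBe] with q hq v w
        rw [hq, bilinearForm_apply, bilinearForm_apply, map_two_swap])
      (by
        filter_upwards [eventually_eventually_nhds.2 hBe, htn] with q hq ht u v w
        rw [Filter.EventuallyEq.fderiv_eq hq]
        exact fderiv_bilinearForm_cyclic
          (((Ω.smooth e hea).contDiffAt (e.open_target.mem_nhds ht)).differentiableAt (by simp))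
          ((hB₀.contDiffAt (e.open_target.mem_nhds ht)).differentiableAt (by simp))
          (Ω.closed e hea q ht) u v w)
      hnd hXB
      (by
        filter_upwards [hKd, hXH, htn] with q h1 h2 h3
        rw [h1]
        exact fderiv_comp_chart_symm_eq_zero Ω hed hF.smooth₁ hF.smooth₂ h3 h2 (hF.commute _))
      hdH
      (fun v hv => by
        rw [hHd.self_of_nhds, fderiv_comp_chart_symm hed hF.smooth₁ hmt] at hv
        rw [hKd.self_of_nhds, fderiv_comp_chart_symm hed hF.smooth₂ hmt]
        refine mfderiv_eq_zero_of_critical hF.smooth₁ hF.smooth₂ (hem.symm ▸ hF.nonsingular m hmcr.1)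
          (hem.symm ▸ hmcr.2) _ hv)
      -- The chart carries such a surface to a Poincaré section on `M`, and the Hessian depends only
      -- on the germ, so the saddle assumption on `H₂` passes to `K`.
      (fun τ ρ hτ hρ hτ0 hρτ hHτ hXτ hKτ => by
        rw [← hτ0] at hXH hHe hKe hmt hXτ
        have hτc : Filter.Tendsto τ (𝓝 0) (𝓝 (τ 0)) := hτ.continuous.continuousAt
        obtain ⟨V, hV0, hV⟩ := exists_isPoincareSection Ω he hed hF.smooth₁ hX.continuous hτ hρ
          hmt hXH hρτ (a := H (e m)) (by
            filter_upwards [hHτ, hτc.eventually hHe] with w h1 h2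
            rw [← h1, h2]
            rfl) hXτ
        have hKV : K ∘ τ =ᶠ[𝓝 0] H₂ ∘ e.symm ∘ τ := hτc.eventually hKe
        have hKf : ∀ v w, hessian (K ∘ τ) 0 v w = hessian (H₂ ∘ e.symm ∘ τ) 0 v w := fun v w => by
          rw [hessian, hKV.fderiv.fderiv_eq]
          rfl
        simp only [hKf]
        refine hF.saddle V _ hV 0 hV0 ?_ ?_
        · rw [Function.comp_apply, hτ0, hem]
          exact hmcr.1
        · rw [← hKτ]
          exact hKV.fderiv_eq.symm)
  let G : R4 → R4 := fun q => !₂[x q, y q, ξ q, η q]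
  have hG : ContDiff ℝ ∞ G := contDiff_euclidean.2 fun i => by
    fin_cases i <;> simpa [G]
  have hGd : ∀ q v i, fderiv ℝ G q v i = fderiv ℝ (fun q => G q i) q v := fun q v i => by
    have := (EuclideanSpace.proj (𝕜 := ℝ) i).hasFDerivAt.comp q
      (hG.differentiable (by simp) q).hasFDerivAt
    rw [HasFDerivAt.fderiv (f := fun q => G q i) this]
    rfl
  obtain ⟨χ, hχ, hχG⟩ := exists_isCanonicalChartAt Ω he hed hms hG
    (by
      ext i
      fin_cases i <;> simp [G, hx0, hy0, hξ0, hη0])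
    (by
      filter_upwards [hall, hBe] with q h1 h2 v w
      rw [← bilinearForm_apply, ← h2, h1.2.2]
      simp only [hGd]
      rfl)
    (hall.and (hHe.and hKe))
  -- `Φ` was built globally smooth, so its domain can be the whole plane.
  refine ⟨χ, univ, Φ, hχ, isOpen_univ, mem_univ _, hΦ.contDiffOn, hΦ0, fun p hp => ?_⟩
  obtain ⟨hps, ⟨⟨h1, h2, -⟩, h3, h4⟩, h5⟩ := hχG p hp
  rw [Function.comp_apply, e.left_inv hps] at h3 h4
  rw [h5]
  refine ⟨?_, mem_univ _, ?_⟩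
  · rw [← h3, h1, hHm, add_sub_cancel_right]
    rfl
  · rw [← h4, h2]
    rfl
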